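/- Let $k\ge 3$. Let $C=C_k=(c_{ij})_{1\le i,j\le k}$ be the generalized Cartan matrix of type $E_k$: $c_{ii}=2$, and for $i\ne j$ one has $c_{ij}=-1$ if the nodes $i,j$ are joined in the following diagram and $c_{ij}=0$ otherwise: the nodes $1,\dots,k-1$ form a line in this order, and the node $k$ is joined to the node $3$ only (to no node if $k=3$). Let $\mathfrak h_k$ be the real vector space with basis $h_0,\dots,h_k$ and the Minkowski inner product for which this basis is orthogonal, $(h_0,h_0)=-1$ and $(h_i,h_i)=1$ for $1\le i\le k$. Let $\varepsilon_j=(h_j,\cdot)\in\mathfrak h_k^*$, and put $$\alpha_i=\varepsilon_i-\varepsilon_{i+1},\quad \alpha_i^\vee=h_i-h_{i+1}\quad(1\le i\le k-1),\qquad \alpha_k=\varepsilon_0-\varepsilon_1-\varepsilon_2-\varepsilon_3,\quad \alpha_k^\vee=h_0-h_1-h_2-h_3,$$ and $K_k=-3h_0+\sum_{i=1}^k h_i$. For a field $F$ of characteristic $0$, an $F$-vector space $V$, and families $\beta_i\in V^*$, $\beta_i^\vee\in V$ $(1\le i\le k)$, let $\mathfrak g_F(V,\beta,\beta^\vee)$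 be the Lie algebra over $F$ generated by the vector space $V$ (with its linear structure) and $e_1,\dots,e_k,f_1,\dots,f_k$ with relations $[h,h']=0$, $[h,e_i]=\beta_i(h)e_i$, $[h,f_i]=-\beta_i(h)f_i$, $[e_i,f_j]=\delta_{ij}\beta_i^\vee$, and $\operatorname{ad}(e_i)^{1-a_{ij}}(e_j)=\operatorname{ad}(f_i)^{1-a_{ij}}(f_j)=0$ for $i\ne j$, where $a_{ij}=\beta_j(\beta_i^\vee)$. Put $\mathfrak g_k=\mathfrak g_{\mathbb R}(\mathfrak h_k,\alpha,\alpha^\vee)$. For $k\neq 9$ let $\mathfrak e_k(F)$ be the Lie algebra over $F$ with generators $h_i,e_i,f_i$ $(1\le i\le k)$ and relations $[h_i,h_j]=0$, $[h_i,e_j]=c_{ij}e_j$, $[h_i,f_j]=-c_{ij}f_j$, $[e_i,f_j]=\delta_{ij}h_i$, and $\operatorname{ad}(e_i)^{1-c_{ij}}(e_j)=\operatorname{ad}(f_i)^{1-c_{ij}}(f_j)=0$ for $i\ne j$; write $\mathfrak e_{k(k)}=\mathfrak e_k(\mathbb R)$ and $\mathfrak e_k=\mathfrak e_k(\mathbb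 C)$. For $k=9$, the Kac–Moody algebra of type $E_9$ over $F$ is $\mathfrak g_F(V,\beta,\beta^\vee)$ for a realization $(V,\beta,\beta^\vee)$ of $C_9$ over $F$, i.e. $V$ is finite-dimensional, the $\beta_i$ are linearly independent, the $\beta_i^\vee$ are linearly independent, $\beta_j(\beta_i^\vee)=c_{ij}$, and $\dim V=2\cdot 9-\operatorname{rank}C_9$; it is $\mathfrak e_{9(9)}$ for $F=\mathbb R$ and $\mathfrak e_9$ for $F=\mathbb C$. Then the following hold. (i) Let $3\le k\le 8$. Over $F=\mathbb R$ and over $F=\mathbb C$, $\mathfrak e_k(F)$ is a finite-dimensional semisimple Lie algebra with a splitting Cartan subalgebra whose root system has a base with Cartan matrix $C_k$. The algebra $\mathfrak e_{k(k)}$ is the standard split real form of $\mathfrak e_k$: there is an isomorphism $\mathbb C\otimes_{\mathbb R}\mathfrak e_{k(k)}\cong\mathfrak e_k$ matching the generators $h_i,e_i,f_i$. The algebra $\mathfrak g_k$ is the trivial one-dimensional central extension of $\mathfrak e_{k(k)}$: there is an isomorphism of Lie algebras $\mathfrak g_k\cong\mathbb R\times\mathfrak e_{k(k)}$, with $\mathbb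 R$ abelian, under which $K_k\mapsto(1,0)$, $\alpha_i^\vee\mapsto(0,h_i)$, $e_i\mapsto(0,e_i)$, $f_i\mapsto(0,f_i)$. (ii) The matrix $C_9$ is of affine type, that is, it is an indecomposable generalized Cartan matrix of corank $1$, there is $u>0$ with $C_9u=0$, and $C_9v\ge0$ implies $C_9v=0$ for real $v$. The triple $(\mathfrak h_9,\alpha,\alpha^\vee)$ is a realization of $C_9$ over $\mathbb R$. The algebra $\mathfrak g_9$ is the split real form $\mathfrak e_{9(9)}$: for every realization $(V,\beta,\beta^\vee)$ of $C_9$ over $\mathbb R$ there is an isomorphism $\mathfrak g_9\cong\mathfrak g_{\mathbb R}(V,\beta,\beta^\vee)$ which maps $e_i\mapsto e_i$, $f_i\mapsto f_i$ and is given on the Cartan spaces by a linear isomorphism $\mathfrak h_9\cong V$ matching $\alpha_i$ with $\beta_i$ and $\alpha_i^\vee$ with $\beta_i^\vee$; and likewise, for every realization $(W,\beta,\beta^\vee)$ of $C_9$ over $\mathbb C$, there is such an isomorphism $\mathbb C\otimes_{\mathbb R}\mathfrak g_9\cong\mathfrak g_{\mathbb C}(W,\beta,\beta^\vee)$. (iii)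 Let $k\ge10$. The matrix $C_k$ is of indefinite type, that is, it is an indecomposable generalized Cartan matrix, there is $u>0$ with $C_ku<0$, and $C_kv\ge0$, $v\ge0$ imply $v=0$ for real $v$ (inequalities between vectors are componentwise). The algebra $\mathfrak e_{k(k)}$ is the standard split real form of $\mathfrak e_k$, and $\mathfrak g_k$ is the trivial one-dimensional central extension of $\mathfrak e_{k(k)}$, both in the sense of (i). -/

import Mathlib

open scoped TensorProduct

/-! ### Lie algebras given by Chevalley generators over a Cartan space -/

section Chevalley

/-- Generators: the elements of the Cartan space `V`, and letters `e i`, `f i`. -/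
inductive ChevalleyGenerator (V ι : Type*)
  | h : V → ChevalleyGenerator V ι
  | e : ι → ChevalleyGenerator V ι
  | f : ι → ChevalleyGenerator V ι

variable (K : Type*) {V ι : Type*} [Field K] [AddCommGroup V] [Module K V]

/-- A generator, as an element of the free Lie algebra. -/
noncomputable abbrev freeGen (K V ι : Type*) [Field K] (x : ChevalleyGenerator V ι) :
    FreeLieAlgebra K (ChevalleyGenerator V ι) :=
  FreeLieAlgebra.of K x

/-- `ChevalleyRelator K α αv x`: the element `x` of the free Lie algebra is one of the elements
that the defining relations set to zero. Here `α i` are the simple roots, `αv i` the simple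
coroots, and the Cartan matrix is `c i j = α j (αv i)`. The constructors `add` and `smul` say that
the elements of `V` are added and scaled as in `V`. -/
inductive ChevalleyRelator (α : ι → Module.Dual K V) (αv : ι → V) :
    FreeLieAlgebra K (ChevalleyGenerator V ι) → Prop
  | add (x y : V) : ChevalleyRelator α αv
      (freeGen K V ι (.h (x + y)) -
        (freeGen K V ι (.h x) + freeGen K V ι (.h y)))
  | smul (c : K) (x : V) : ChevalleyRelator α αv
      (freeGen K V ι (.h (c • x)) - c • freeGen K V ι (.h x))
  | hh (x y : V) : ChevalleyRelator α αv
      ⁅freeGen K V ι (.h x), freeGen K V ι (.h y)⁆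
  | he (x : V) (i : ι) : ChevalleyRelator α αv
      (⁅freeGen K V ι (.h x), freeGen K V ι (.e i)⁆ -
        α i x • freeGen K V ι (.e i))
  | hf (x : V) (i : ι) : ChevalleyRelator α αv
      (⁅freeGen K V ι (.h x), freeGen K V ι (.f i)⁆ +
        α i x • freeGen K V ι (.f i))
  | ef_same (i : ι) : ChevalleyRelator α αv
      (⁅freeGen K V ι (.e i), freeGen K V ι (.f i)⁆ -
        freeGen K V ι (.h (αv i)))
  | ef_ne (i j : ι) (hij : i ≠ j) : ChevalleyRelator α αv
      ⁅freeGen K V ι (.e i), freeGen K V ι (.f j)⁆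
  | serre_e (i j : ι) (hij : i ≠ j) (n : ℕ) (hn : (n : K) = 1 - α j (αv i)) :
      ChevalleyRelator α αv
      (((LieAlgebra.ad K _ (freeGen K V ι (.e i))) ^ n) (freeGen K V ι (.e j)))
  | serre_f (i j : ι) (hij : i ≠ j) (n : ℕ) (hn : (n : K) = 1 - α j (αv i)) :
      ChevalleyRelator α αv
      (((LieAlgebra.ad K _ (freeGen K V ι (.f i))) ^ n) (freeGen K V ι (.f j)))

/-- The ideal of the free Lie algebra generated by the defining relations. -/
noncomputable def chevalleyIdeal (α : ι → Module.Dual K V) (αv : ι → V) :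
    LieIdeal K (FreeLieAlgebra K (ChevalleyGenerator V ι)) :=
  LieSubmodule.lieSpan K _ {x | ChevalleyRelator K α αv x}

/-- The Lie algebra over `K` with generators the elements of `V` and `e i`, `f i`, and relations
`[h, h'] = 0`, `[h, e i] = α i (h) e i`, `[h, f i] = - α i (h) f i`, `[e i, f j] = δ i j • αv i`,
and, for `i ≠ j`, `ad (e i) ^ (1 - c i j) (e j) = 0` and `ad (f i) ^ (1 - c i j) (f j) = 0` with
`c i j = α j (αv i)`. When `(V, α, αv)` is a realization of a generalized Cartan matrix, this is
the Kac-Moody algebra over `K` of that matrix. -/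
def ChevalleyAlgebra (α : ι → Module.Dual K V) (αv : ι → V) : Type _ :=
  FreeLieAlgebra K (ChevalleyGenerator V ι) ⧸ chevalleyIdeal K α αv

noncomputable instance (α : ι → Module.Dual K V) (αv : ι → V) :
    LieRing (ChevalleyAlgebra K α αv) :=
  inferInstanceAs (LieRing (FreeLieAlgebra K (ChevalleyGenerator V ι) ⧸ chevalleyIdeal K α αv))

noncomputable instance (α : ι → Module.Dual K V) (αv : ι → V) :
    LieAlgebra K (ChevalleyAlgebra K α αv) :=
  inferInstanceAs
    (LieAlgebra K (FreeLieAlgebra K (ChevalleyGenerator V ι) ⧸ chevalleyIdeal K α αv))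

/-- The image of a generator in the Lie algebra. -/
noncomputable def ChevalleyAlgebra.gen (α : ι → Module.Dual K V) (αv : ι → V)
    (x : ChevalleyGenerator V ι) : ChevalleyAlgebra K α αv :=
  LieSubmodule.Quotient.mk (N := chevalleyIdeal K α αv) (FreeLieAlgebra.of K x)

/-- `(V, α, αv)` is a realization over `K` of the square matrix `A` of size `n`: the `α i` are
linearly independent in the dual of `V`, the `αv i` are linearly independent in `V`,
`α j (αv i) = A i j`, and `n - rank A = dim V - n`. -/
structure IsRealization [Fintype ι] (A : Matrix ι ι ℤ) (α : ι → Module.Dual K V)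
    (αv : ι → V) : Prop where
  finite : Module.Finite K V
  root_indep : LinearIndependent K α
  coroot_indep : LinearIndependent K αv
  pairing : ∀ i j, α j (αv i) = (A i j : K)
  dim : Module.finrank K V + (A.map (Int.cast : ℤ → K)).rank = 2 * Fintype.card ι

end Chevalley

/-! ### Generalized Cartan matrices and their types -/

section CartanMatrices

variable {ι : Type*}

/-- Indecomposable generalized Cartan matrices. -/
structure IsIndecomposableGCM (A : Matrix ι ι ℤ) : Prop where
  diag : ∀ i, A i i = 2
  off_diag : ∀ i j, i ≠ j → A i j ≤ 0
  zero : ∀ i j, A i j = 0 → A j i = 0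
  indecomposable : ∀ S : Set ι, S.Nonempty → Sᶜ.Nonempty → ∃ i ∈ S, ∃ j ∈ Sᶜ, A i j ≠ 0

/-- Affine type: an indecomposable generalized Cartan matrix of corank `1` such that `A u = 0` for
some `u > 0`, and `A v ≥ 0` implies `A v = 0`. -/
structure IsAffineType [Fintype ι] (A : Matrix ι ι ℤ) : Prop extends IsIndecomposableGCM A where
  corank : (A.map (Int.cast : ℤ → ℝ)).rank + 1 = Fintype.card ι
  exists_pos : ∃ u : ι → ℝ, (∀ i, 0 < u i) ∧ (A.map (Int.cast : ℤ → ℝ)).mulVec u = 0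
  eq_zero : ∀ v : ι → ℝ, (∀ i, 0 ≤ (A.map (Int.cast : ℤ → ℝ)).mulVec v i) →
    (A.map (Int.cast : ℤ → ℝ)).mulVec v = 0

/-- Indefinite type: an indecomposable generalized Cartan matrix such that `A u < 0` for some
`u > 0`, and `A v ≥ 0`, `v ≥ 0` imply `v = 0`. -/
structure IsIndefiniteType [Fintype ι] (A : Matrix ι ι ℤ) : Prop
    extends IsIndecomposableGCM A where
  exists_pos : ∃ u : ι → ℝ, (∀ i, 0 < u i) ∧
    ∀ i, (A.map (Int.cast : ℤ → ℝ)).mulVec u i < 0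
  eq_zero : ∀ v : ι → ℝ, (∀ i, 0 ≤ (A.map (Int.cast : ℤ → ℝ)).mulVec v i) →
    (∀ i, 0 ≤ v i) → v = 0

/-- `L` is a finite-dimensional semisimple Lie algebra over `K` which has a splitting Cartan
subalgebra (one whose elements act on `L` with all eigenvalues in `K`) such that the resulting
root system has a base with Cartan matrix `A`. -/
def IsSplitSemisimpleOfType (K L : Type*) [Field K] [CharZero K] [LieRing L] [LieAlgebra K L]
    (A : Matrix ι ι ℤ) : Prop :=
  ∃ (_ : FiniteDimensional K L) (_ : LieAlgebra.IsSemisimple K L)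
    (H : LieSubalgebra K L) (_ : H.IsCartanSubalgebra) (_ : LieModule.IsTriangularizable K H L)
    (b : (LieAlgebra.IsKilling.rootSystem H).Base) (σ : ι ≃ b.support),
    ∀ i j, b.cartanMatrix (σ i) (σ j) = A i j

end CartanMatrices

/-! ### The series `E_k` -/

namespace ESeries

/-- The generalized Cartan matrix of type `E_k`. The index `i : Fin k` stands for the node number
`i + 1`. Nodes `1, …, k - 1` form a line, and node `k` is joined to node `3` (to no node if
`k = 3`). -/
def cartanMatrix (k : ℕ) : Matrix (Fin k) (Fin k) ℤ := fun i j =>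
  if i = j then 2
  else if (i.val + 1 = j.val ∧ j.val + 1 < k) ∨ (j.val + 1 = i.val ∧ i.val + 1 < k) ∨
      (i.val + 1 = 3 ∧ j.val + 1 = k) ∨ (j.val + 1 = 3 ∧ i.val + 1 = k) then -1
  else 0

/-- The real vector space `𝔥_k` with basis `h_0, …, h_k`. -/
abbrev Cartan (k : ℕ) : Type := Fin (k + 1) → ℝ

/-- The basis vector `h_j`, for `0 ≤ j ≤ k`. -/
def hvec (k j : ℕ) : Cartan k := fun m => if m.val = j then 1 else 0

/-- The Minkowski inner product, with `(h_0, h_0) = -1` and `(h_i, h_i) = 1` for `i ≥ 1`. -/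
noncomputable def minkowski (k : ℕ) : LinearMap.BilinForm ℝ (Cartan k) :=
  Matrix.toBilin' (Matrix.diagonal fun i : Fin (k + 1) => if i = 0 then (-1 : ℝ) else 1)

/-- `ε_j`, the image of `h_j` in the dual space under the map induced by the inner product. -/
noncomputable def eps (k j : ℕ) : Module.Dual ℝ (Cartan k) := minkowski k (hvec k j)

/-- Simple roots: `α_i = ε_i - ε_{i+1}` for `1 ≤ i ≤ k - 1`, and
`α_k = ε_0 - ε_1 - ε_2 - ε_3`. The index `i : Fin k` stands for `i + 1`. -/
noncomputable def root (k : ℕ) (i : Fin k) : Module.Dual ℝ (Cartan k) :=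
  if i.val + 1 < k then eps k (i.val + 1) - eps k (i.val + 2)
  else eps k 0 - eps k 1 - eps k 2 - eps k 3

/-- Simple coroots: `h_i - h_{i+1}` for `1 ≤ i ≤ k - 1`, and `h_0 - h_1 - h_2 - h_3`. -/
def coroot (k : ℕ) (i : Fin k) : Cartan k :=
  if i.val + 1 < k then hvec k (i.val + 1) - hvec k (i.val + 2)
  else hvec k 0 - hvec k 1 - hvec k 2 - hvec k 3

/-- The distinguished element `K_k = -3 h_0 + h_1 + … + h_k`. -/
def canonical (k : ℕ) : Cartan k :=
  (-3 : ℝ) • hvec k 0 + ∑ i ∈ Finset.Icc 1 k, hvec k i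

/-- The Lie algebra `𝔤_k`. -/
abbrev G (k : ℕ) : Type := ChevalleyAlgebra ℝ (root k) (coroot k)

/-- The image in `𝔤_k` of an element of `𝔥_k`. -/
noncomputable abbrev gh (k : ℕ) (x : Cartan k) : G k :=
  ChevalleyAlgebra.gen ℝ (root k) (coroot k) (.h x)

/-- The generator `e_i` of `𝔤_k`. -/
noncomputable abbrev ge (k : ℕ) (i : Fin k) : G k :=
  ChevalleyAlgebra.gen ℝ (root k) (coroot k) (.e i)

/-- The generator `f_i` of `𝔤_k`. -/
noncomputable abbrev gf (k : ℕ) (i : Fin k) : G k :=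
  ChevalleyAlgebra.gen ℝ (root k) (coroot k) (.f i)

/-- The Lie algebra over `K` with Chevalley generators `h_i, e_i, f_i` and the Chevalley-Serre
relations of the matrix of type `E_k`. For `k ≠ 9`, it is `𝔢_{k(k)}` when `K = ℝ`, and `𝔢_k` when
`K = ℂ`. -/
abbrev E (K : Type*) [Field K] (k : ℕ) : Type _ := Matrix.ToLieAlgebra K (cartanMatrix k)

/-- The image in `E K k` of a generator `h_i`, `e_i` or `f_i`. -/
noncomputable def egen (K : Type*) [Field K] (k : ℕ) (x : CartanMatrix.Generators (Fin k)) :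
    E K k :=
  LieSubmodule.Quotient.mk
    (N := CartanMatrix.Relations.toIdeal K (cartanMatrix k)) (FreeLieAlgebra.of K x)

/-- `E ℝ k` is a real form of `E ℂ k`, namely the standard split one: the real span of brackets
of Chevalley generators. -/
def IsStandardSplitForm (k : ℕ) : Prop :=
  ∃ Ψ : (ℂ ⊗[ℝ] E ℝ k) ≃ₗ⁅ℂ⁆ E ℂ k,
    ∀ x : CartanMatrix.Generators (Fin k), Ψ (1 ⊗ₜ[ℝ] egen ℝ k x) = egen ℂ k x

section

attribute [local instance] LieRing.ofAssociativeRing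

/-- `𝔤_k` is the trivial one-dimensional central extension of `E ℝ k`: it is the product of `E ℝ k`
with the one-dimensional abelian Lie algebra `ℝ`, which corresponds to the line through the central
element `K_k`, compatibly with the Chevalley generators. -/
def IsTrivialCentralExtension (k : ℕ) : Prop :=
  ∃ Φ : G k ≃ₗ⁅ℝ⁆ (ℝ × E ℝ k),
    Φ (gh k (canonical k)) = (1, 0) ∧
    ∀ i : Fin k,
      Φ (gh k (coroot k i)) = (0, egen ℝ k (.H i)) ∧
      Φ (ge k i) = (0, egen ℝ k (.E i)) ∧
      Φ (gf k i) = (0, egen ℝ k (.F i))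

end

end ESeries

/-! The simple coroots are Minkowski-dual to the simple roots, so `C_k` is their Gram matrix, and
their span is the orthogonal complement of `K_k`. Since `(K_k, K_k) = k - 9`, the value `k = 9`
separates the three cases.

Central extension and split form. All simple roots vanish on `K_k`, so `K_k` is central in `𝔤_k`.
For `k ≠ 9` it is complementary to the span of the coroots (`exists_decomposition`), and the
universal properties of the two presentations give mutually inverse maps between `𝔤_k` and `ℝ × 𝔢_k`
(`isTrivialCentralExtension`). The Serre relations have integer coefficients, so the presentation
commutes with extension of scalars.

Types. On the complement of `K_k`, Cauchy–Schwarz gives `form_lower_bound`, hence positivity for `k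
≤ 8`. The kernel of `C_9` is the line of a positive vector, and for `k ≥ 10` an explicit `u > 0` has
`C_k u < 0`. Symmetry of the matrix then gives the remaining conditions. In any realization of `C_9`
the coroots are completed to a basis by one vector with prescribed root values; matching such bases
identifies realizations, also after extension of scalars.

Semisimplicity for `k ≤ 8`. The presentation must first be shown not to collapse: a quotient of a
Verma module without Serre relations satisfies all relations, and `e_i` acts nontrivially on it
(`gen_E_ne_zero`). The algebra is spanned by coroots and by words in the `e_i` and in the `f_i`, so
its weights are nonnegative or nonpositive. By `sl_2` theory the weights of an ideal are stable
under simple reflections. Positive definiteness lets a positive weight be reflected down in height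
until it is a simple root (`form_eq_two_of_nonneg`). For the whole algebra this gives norm `2` for
all positive weights, hence finite dimension; for a nonzero ideal it produces some `e_i`, so no
nonzero ideal is abelian. -/

/-! ### Lie algebras given by generators and relations -/

section Presentations

/-- The descent of a morphism of Lie algebras to the quotient by an ideal that it kills. -/
noncomputable def LieIdeal.quotLift {K L L' : Type*} [CommRing K] [LieRing L] [LieAlgebra K L]
    [LieRing L'] [LieAlgebra K L'] (I : LieIdeal K L) (F : L →ₗ⁅K⁆ L') (h : I ≤ F.ker) :
    (L ⧸ I) →ₗ⁅K⁆ L' :=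
  { I.toSubmodule.liftQ (F : L →ₗ[K] L') (fun x hx => (LieHom.mem_ker (f := F) (x := x)).1 (h hx)) with
    map_lie' := by
      intro x y
      induction x using Submodule.Quotient.induction_on
      induction y using Submodule.Quotient.induction_on
      exact F.map_lie _ _ }

/-- The quotient map by an ideal. -/
def LieIdeal.quotMk {K L : Type*} [CommRing K] [LieRing L] [LieAlgebra K L] (I : LieIdeal K L) :
    L →ₗ⁅K⁆ (L ⧸ I) where
  toFun x := LieSubmodule.Quotient.mk (N := I) x
  map_add' _ _ := rfl
  map_smul' _ _ := rfl
  map_lie' := rfl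

theorem LieHom.map_ad_pow {K L L' : Type*} [CommRing K] [LieRing L] [LieAlgebra K L]
    [LieRing L'] [LieAlgebra K L'] (F : L →ₗ⁅K⁆ L') (n : ℕ) (x y : L) :
    F ((LieAlgebra.ad K L x ^ n) y) = (LieAlgebra.ad K L' (F x) ^ n) (F y) := by
  induction n with
  | zero => simp
  | succ n ih => simp [pow_succ', ih]

theorem LieHom.eq_of_lieSpan_eq_top {K L L' : Type*} [CommRing K] [LieRing L] [LieAlgebra K L]
    [LieRing L'] [LieAlgebra K L'] {s : Set L} (hs : LieSubalgebra.lieSpan K L s = ⊤)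
    {F G : L →ₗ⁅K⁆ L'} (h : ∀ x ∈ s, F x = G x) : F = G := by
  ext x
  have hx : x ∈ LieSubalgebra.lieSpan K L s := by rw [hs]; trivial
  induction hx using LieSubalgebra.lieSpan_induction with
  | mem y hy => exact h y hy
  | zero => simp
  | add u v _ _ hu hv => simp [hu, hv]
  | smul t u _ hu => simp [hu]
  | lie u v _ _ hu hv => simp [hu, hv]

/-- The universal property lifts the letters into the subalgebra that they generate; followed by the
inclusion this fixes the letters, so it is the identity, and the identity has image in that
subalgebra. -/
theorem FreeLieAlgebra.lieSpan_range_of (K X : Type*) [CommRing K] :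
    LieSubalgebra.lieSpan K (FreeLieAlgebra K X) (Set.range (FreeLieAlgebra.of K)) = ⊤ := by
  set S := LieSubalgebra.lieSpan K (FreeLieAlgebra K X) (Set.range (FreeLieAlgebra.of K))
  let g : X → S := fun x => ⟨FreeLieAlgebra.of K x, LieSubalgebra.subset_lieSpan ⟨x, rfl⟩⟩
  have h : S.incl.comp (FreeLieAlgebra.lift K g) = LieHom.id := by
    apply FreeLieAlgebra.hom_ext
    intro x
    simp [g]
  rw [eq_top_iff]
  intro x _
  have := LieHom.congr_fun h x
  simp only [LieHom.coe_comp, Function.comp_apply, LieHom.id_apply] at this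
  rw [← this]
  exact (FreeLieAlgebra.lift K g x).2

theorem LieIdeal.lieSpan_quotient_eq_top {K L : Type*} [CommRing K] [LieRing L] [LieAlgebra K L]
    (I : LieIdeal K L) {s : Set L} (hs : LieSubalgebra.lieSpan K L s = ⊤) :
    LieSubalgebra.lieSpan K (L ⧸ I) ((fun x => LieSubmodule.Quotient.mk (N := I) x) '' s) = ⊤ := by
  rw [eq_top_iff]
  intro x _
  induction x using Submodule.Quotient.induction_on with | _ x
  have hx : x ∈ LieSubalgebra.lieSpan K L s := by rw [hs]; trivial
  induction hx using LieSubalgebra.lieSpan_induction with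
  | mem y hy => exact LieSubalgebra.subset_lieSpan ⟨y, hy, rfl⟩
  | zero => exact zero_mem _
  | add u v _ _ hu hv => exact add_mem (hu trivial) (hv trivial)
  | smul t u _ hu => exact SMulMemClass.smul_mem t (hu trivial)
  | lie u v _ _ hu hv => exact LieSubalgebra.lie_mem _ (hu trivial) (hv trivial)

end Presentations

/-! ### The universal property of the Chevalley presentation -/

section ChevalleyFamily

variable (K : Type*) {V ι : Type*} [Field K] [AddCommGroup V] [Module K V]

/-- Elements of a Lie algebra that satisfy the Chevalley-Serre relations. -/
structure IsChevalleyFamily (α : ι → Module.Dual K V) (αv : ι → V) {L : Type*} [LieRing L]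
    [LieAlgebra K L] (h : V →ₗ[K] L) (e f : ι → L) : Prop where
  hh : ∀ x y, ⁅h x, h y⁆ = 0
  he : ∀ x i, ⁅h x, e i⁆ = α i x • e i
  hf : ∀ x i, ⁅h x, f i⁆ = -(α i x • f i)
  ef_same : ∀ i, ⁅e i, f i⁆ = h (αv i)
  ef_ne : ∀ i j, i ≠ j → ⁅e i, f j⁆ = 0
  serre_e : ∀ i j, i ≠ j → ∀ n : ℕ, (n : K) = 1 - α j (αv i) →
    (LieAlgebra.ad K L (e i) ^ n) (e j) = 0
  serre_f : ∀ i j, i ≠ j → ∀ n : ℕ, (n : K) = 1 - α j (αv i) →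
    (LieAlgebra.ad K L (f i) ^ n) (f j) = 0

variable {K}

/-- The values of a Chevalley family on the generators. -/
def chevalleyValue {L : Type*} [LieRing L] [LieAlgebra K L] (h : V →ₗ[K] L) (e f : ι → L) :
    ChevalleyGenerator V ι → L
  | .h x => h x
  | .e i => e i
  | .f i => f i

variable {α : ι → Module.Dual K V} {αv : ι → V}

namespace ChevalleyAlgebra

theorem mk_eq_zero {x : FreeLieAlgebra K (ChevalleyGenerator V ι)}
    (hx : ChevalleyRelator K α αv x) :
    LieSubmodule.Quotient.mk (N := chevalleyIdeal K α αv) x = 0 :=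
  (LieSubmodule.Quotient.mk_eq_zero' (N := chevalleyIdeal K α αv)).2
    (LieSubmodule.subset_lieSpan hx)

variable (α αv) in
/-- The quotient map from the free Lie algebra. -/
noncomputable def proj :
    FreeLieAlgebra K (ChevalleyGenerator V ι) →ₗ⁅K⁆ ChevalleyAlgebra K α αv :=
  LieIdeal.quotMk (chevalleyIdeal K α αv)

theorem proj_eq_zero {x : FreeLieAlgebra K (ChevalleyGenerator V ι)}
    (hx : ChevalleyRelator K α αv x) : proj α αv x = 0 :=
  mk_eq_zero hx

variable (α αv) in
/-- The Cartan space mapped to the Lie algebra. -/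
noncomputable def genH : V →ₗ[K] ChevalleyAlgebra K α αv where
  toFun x := gen K α αv (.h x)
  map_add' x y := by
    have := proj_eq_zero (ChevalleyRelator.add (K := K) (α := α) (αv := αv) x y)
    rw [map_sub, map_add] at this
    exact sub_eq_zero.1 this
  map_smul' c x := by
    have := proj_eq_zero (ChevalleyRelator.smul (K := K) (α := α) (αv := αv) c x)
    rw [map_sub, map_smul] at this
    exact sub_eq_zero.1 this

variable (α αv) in
theorem isChevalleyFamily_gen :
    IsChevalleyFamily K α αv (genH α αv) (fun i => gen K α αv (.e i))
      (fun i => gen K α αv (.f i)) where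
  hh x y := by
    have := proj_eq_zero (ChevalleyRelator.hh (K := K) (α := α) (αv := αv) x y)
    rwa [LieHom.map_lie] at this
  he x i := by
    have := proj_eq_zero (ChevalleyRelator.he (K := K) (α := α) (αv := αv) x i)
    rw [map_sub, map_smul, LieHom.map_lie] at this
    exact sub_eq_zero.1 this
  hf x i := by
    have := proj_eq_zero (ChevalleyRelator.hf (K := K) (α := α) (αv := αv) x i)
    rw [map_add, map_smul, LieHom.map_lie] at this
    exact eq_neg_of_add_eq_zero_left this
  ef_same i := by
    have := proj_eq_zero (ChevalleyRelator.ef_same (K := K) (α := α) (αv := αv) i)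
    rw [map_sub, LieHom.map_lie] at this
    exact sub_eq_zero.1 this
  ef_ne i j hij := by
    have := proj_eq_zero (ChevalleyRelator.ef_ne (K := K) (α := α) (αv := αv) i j hij)
    rwa [LieHom.map_lie] at this
  serre_e i j hij n hn := by
    have := proj_eq_zero (ChevalleyRelator.serre_e (K := K) (α := α) (αv := αv) i j hij n hn)
    rwa [LieHom.map_ad_pow] at this
  serre_f i j hij n hn := by
    have := proj_eq_zero (ChevalleyRelator.serre_f (K := K) (α := α) (αv := αv) i j hij n hn)
    rwa [LieHom.map_ad_pow] at this

variable (α αv) in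
theorem lieSpan_range_gen :
    LieSubalgebra.lieSpan K (ChevalleyAlgebra K α αv) (Set.range (gen K α αv)) = ⊤ := by
  have := LieIdeal.lieSpan_quotient_eq_top (chevalleyIdeal K α αv)
    (FreeLieAlgebra.lieSpan_range_of K (ChevalleyGenerator V ι))
  rw [← Set.range_comp] at this
  exact this

variable {L : Type*} [LieRing L] [LieAlgebra K L] {h : V →ₗ[K] L} {e f : ι → L}

/-- The morphism of Lie algebras given by a Chevalley family. -/
noncomputable def lift (H : IsChevalleyFamily K α αv h e f) : ChevalleyAlgebra K α αv →ₗ⁅K⁆ L :=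
  LieIdeal.quotLift (chevalleyIdeal K α αv) (FreeLieAlgebra.lift K (chevalleyValue h e f)) <| by
    refine LieSubmodule.lieSpan_le.2 fun x hx => ?_
    simp only [SetLike.mem_coe, LieHom.mem_ker]
    cases hx with
    | add x y => simp [chevalleyValue]
    | smul c x => simp [chevalleyValue]
    | hh x y => simpa [chevalleyValue] using H.hh x y
    | he x i => simpa [chevalleyValue, sub_eq_zero] using H.he x i
    | hf x i => simp [chevalleyValue, H.hf x i]
    | ef_same i => simpa [chevalleyValue, sub_eq_zero] using H.ef_same i
    | ef_ne i j hij => simpa [chevalleyValue] using H.ef_ne i j hij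
    | serre_e i j hij n hn =>
      simpa [LieHom.map_ad_pow, chevalleyValue] using H.serre_e i j hij n hn
    | serre_f i j hij n hn =>
      simpa [LieHom.map_ad_pow, chevalleyValue] using H.serre_f i j hij n hn

theorem lift_gen (H : IsChevalleyFamily K α αv h e f) (x : ChevalleyGenerator V ι) :
    lift H (gen K α αv x) = chevalleyValue h e f x :=
  FreeLieAlgebra.lift_of_apply _ x

theorem hom_ext {F G : ChevalleyAlgebra K α αv →ₗ⁅K⁆ L}
    (hFG : ∀ x, F (gen K α αv x) = G (gen K α αv x)) : F = G :=
  LieHom.eq_of_lieSpan_eq_top (lieSpan_range_gen α αv) (by rintro _ ⟨x, rfl⟩; exact hFG x)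

end ChevalleyAlgebra

end ChevalleyFamily

/-! ### The universal property of the Serre presentation -/

section SerreFamily

variable (K : Type*) [Field K] {ι : Type*}

/-- Elements of a Lie algebra that satisfy the Serre relations of a matrix. -/
structure IsSerreFamily (A : Matrix ι ι ℤ) {L : Type*} [LieRing L] [LieAlgebra K L]
    (h e f : ι → L) : Prop where
  hh : ∀ i j, ⁅h i, h j⁆ = 0
  he : ∀ i j, ⁅h i, e j⁆ = A i j • e j
  hf : ∀ i j, ⁅h i, f j⁆ = -(A i j • f j)
  ef_same : ∀ i, ⁅e i, f i⁆ = h i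
  ef_ne : ∀ i j, i ≠ j → ⁅e i, f j⁆ = 0
  serre_e : ∀ i j, (LieAlgebra.ad K L (e i) ^ (-A i j).toNat) ⁅e i, e j⁆ = 0
  serre_f : ∀ i j, (LieAlgebra.ad K L (f i) ^ (-A i j).toNat) ⁅f i, f j⁆ = 0

/-- The values of a Serre family on the generators. -/
def serreValue {L : Type*} (h e f : ι → L) : CartanMatrix.Generators ι → L
  | .H i => h i
  | .E i => e i
  | .F i => f i

variable {K} {A : Matrix ι ι ℤ} [DecidableEq ι]

namespace Matrix.ToLieAlgebra

variable (K A) in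
/-- The image of a generator. -/
noncomputable def gen (x : CartanMatrix.Generators ι) : Matrix.ToLieAlgebra K A :=
  LieSubmodule.Quotient.mk (N := CartanMatrix.Relations.toIdeal K A) (FreeLieAlgebra.of K x)

variable (K A) in
/-- The quotient map from the free Lie algebra. -/
noncomputable def proj :
    FreeLieAlgebra K (CartanMatrix.Generators ι) →ₗ⁅K⁆ Matrix.ToLieAlgebra K A :=
  LieIdeal.quotMk (CartanMatrix.Relations.toIdeal K A)

theorem proj_eq_zero {x : FreeLieAlgebra K (CartanMatrix.Generators ι)}
    (hx : x ∈ CartanMatrix.Relations.toSet K A) : proj K A x = 0 :=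
  (LieSubmodule.Quotient.mk_eq_zero' (N := CartanMatrix.Relations.toIdeal K A)).2
    (LieSubmodule.subset_lieSpan hx)

theorem proj_of (x : CartanMatrix.Generators ι) :
    proj K A (FreeLieAlgebra.of K x) = gen K A x := rfl

variable (K A) in
theorem isSerreFamily_gen :
    IsSerreFamily K A (fun i => gen K A (.H i)) (fun i => gen K A (.E i))
      (fun i => gen K A (.F i)) where
  hh i j := by
    have := proj_eq_zero (K := K) (A := A) (x := CartanMatrix.Relations.HH K (i, j))
      (by simp [CartanMatrix.Relations.toSet])
    simpa [CartanMatrix.Relations.HH, proj_of] using this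
  he i j := by
    have := proj_eq_zero (K := K) (A := A) (x := CartanMatrix.Relations.HE K A (i, j))
      (by simp [CartanMatrix.Relations.toSet])
    simpa [CartanMatrix.Relations.HE, proj_of, sub_eq_zero] using this
  hf i j := by
    have := proj_eq_zero (K := K) (A := A) (x := CartanMatrix.Relations.HF K A (i, j))
      (by simp [CartanMatrix.Relations.toSet])
    rw [← add_eq_zero_iff_eq_neg]
    simpa [CartanMatrix.Relations.HF, proj_of] using this
  ef_same i := by
    have := proj_eq_zero (K := K) (A := A) (x := CartanMatrix.Relations.EF K (i, i))
      (by simp [CartanMatrix.Relations.toSet])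
    simpa [CartanMatrix.Relations.EF, proj_of, sub_eq_zero] using this
  ef_ne i j hij := by
    have := proj_eq_zero (K := K) (A := A) (x := CartanMatrix.Relations.EF K (i, j))
      (by simp [CartanMatrix.Relations.toSet])
    simpa [CartanMatrix.Relations.EF, proj_of, hij] using this
  serre_e i j := by
    have := proj_eq_zero (K := K) (A := A) (x := CartanMatrix.Relations.adE K A (i, j))
      (by simp [CartanMatrix.Relations.toSet])
    simpa [CartanMatrix.Relations.adE, proj_of, LieHom.map_ad_pow] using this
  serre_f i j := by
    have := proj_eq_zero (K := K) (A := A) (x := CartanMatrix.Relations.adF K A (i, j))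
      (by simp [CartanMatrix.Relations.toSet])
    simpa [CartanMatrix.Relations.adF, proj_of, LieHom.map_ad_pow] using this

variable (K A) in
theorem lieSpan_range_gen :
    LieSubalgebra.lieSpan K (Matrix.ToLieAlgebra K A) (Set.range (gen K A)) = ⊤ := by
  have := LieIdeal.lieSpan_quotient_eq_top (CartanMatrix.Relations.toIdeal K A)
    (FreeLieAlgebra.lieSpan_range_of K (CartanMatrix.Generators ι))
  rw [← Set.range_comp] at this
  exact this

variable {L : Type*} [LieRing L] [LieAlgebra K L] {h e f : ι → L}

/-- The morphism of Lie algebras given by a Serre family. -/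
noncomputable def lift (S : IsSerreFamily K A h e f) : Matrix.ToLieAlgebra K A →ₗ⁅K⁆ L :=
  LieIdeal.quotLift (CartanMatrix.Relations.toIdeal K A)
    (FreeLieAlgebra.lift K (serreValue h e f)) <| by
    refine LieSubmodule.lieSpan_le.2 fun x hx => ?_
    simp only [SetLike.mem_coe, LieHom.mem_ker]
    rcases hx with ((((⟨⟨i, j⟩, rfl⟩ | ⟨⟨i, j⟩, rfl⟩) | ⟨⟨i, j⟩, rfl⟩) | ⟨⟨i, j⟩, rfl⟩) |
      ⟨⟨i, j⟩, rfl⟩) | ⟨⟨i, j⟩, rfl⟩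
    · simpa [CartanMatrix.Relations.HH, serreValue] using S.hh i j
    · rcases eq_or_ne i j with rfl | hij
      · simpa [CartanMatrix.Relations.EF, serreValue, sub_eq_zero] using S.ef_same i
      · simpa [CartanMatrix.Relations.EF, serreValue, hij] using S.ef_ne i j hij
    · simpa [CartanMatrix.Relations.HE, serreValue, sub_eq_zero] using S.he i j
    · simp [CartanMatrix.Relations.HF, serreValue, S.hf i j]
    · simpa [CartanMatrix.Relations.adE, serreValue, LieHom.map_ad_pow] using S.serre_e i j
    · simpa [CartanMatrix.Relations.adF, serreValue, LieHom.map_ad_pow] using S.serre_f i j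

theorem lift_gen (S : IsSerreFamily K A h e f) (x : CartanMatrix.Generators ι) :
    lift S (gen K A x) = serreValue h e f x :=
  FreeLieAlgebra.lift_of_apply _ x

theorem hom_ext {F G : Matrix.ToLieAlgebra K A →ₗ⁅K⁆ L}
    (hFG : ∀ x, F (gen K A x) = G (gen K A x)) : F = G :=
  LieHom.eq_of_lieSpan_eq_top (lieSpan_range_gen K A) (by rintro _ ⟨x, rfl⟩; exact hFG x)

end Matrix.ToLieAlgebra

end SerreFamily

/-! ### Functoriality and base change of the presentations -/

section BaseChange

variable {R A L L' : Type*} [Field R] [Field A] [Algebra R A] [LieRing L] [LieAlgebra R L]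
  [LieRing L'] [LieAlgebra A L']

theorem LieHom.map_zsmul' {K L L' : Type*} [CommRing K] [LieRing L] [LieAlgebra K L]
    [LieRing L'] [LieAlgebra K L'] (F : L →ₗ⁅K⁆ L') (n : ℤ) (x : L) : F (n • x) = n • F x :=
  map_zsmul (F : L →ₗ[K] L') n x

/-- Restriction of scalars for Lie algebras over fields. -/
abbrev LieAlgebra.restrictScalarsOfAlgebra (R A L' : Type*) [Field R] [Field A] [Algebra R A]
    [LieRing L'] [LieAlgebra A L'] : LieAlgebra R L' :=
  { Module.compHom L' (algebraMap R A) with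
    lie_smul := fun t x y => lie_smul (algebraMap R A t) x y }

/-- The extension of scalars of a morphism of Lie algebras. -/
noncomputable def LieHom.liftBaseChange (A : Type*) [Field A] [Algebra R A] [LieAlgebra A L']
    [LieAlgebra R L'] [IsScalarTower R A L'] (F : L →ₗ⁅R⁆ L') : (A ⊗[R] L) →ₗ⁅A⁆ L' :=
  { (F : L →ₗ[R] L').liftBaseChange A with
    map_lie' := by
      intro x y
      change (F : L →ₗ[R] L').liftBaseChange A ⁅x, y⁆ =
        ⁅(F : L →ₗ[R] L').liftBaseChange A x, (F : L →ₗ[R] L').liftBaseChange A y⁆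
      induction x using TensorProduct.induction_on with
      | zero => simp
      | add x₁ x₂ h₁ h₂ => simp only [add_lie, map_add, h₁, h₂]
      | tmul a x =>
        induction y using TensorProduct.induction_on with
        | zero => simp
        | add y₁ y₂ h₁ h₂ => simp only [lie_add, map_add, h₁, h₂]
        | tmul b y => simp [mul_smul, smul_comm a b] }

theorem LieHom.liftBaseChange_tmul [LieAlgebra R L'] [IsScalarTower R A L'] (F : L →ₗ⁅R⁆ L')
    (a : A) (x : L) : F.liftBaseChange A (a ⊗ₜ[R] x) = a • F x :=
  LinearMap.liftBaseChange_tmul A (F : L →ₗ[R] L') a x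

variable (R A L) in
/-- The morphism `x ↦ 1 ⊗ x`. -/
noncomputable def LieAlgebra.includeRight : L →ₗ⁅R⁆ A ⊗[R] L :=
  { TensorProduct.mk R A L 1 with
    map_lie' := by intro x y; simp }

theorem LieAlgebra.includeRight_apply (x : L) : LieAlgebra.includeRight R A L x = 1 ⊗ₜ x := rfl

theorem LieHom.baseChange_ext {s : Set L} (hs : LieSubalgebra.lieSpan R L s = ⊤)
    {F G : (A ⊗[R] L) →ₗ⁅A⁆ L'} (h : ∀ x ∈ s, F (1 ⊗ₜ x) = G (1 ⊗ₜ x)) : F = G := by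
  have key : ∀ x : L, F (1 ⊗ₜ x) = G (1 ⊗ₜ x) := by
    intro x
    have hx : x ∈ LieSubalgebra.lieSpan R L s := by rw [hs]; trivial
    induction hx using LieSubalgebra.lieSpan_induction with
    | mem y hy => exact h y hy
    | zero => simp
    | add u v _ _ hu hv => simp [TensorProduct.tmul_add, hu, hv]
    | smul t u _ hu =>
      have : (1 : A) ⊗ₜ[R] (t • u) = algebraMap R A t • ((1 : A) ⊗ₜ[R] u) := by
        rw [TensorProduct.tmul_smul, algebraMap_smul]
      rw [this, map_smul, map_smul, hu]
    | lie u v _ _ hu hv =>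
      have : (1 : A) ⊗ₜ[R] ⁅u, v⁆ = ⁅(1 : A) ⊗ₜ[R] u, (1 : A) ⊗ₜ[R] v⁆ := by simp
      rw [this, LieHom.map_lie, LieHom.map_lie, hu, hv]
  ext z
  induction z using TensorProduct.induction_on with
  | zero => simp
  | add x y hx hy => simp [hx, hy]
  | tmul a x =>
    have : a ⊗ₜ[R] x = a • ((1 : A) ⊗ₜ[R] x) := by simp [TensorProduct.smul_tmul']
    rw [this, map_smul, map_smul, key]

end BaseChange

/-- An equivalence of Lie algebras from mutually inverse morphisms. -/
noncomputable def LieEquiv.ofHoms {K L L' : Type*} [CommRing K] [LieRing L] [LieAlgebra K L]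
    [LieRing L'] [LieAlgebra K L'] (F : L →ₗ⁅K⁆ L') (G : L' →ₗ⁅K⁆ L)
    (h₁ : G.comp F = LieHom.id) (h₂ : F.comp G = LieHom.id) : L ≃ₗ⁅K⁆ L' :=
  { F with
    invFun := G
    left_inv := fun x => LieHom.congr_fun h₁ x
    right_inv := fun x => LieHom.congr_fun h₂ x }

section Chevalley

variable {ι : Type*}

theorem IsChevalleyFamily.comp_linearMap {K V W L : Type*} [Field K] [AddCommGroup V] [Module K V]
    [AddCommGroup W] [Module K W] [LieRing L] [LieAlgebra K L]
    {α : ι → Module.Dual K V} {αv : ι → V} {β : ι → Module.Dual K W} {βv : ι → W}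
    {h : W →ₗ[K] L} {e f : ι → L} (H : IsChevalleyFamily K β βv h e f) (φ : V →ₗ[K] W)
    (hα : ∀ i x, β i (φ x) = α i x) (hv : ∀ i, φ (αv i) = βv i) :
    IsChevalleyFamily K α αv (h ∘ₗ φ) e f where
  hh x y := by simp [H.hh]
  he x i := by simp [H.he, hα]
  hf x i := by simp [H.hf, hα]
  ef_same i := by simp [H.ef_same, hv]
  ef_ne := H.ef_ne
  serre_e i j hij n hn := H.serre_e i j hij n (by rw [hn, ← hv, hα])
  serre_f i j hij n hn := H.serre_f i j hij n (by rw [hn, ← hv, hα])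

/-- A linear isomorphism of Cartan spaces that matches roots and coroots induces an isomorphism. -/
theorem ChevalleyAlgebra.exists_equiv {K V W : Type*} [Field K] [AddCommGroup V] [Module K V]
    [AddCommGroup W] [Module K W]
    {α : ι → Module.Dual K V} {αv : ι → V} {β : ι → Module.Dual K W} {βv : ι → W}
    (φ : V ≃ₗ[K] W) (hα : ∀ i x, β i (φ x) = α i x) (hv : ∀ i, φ (αv i) = βv i) :
    ∃ Φ : ChevalleyAlgebra K α αv ≃ₗ⁅K⁆ ChevalleyAlgebra K β βv,
      (∀ x, Φ (gen K α αv (.h x)) = gen K β βv (.h (φ x))) ∧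
      ∀ i, Φ (gen K α αv (.e i)) = gen K β βv (.e i) ∧
        Φ (gen K α αv (.f i)) = gen K β βv (.f i) := by
  have H₁ := (isChevalleyFamily_gen β βv).comp_linearMap (α := α) (αv := αv) φ.toLinearMap hα hv
  have H₂ := (isChevalleyFamily_gen α αv).comp_linearMap (α := β) (αv := βv) φ.symm.toLinearMap
    (fun i x => by rw [← hα]; simp) (fun i => by rw [← hv]; simp)
  have h₁ : ∀ x, lift H₁ (gen K α αv (.h x)) = gen K β βv (.h (φ x)) := fun x => lift_gen H₁ _
  have h₂ : ∀ x, lift H₂ (gen K β βv (.h x)) = gen K α αv (.h (φ.symm x)) :=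
    fun x => lift_gen H₂ _
  refine ⟨LieEquiv.ofHoms (lift H₁) (lift H₂) (hom_ext fun x => ?_) (hom_ext fun x => ?_),
    h₁, fun i => ⟨lift_gen H₁ _, lift_gen H₁ _⟩⟩
  · rw [LieHom.comp_apply]
    cases x with
    | h x => rw [h₁, h₂]; simp
    | e i => simp [lift_gen, chevalleyValue]
    | f i => simp [lift_gen, chevalleyValue]
  · rw [LieHom.comp_apply]
    cases x with
    | h x => rw [h₂, h₁]; simp
    | e i => simp [lift_gen, chevalleyValue]
    | f i => simp [lift_gen, chevalleyValue]

/-- The Cartan relations are linear in the Cartan element and can be checked on pure tensors. The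
Serre relations are transported along `x ↦ 1 ⊗ x`. -/
theorem IsChevalleyFamily.baseChange {R V L : Type*} [Field R] [AddCommGroup V] [Module R V]
    [LieRing L] [LieAlgebra R L] {α : ι → Module.Dual R V} {αv : ι → V}
    {h : V →ₗ[R] L} {e f : ι → L} (H : IsChevalleyFamily R α αv h e f)
    (A : Type*) [Field A] [Algebra R A] :
    IsChevalleyFamily A (fun i => (α i).baseChange A)
      (fun i => (1 : A) ⊗ₜ[R] αv i) (h.baseChange A) (fun i => 1 ⊗ₜ e i) (fun i => 1 ⊗ₜ f i) where
  hh x y := by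
    induction x using TensorProduct.induction_on with
    | zero => simp
    | add x₁ x₂ h₁ h₂ => simp only [add_lie, map_add, h₁, h₂, add_zero]
    | tmul a x =>
      induction y using TensorProduct.induction_on with
      | zero => simp
      | add y₁ y₂ h₁ h₂ => simp only [lie_add, map_add, h₁, h₂, add_zero]
      | tmul b y => simp [H.hh]
  he x i := by
    induction x using TensorProduct.induction_on with
    | zero => simp
    | add x₁ x₂ h₁ h₂ => simp only [add_lie, map_add, h₁, h₂, add_smul]
    | tmul a x => simp [H.he, TensorProduct.smul_tmul']
  hf x i := by
    induction x using TensorProduct.induction_on with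
    | zero => simp
    | add x₁ x₂ h₁ h₂ => simp only [add_lie, map_add, h₁, h₂, add_smul, neg_add]
    | tmul a x => simp [H.hf, TensorProduct.smul_tmul', TensorProduct.tmul_neg]
  ef_same i := by simp [H.ef_same]
  ef_ne i j hij := by simp [H.ef_ne i j hij]
  serre_e i j hij n hn := by
    -- The exponent is specified by an equation in `A`; it descends to `R` because a map of fields
    -- is injective.
    have hn' : (n : R) = 1 - α j (αv i) := (algebraMap R A).injective (by
      simpa [Algebra.smul_def] using hn)
    have := congrArg (LieAlgebra.includeRight R A L) (H.serre_e i j hij n hn')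
    rw [LieHom.map_ad_pow] at this
    have key : ∀ m : ℕ, ∀ y, (LieAlgebra.ad R (A ⊗[R] L) (1 ⊗ₜ e i) ^ m) y =
      (LieAlgebra.ad A (A ⊗[R] L) (1 ⊗ₜ e i) ^ m) y := by
      intro m
      induction m with
      | zero => simp
      | succ m ih => intro y; simp [pow_succ', ih]
    rw [← key]
    simpa [LieAlgebra.includeRight_apply] using this
  serre_f i j hij n hn := by
    have hn' : (n : R) = 1 - α j (αv i) := (algebraMap R A).injective (by
      simpa [Algebra.smul_def] using hn)
    have := congrArg (LieAlgebra.includeRight R A L) (H.serre_f i j hij n hn')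
    rw [LieHom.map_ad_pow] at this
    have key : ∀ m : ℕ, ∀ y, (LieAlgebra.ad R (A ⊗[R] L) (1 ⊗ₜ f i) ^ m) y =
      (LieAlgebra.ad A (A ⊗[R] L) (1 ⊗ₜ f i) ^ m) y := by
      intro m
      induction m with
      | zero => simp
      | succ m ih => intro y; simp [pow_succ', ih]
    rw [← key]
    simpa [LieAlgebra.includeRight_apply] using this

/-- Counterpart of `IsChevalleyFamily.baseChange`: it provides the map out of the presentation over
`R` into the presentation over `A`. -/
theorem IsChevalleyFamily.restrictScalars {R A V L : Type*} [Field R] [Field A] [Algebra R A]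
    [AddCommGroup V] [Module A V] [Module R V] [IsScalarTower R A V]
    [LieRing L] [LieAlgebra A L] [LieAlgebra R L] [IsScalarTower R A L]
    {U : Type*} [AddCommGroup U] [Module R U] {α : ι → Module.Dual R U} {αv : ι → U}
    {β : ι → Module.Dual A V} {βv : ι → V}
    {h : V →ₗ[A] L} {e f : ι → L} (H : IsChevalleyFamily A β βv h e f) (ψ : U →ₗ[R] V)
    (hα : ∀ i x, β i (ψ x) = algebraMap R A (α i x)) (hv : ∀ i, ψ (αv i) = βv i) :
    IsChevalleyFamily R α αv (h.restrictScalars R ∘ₗ ψ) e f where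
  hh x y := by simp [H.hh]
  he x i := by simp [H.he, hα]
  hf x i := by simp [H.hf, hα]
  ef_same i := by simp [H.ef_same, hv]
  ef_ne := H.ef_ne
  serre_e i j hij n hn := by
    have := H.serre_e i j hij n (by rw [← hv, hα, ← map_natCast (algebraMap R A), hn]; simp)
    have key : ∀ m : ℕ, ∀ y, (LieAlgebra.ad R L (e i) ^ m) y =
      (LieAlgebra.ad A L (e i) ^ m) y := by
      intro m
      induction m with
      | zero => simp
      | succ m ih => intro y; simp [pow_succ', ih]
    rw [key, this]
  serre_f i j hij n hn := by
    have := H.serre_f i j hij n (by rw [← hv, hα, ← map_natCast (algebraMap R A), hn]; simp)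
    have key : ∀ m : ℕ, ∀ y, (LieAlgebra.ad R L (f i) ^ m) y =
      (LieAlgebra.ad A L (f i) ^ m) y := by
      intro m
      induction m with
      | zero => simp
      | succ m ih => intro y; simp [pow_succ', ih]
    rw [key, this]

/-- Extension of scalars commutes with the Chevalley presentation. -/
theorem ChevalleyAlgebra.exists_baseChange_equiv {R A V W : Type*} [Field R] [Field A]
    [Algebra R A] [AddCommGroup V] [Module R V] [AddCommGroup W] [Module A W]
    {α : ι → Module.Dual R V} {αv : ι → V} {β : ι → Module.Dual A W} {βv : ι → W}
    (ψ : (A ⊗[R] V) ≃ₗ[A] W) (hα : ∀ i x, β i (ψ (1 ⊗ₜ x)) = algebraMap R A (α i x))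
    (hv : ∀ i, ψ (1 ⊗ₜ αv i) = βv i) :
    ∃ Ψ : (A ⊗[R] ChevalleyAlgebra R α αv) ≃ₗ⁅A⁆ ChevalleyAlgebra A β βv,
      (∀ x, Ψ (1 ⊗ₜ gen R α αv (.h x)) = gen A β βv (.h (ψ (1 ⊗ₜ x)))) ∧
      ∀ i, Ψ (1 ⊗ₜ gen R α αv (.e i)) = gen A β βv (.e i) ∧
        Ψ (1 ⊗ₜ gen R α αv (.f i)) = gen A β βv (.f i) := by
  let _ : LieAlgebra R (ChevalleyAlgebra A β βv) := LieAlgebra.restrictScalarsOfAlgebra R A _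
  have : IsScalarTower R A (ChevalleyAlgebra A β βv) := ⟨fun a b x => by
    rw [Algebra.smul_def, mul_smul]; rfl⟩
  let _ : Module R W := Module.compHom W (algebraMap R A)
  have : IsScalarTower R A W := ⟨fun a b x => by rw [Algebra.smul_def, mul_smul]; rfl⟩
  let ψ₀ : V →ₗ[R] W := ψ.toLinearMap.restrictScalars R ∘ₗ TensorProduct.mk R A V 1
  have H₁ := (isChevalleyFamily_gen β βv).restrictScalars (α := α) (αv := αv) ψ₀ hα hv
  have H₂ := ((isChevalleyFamily_gen α αv).baseChange A).comp_linearMap (α := β) (αv := βv)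
    -- The roots are known only on vectors `ψ (1 ⊗ x)`. These span the target over `A`, so linearity
    -- settles the general case.
    ψ.symm.toLinearMap (fun i w => by
      obtain ⟨x, rfl⟩ := ψ.surjective w
      induction x using TensorProduct.induction_on with
      | zero => simp
      | add x y hx hy => simpa using congrArg₂ (· + ·) hx hy
      | tmul a x =>
        have : a ⊗ₜ[R] x = a • ((1 : A) ⊗ₜ[R] x) := by simp [TensorProduct.smul_tmul']
        rw [this]
        simp only [map_smul, hα]
        simp [Algebra.smul_def]) (fun i => by rw [← hv]; simp)
  have h₁ : ∀ x, (lift H₁).liftBaseChange A (1 ⊗ₜ gen R α αv (.h x)) =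
      gen A β βv (.h (ψ (1 ⊗ₜ x))) := fun x => by
    rw [LieHom.liftBaseChange_tmul, one_smul]; exact lift_gen H₁ _
  have e₁ : ∀ i, (lift H₁).liftBaseChange A (1 ⊗ₜ gen R α αv (.e i)) =
      gen A β βv (.e i) := fun x => by
    rw [LieHom.liftBaseChange_tmul, one_smul]; exact lift_gen H₁ _
  have f₁ : ∀ i, (lift H₁).liftBaseChange A (1 ⊗ₜ gen R α αv (.f i)) =
      gen A β βv (.f i) := fun x => by
    rw [LieHom.liftBaseChange_tmul, one_smul]; exact lift_gen H₁ _
  have h₂ : ∀ x, lift H₂ (gen A β βv (.h x)) = (genH α αv).baseChange A (ψ.symm x) :=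
    fun x => lift_gen H₂ _
  refine ⟨LieEquiv.ofHoms ((lift H₁).liftBaseChange A) (lift H₂)
    (LieHom.baseChange_ext (lieSpan_range_gen α αv) ?_) (hom_ext fun x => ?_),
    h₁, fun i => ⟨e₁ i, f₁ i⟩⟩
  · rintro _ ⟨x, rfl⟩
    rw [LieHom.comp_apply]
    cases x with
    | h x => rw [h₁, h₂]; simp; rfl
    | e i => rw [e₁, lift_gen]; rfl
    | f i => rw [f₁, lift_gen]; rfl
  · rw [LieHom.comp_apply]
    cases x with
    | h x =>
      rw [h₂]
      obtain ⟨x, rfl⟩ := ψ.surjective x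
      rw [LinearEquiv.symm_apply_apply]
      induction x using TensorProduct.induction_on with
      | zero =>
        change _ = genH β βv (ψ 0)
        simp
      | add x y hx hy =>
        rw [LieHom.id_apply] at hx hy ⊢
        change _ = genH β βv (ψ (x + y))
        rw [map_add, map_add, hx, hy, map_add, map_add]
        rfl
      | tmul a x =>
        have : a ⊗ₜ[R] x = a • ((1 : A) ⊗ₜ[R] x) := by simp [TensorProduct.smul_tmul']
        rw [this, map_smul, map_smul, LinearMap.baseChange_tmul]
        change a • _ = genH β βv (ψ _)
        rw [map_smul, map_smul]
        exact congrArg _ (h₁ x)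
    | e i => rw [lift_gen]; exact e₁ i
    | f i => rw [lift_gen]; exact f₁ i

end Chevalley

section Serre

variable {ι : Type*} {A : Matrix ι ι ℤ}

theorem IsSerreFamily.map {K L L' : Type*} [Field K] [LieRing L] [LieAlgebra K L] [LieRing L']
    [LieAlgebra K L'] {h e f : ι → L} (S : IsSerreFamily K A h e f) (F : L →ₗ⁅K⁆ L') :
    IsSerreFamily K A (fun i => F (h i)) (fun i => F (e i)) (fun i => F (f i)) where
  hh i j := by rw [← LieHom.map_lie, S.hh, map_zero]
  he i j := by rw [← LieHom.map_lie, S.he, F.map_zsmul']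
  hf i j := by rw [← LieHom.map_lie, S.hf, map_neg, F.map_zsmul']
  ef_same i := by rw [← LieHom.map_lie, S.ef_same]
  ef_ne i j hij := by rw [← LieHom.map_lie, S.ef_ne i j hij, map_zero]
  serre_e i j := by rw [← LieHom.map_lie, ← LieHom.map_ad_pow, S.serre_e, map_zero]
  serre_f i j := by rw [← LieHom.map_lie, ← LieHom.map_ad_pow, S.serre_f, map_zero]

/-- The Serre relations do not depend on the field of scalars. -/
theorem IsSerreFamily.of_field {K K' L : Type*} [Field K] [Field K'] [LieRing L] [LieAlgebra K L]
    [LieAlgebra K' L] {h e f : ι → L} (S : IsSerreFamily K A h e f) :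
    IsSerreFamily K' A h e f := by
  have key : ∀ (x : L) (m : ℕ) (y : L), (LieAlgebra.ad K' L x ^ m) y =
      (LieAlgebra.ad K L x ^ m) y := by
    intro x m
    induction m with
    | zero => simp
    | succ m ih => intro y; simp [pow_succ', ih]
  exact ⟨S.hh, S.he, S.hf, S.ef_same, S.ef_ne, fun i j => by rw [key, S.serre_e],
    fun i j => by rw [key, S.serre_f]⟩

/-- Extension of scalars commutes with the Serre presentation. -/
theorem Matrix.ToLieAlgebra.exists_baseChange_equiv (R K : Type*) [Field R] [Field K]
    [Algebra R K] [DecidableEq ι] (A : Matrix ι ι ℤ) :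
    ∃ Ψ : (K ⊗[R] Matrix.ToLieAlgebra R A) ≃ₗ⁅K⁆ Matrix.ToLieAlgebra K A,
      ∀ x, Ψ (1 ⊗ₜ gen R A x) = gen K A x := by
  let _ : LieAlgebra R (Matrix.ToLieAlgebra K A) := LieAlgebra.restrictScalarsOfAlgebra R K _
  have : IsScalarTower R K (Matrix.ToLieAlgebra K A) := ⟨fun a b x => by
    rw [Algebra.smul_def, mul_smul]; rfl⟩
  have S₁ := (isSerreFamily_gen K A).of_field (K' := R)
  have S₂ := ((isSerreFamily_gen R A).map (LieAlgebra.includeRight R K _)).of_field (K' := K)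
  have h₁ : ∀ x, (lift S₁).liftBaseChange K (1 ⊗ₜ gen R A x) = gen K A x := fun x => by
    rw [LieHom.liftBaseChange_tmul, one_smul, lift_gen]; cases x <;> rfl
  have h₂ : ∀ x, lift S₂ (gen K A x) = 1 ⊗ₜ gen R A x := fun x => by
    rw [lift_gen]; cases x <;> rfl
  refine ⟨LieEquiv.ofHoms ((lift S₁).liftBaseChange K) (lift S₂)
    (LieHom.baseChange_ext (lieSpan_range_gen R A) ?_) (hom_ext fun x => ?_), h₁⟩
  · rintro _ ⟨x, rfl⟩
    rw [LieHom.comp_apply, h₁, h₂, LieHom.id_apply]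
  · rw [LieHom.comp_apply, h₂, h₁, LieHom.id_apply]

end Serre

theorem ESeries.isStandardSplitForm (k : ℕ) : ESeries.IsStandardSplitForm k :=
  Matrix.ToLieAlgebra.exists_baseChange_equiv ℝ ℂ (ESeries.cartanMatrix k)

/-! ### The Minkowski lattice and the matrix of type `E_k` -/

namespace ESeries

variable {k : ℕ}

/-- The coordinates of a vector, extended by zero. -/
def coord (x : Cartan k) (n : ℕ) : ℝ := if h : n < k + 1 then x ⟨n, h⟩ else 0

theorem coord_add (x y : Cartan k) (n : ℕ) : coord (x + y) n = coord x n + coord y n := by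
  unfold coord; split_ifs <;> simp

theorem coord_sub (x y : Cartan k) (n : ℕ) : coord (x - y) n = coord x n - coord y n := by
  unfold coord; split_ifs <;> simp

theorem coord_smul (c : ℝ) (x : Cartan k) (n : ℕ) : coord (c • x) n = c * coord x n := by
  unfold coord; split_ifs <;> simp

theorem coord_sum {ι : Type*} (s : Finset ι) (g : ι → Cartan k) (n : ℕ) :
    coord (∑ i ∈ s, g i) n = ∑ i ∈ s, coord (g i) n := by
  unfold coord; split_ifs <;> simp

theorem coord_hvec (j n : ℕ) : coord (hvec k j) n = if n = j ∧ n ≤ k then 1 else 0 := by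
  unfold coord hvec; split_ifs with h₁ h₂ h₃ h₃ <;> first | rfl | (exfalso; simp at *; omega)

theorem coord_val (x : Cartan k) (i : Fin (k + 1)) : coord x i = x i := by
  simp [coord, i.2]

theorem ext_coord {x y : Cartan k} (h : ∀ n ≤ k, coord x n = coord y n) : x = y := by
  funext i
  rw [← coord_val x, ← coord_val y]
  exact h i (by omega)

theorem minkowski_apply (x y : Cartan k) :
    minkowski k x y = (∑ n ∈ Finset.range k, coord x (n + 1) * coord y (n + 1)) -
      coord x 0 * coord y 0 := by
  have h : minkowski k x y = ∑ i : Fin (k + 1), (if i = 0 then (-1 : ℝ) else 1) * (x i * y i) := by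
    rw [minkowski, Matrix.toBilin'_apply]
    refine Finset.sum_congr rfl fun i _ => ?_
    rw [Finset.sum_eq_single i]
    · simp
    · intro j _ hj; simp [Matrix.diagonal_apply_ne _ hj.symm]
    · simp
  rw [h, Fin.sum_univ_succ, Finset.sum_range]
  have h0 : ∀ z : Cartan k, coord z 0 = z 0 := fun z => coord_val z 0
  have hs : ∀ (z : Cartan k) (i : Fin k), coord z (i + 1) = z i.succ := fun z i => by
    rw [← coord_val z]; rfl
  simp only [h0, hs, if_true, Fin.succ_ne_zero, if_false]
  ring_nf

theorem minkowski_comm (x y : Cartan k) : minkowski k x y = minkowski k y x := by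
  simp only [minkowski_apply, mul_comm]

theorem eps_apply (j : ℕ) (x : Cartan k) :
    eps k j x = (if j = 0 then -1 else 1) * coord x j := by
  rw [eps, minkowski_apply]
  simp only [coord_hvec]
  rcases j with _ | j
  · simp
  · by_cases hj : j < k
    · rw [Finset.sum_eq_single j]
      · simp; omega
      · intro n _ hn; simp [hn]
      · simp [hj]
    · have : coord x (j + 1) = 0 := by simp [coord]; omega
      rw [Finset.sum_eq_zero]
      · simp [this]
      · intro n hn
        rw [Finset.mem_range] at hn
        rw [if_neg (by omega), zero_mul]

theorem root_apply (i : Fin k) (x : Cartan k) :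
    root k i x = if i.val + 1 < k then coord x (i + 1) - coord x (i + 2)
      else -coord x 0 - coord x 1 - coord x 2 - coord x 3 := by
  unfold root; split_ifs <;> simp [eps_apply]

theorem minkowski_coroot (i : Fin k) (x : Cartan k) :
    minkowski k (coroot k i) x = root k i x := by
  unfold root coroot eps; split_ifs <;> simp

theorem cartanMatrix_symm (i j : Fin k) : cartanMatrix k i j = cartanMatrix k j i := by
  unfold cartanMatrix
  rcases eq_or_ne i j with rfl | h
  · rfl
  · rw [if_neg h, if_neg h.symm]
    congr 1
    apply propext
    tauto

/-- A computation in coordinates, split by whether each of the two nodes lies on the line or is the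
last node. -/
theorem root_coroot (hk : 3 ≤ k) (i j : Fin k) :
    root k j (coroot k i) = (cartanMatrix k i j : ℝ) := by
  obtain ⟨i, hi⟩ := i
  obtain ⟨j, hj⟩ := j
  rw [root_apply]
  simp only [coroot, cartanMatrix, Fin.mk.injEq]
  by_cases hi' : i + 1 < k <;> by_cases hj' : j + 1 < k
  · simp only [hi', hj', if_true, coord_sub, coord_hvec, and_true]
    by_cases h1 : i = j
    · subst h1
      rw [if_pos (by omega), if_neg (by omega), if_neg (by omega), if_pos (by omega),
        if_pos rfl]
      norm_num
    by_cases h2 : i = j + 1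
    · subst h2
      rw [if_neg (by omega), if_neg (by omega), if_pos (by omega), if_neg (by omega),
        if_neg (by omega), if_pos (by omega)]
      norm_num
    by_cases h3 : j = i + 1
    · subst h3
      rw [if_neg (by omega), if_pos (by omega), if_neg (by omega), if_neg (by omega),
        if_neg (by omega), if_pos (by omega)]
      norm_num
    · rw [if_neg (by omega), if_neg (by omega), if_neg (by omega), if_neg (by omega),
        if_neg (by omega), if_neg (by omega)]
      norm_num
  · simp only [hi', hj', if_true, if_false, coord_sub, coord_hvec]
    -- Index `2` is node `3`, the only neighbour of the last node.
    by_cases h1 : i = 2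
    · subst h1
      rw [if_neg (by omega), if_neg (by omega), if_neg (by omega), if_neg (by omega),
        if_neg (by omega), if_neg (by omega), if_pos (by omega), if_neg (by omega),
        if_neg (by omega), if_pos (by omega)]
      norm_num
    · rw [if_neg (c := i = j) (by omega), if_neg (c := i + 1 = j ∧ False ∨ j + 1 = i ∧ True ∨
        i + 1 = 3 ∧ j + 1 = k ∨ j + 1 = 3 ∧ i + 1 = k)
        (by simp only [and_false, and_true, false_or]; omega)]
      rw [if_neg (c := 0 = i + 1 ∧ 0 ≤ k) (by omega), if_neg (c := 0 = i + 2 ∧ 0 ≤ k) (by omega),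
        if_neg (c := 3 = i + 1 ∧ 3 ≤ k) (by omega), if_neg (c := 1 = i + 2 ∧ 1 ≤ k) (by omega)]
      -- For `i = 0, 1` both coordinates of the coroot are among the first three and cancel in the
      -- last root; for `3 ≤ i` neither occurs in it.
      have : i = 0 ∨ i = 1 ∨ 3 ≤ i := by omega
      rcases this with rfl | rfl | h
      · rw [if_pos (by omega), if_neg (by omega), if_pos (by omega), if_neg (by omega)]
        norm_num
      · rw [if_neg (by omega), if_pos (by omega), if_neg (by omega), if_pos (by omega)]
        norm_num
      · rw [if_neg (by omega), if_neg (by omega), if_neg (by omega), if_neg (by omega)]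
        norm_num
  · simp only [hi', hj', if_true, if_false, coord_sub, coord_hvec]
    by_cases h1 : j = 2
    · subst h1
      rw [if_neg (by omega), if_neg (by omega), if_neg (by omega), if_pos (by omega),
        if_neg (by omega), if_neg (by omega), if_neg (by omega), if_neg (by omega),
        if_neg (by omega), if_pos (by omega)]
      norm_num
    · rw [if_neg (c := i = j) (by omega), if_neg (c := i + 1 = j ∧ True ∨ j + 1 = i ∧ False ∨
        i + 1 = 3 ∧ j + 1 = k ∨ j + 1 = 3 ∧ i + 1 = k)
        (by simp only [and_false, and_true, false_or]; omega)]
      rw [if_neg (c := j + 1 = 0 ∧ j + 1 ≤ k) (by omega), if_neg (c := j + 2 = 0 ∧ j + 2 ≤ k) (by omega),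
        if_neg (c := j + 1 = 3 ∧ j + 1 ≤ k) (by omega), if_neg (c := j + 2 = 1 ∧ j + 2 ≤ k) (by omega)]
      have : j = 0 ∨ j = 1 ∨ 3 ≤ j := by omega
      rcases this with rfl | rfl | h
      · rw [if_pos (by omega), if_neg (by omega), if_pos (by omega), if_neg (by omega)]
        norm_num
      · rw [if_neg (by omega), if_pos (by omega), if_neg (by omega), if_pos (by omega)]
        norm_num
      · rw [if_neg (by omega), if_neg (by omega), if_neg (by omega), if_neg (by omega)]
        norm_num
  · have : i = j := by omega
    have h1 : 1 ≤ k := by omega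
    have h2 : 2 ≤ k := by omega
    simp [hj', coord_sub, coord_hvec, this, hk, h1, h2]
    norm_num

theorem coord_canonical_zero : coord (canonical k) 0 = -3 := by
  simp only [canonical, coord_add, coord_smul, coord_sum, coord_hvec]
  rw [Finset.sum_eq_zero]
  · simp
  · intro n hn
    rw [Finset.mem_Icc] at hn
    rw [if_neg (by omega)]

theorem coord_canonical {n : ℕ} (hn : 1 ≤ n) (hnk : n ≤ k) : coord (canonical k) n = 1 := by
  simp only [canonical, coord_add, coord_smul, coord_sum, coord_hvec]
  rw [Finset.sum_eq_single n]
  · rw [if_neg (by omega), if_pos (by omega)]; norm_num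
  · intro m _ hm
    rw [if_neg (by omega)]
  · intro h
    exact absurd (Finset.mem_Icc.2 ⟨hn, hnk⟩) h

/-- Coordinates `1` to `k` are all equal to `1`, and the coefficient `-3` balances the three
subtracted in the last root. -/
theorem root_canonical (hk : 3 ≤ k) (i : Fin k) : root k i (canonical k) = 0 := by
  rw [root_apply]
  split_ifs with h
  · rw [coord_canonical (by omega) (by omega), coord_canonical (by omega) (by omega)]; norm_num
  · rw [coord_canonical_zero, coord_canonical (by omega) (by omega),
      coord_canonical (by omega) (by omega), coord_canonical (by omega) (by omega)]
    norm_num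

/-- The combination of the simple coroots with given coefficients. -/
noncomputable def corootComb (k : ℕ) : (Fin k → ℝ) →ₗ[ℝ] Cartan k :=
  Fintype.linearCombination ℝ (coroot k)

theorem corootComb_apply (b : Fin k → ℝ) : corootComb k b = ∑ i, b i • coroot k i := by
  simp [corootComb, Fintype.linearCombination_apply]

theorem root_corootComb (hk : 3 ≤ k) (b : Fin k → ℝ) (i : Fin k) :
    root k i (corootComb k b) = ((cartanMatrix k).map (Int.cast : ℤ → ℝ)).mulVec b i := by
  rw [corootComb_apply, map_sum, Matrix.mulVec, dotProduct]
  refine Finset.sum_congr rfl fun j _ => ?_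
  rw [map_smul, root_coroot hk, cartanMatrix_symm, Matrix.map_apply, smul_eq_mul, mul_comm]

/-- This replaces the quadratic form of `C_k` by a diagonal form of signature `(k, 1)`. -/
theorem minkowski_corootComb (hk : 3 ≤ k) (b : Fin k → ℝ) :
    minkowski k (corootComb k b) (corootComb k b) =
      ∑ i, b i * ((cartanMatrix k).map (Int.cast : ℤ → ℝ)).mulVec b i := by
  conv_lhs => enter [1]; rw [corootComb_apply]
  rw [map_sum, LinearMap.sum_apply]
  refine Finset.sum_congr rfl fun i _ => ?_
  rw [map_smul, LinearMap.smul_apply, minkowski_coroot, root_corootComb hk, smul_eq_mul]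

/-- Combinations of coroots are orthogonal to the canonical element. -/
theorem sum_coord_corootComb (hk : 3 ≤ k) (b : Fin k → ℝ) :
    ∑ n ∈ Finset.range k, coord (corootComb k b) (n + 1) = -3 * coord (corootComb k b) 0 := by
  have h : minkowski k (canonical k) (corootComb k b) = 0 := by
    rw [minkowski_comm, corootComb_apply, map_sum, LinearMap.sum_apply]
    refine Finset.sum_eq_zero fun i _ => ?_
    rw [map_smul, LinearMap.smul_apply, minkowski_coroot, root_canonical hk, smul_zero]
  rw [minkowski_apply, coord_canonical_zero, sub_eq_zero] at h
  rw [← h]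
  refine Finset.sum_congr rfl fun n hn => ?_
  rw [Finset.mem_range] at hn
  rw [coord_canonical (by omega) (by omega), one_mul]

theorem coord_corootComb_zero (hk : 3 ≤ k) (b : Fin k → ℝ) :
    coord (corootComb k b) 0 = b ⟨k - 1, by omega⟩ := by
  rw [corootComb_apply, coord_sum, Finset.sum_eq_single ⟨k - 1, by omega⟩]
  · have : ¬ (k - 1 + 1 < k) := by omega
    simp [coroot, coord_smul, coord_sub, coord_hvec, this]
  · intro i _ hi
    have : i.val + 1 < k := by
      have := i.2
      have : i.val ≠ k - 1 := fun h => hi (Fin.ext h)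
      omega
    simp [coroot, coord_smul, coord_sub, coord_hvec, this]
  · simp

/-- Read as a recursion along the line, this recovers the coefficients one after another once the
last one is known from the `h_0`-coordinate. -/
theorem coord_corootComb_succ (hk : 3 ≤ k) (b : Fin k → ℝ) (n : ℕ) (hn : n < k) :
    coord (corootComb k b) (n + 1) = (if n + 1 < k then b ⟨n, hn⟩ else 0) -
      (if h : 1 ≤ n then b ⟨n - 1, by omega⟩ else 0) -
      (if n < 3 then b ⟨k - 1, by omega⟩ else 0) := by
  obtain ⟨m, rfl⟩ : ∃ m, k = m + 1 := ⟨k - 1, by omega⟩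
  rw [corootComb_apply, coord_sum, Fin.sum_univ_castSucc]
  have h1 : ∀ i : Fin m, coord (b i.castSucc • coroot (m + 1) i.castSucc) (n + 1) =
      (if n = i.val then b i.castSucc else 0) - (if n = i.val + 1 then b i.castSucc else 0) := by
    intro i
    have := i.2
    rw [coord_smul, coroot, if_pos (by simp), coord_sub, coord_hvec, coord_hvec]
    simp only [Fin.val_castSucc, add_left_inj]
    split_ifs <;> first | omega | simp
  rw [Finset.sum_congr rfl fun i _ => h1 i, Finset.sum_sub_distrib,
    sub_eq_add_neg (_ - _) (ite _ _ _)]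
  congr 1
  · congr 1
    · split_ifs with h
      · rw [Finset.sum_eq_single ⟨n, by omega⟩]
        · simp
        · intro i _ hi
          rw [if_neg]
          rintro rfl
          exact hi rfl
        · simp
      · refine Finset.sum_eq_zero fun i _ => if_neg ?_
        have := i.2
        omega
    · split_ifs with h
      · rw [Finset.sum_eq_single ⟨n - 1, by omega⟩]
        · rw [if_pos (by simp; omega)]; rfl
        · intro i _ hi
          rw [if_neg]
          rintro rfl
          exact hi rfl
        · simp
      · refine Finset.sum_eq_zero fun i _ => if_neg ?_
        omega
  · rw [coord_smul, coroot, if_neg (by simp)]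
    simp only [coord_sub, coord_hvec]
    have : (⟨m + 1 - 1, by omega⟩ : Fin (m + 1)) = Fin.last m := rfl
    rw [this]
    have hc : n < 3 ↔ (n = 0 ∨ n = 1 ∨ n = 2) := by omega
    have h2 : 2 ≤ m + 1 := by omega
    simp only [hc]
    by_cases h : n < 3
    · interval_cases n <;> simp [hk, h2]
    · rw [if_neg (by omega), if_neg (by omega), if_neg (by omega), if_neg (by omega),
        if_neg (by omega)]
      simp

end ESeries

/-! ### The quadratic form of `E_k` and the position of the canonical element. -/

namespace ESeries

variable {k : ℕ}

theorem corootComb_injective (hk : 3 ≤ k) : Function.Injective (corootComb k) := by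
  rw [← LinearMap.ker_eq_bot, LinearMap.ker_eq_bot']
  intro b hb
  have hc : ∀ n, coord (corootComb k b) n = 0 := fun n => by rw [hb]; simp [coord]
  have hl : b ⟨k - 1, by omega⟩ = 0 := by rw [← coord_corootComb_zero hk b, hc]
  have hn : ∀ n, ∀ h : n + 1 < k, b ⟨n, by omega⟩ = 0 := by
    intro n
    induction n with
    | zero =>
      intro h
      have := coord_corootComb_succ hk b 0 (by omega)
      rw [hc, hl] at this
      simpa [h] using this.symm
    | succ n ih =>
      intro h
      have := coord_corootComb_succ hk b (n + 1) (by omega)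
      rw [hc, hl] at this
      simp only [add_tsub_cancel_right, ih (by omega)] at this
      simpa [h] using this.symm
  funext i
  by_cases h : i.val + 1 < k
  · exact hn i h
  · have : i = ⟨k - 1, by omega⟩ := Fin.ext (by simp; omega)
    rw [this]; exact hl

theorem linearIndependent_coroot (hk : 3 ≤ k) : LinearIndependent ℝ (coroot k) :=
  Fintype.linearIndependent_iff.2 fun g hg => by
    have : g = 0 := corootComb_injective hk (by rw [corootComb_apply, hg, map_zero])
    simp [this]

/-- A relation among roots is a combination of coroots orthogonal to everything. Pairing it with
each `h_n` reads off its coordinates, so it is zero. -/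
theorem linearIndependent_root (hk : 3 ≤ k) : LinearIndependent ℝ (root k) := by
  refine Fintype.linearIndependent_iff.2 fun g hg => ?_
  have h : ∀ x, minkowski k (corootComb k g) x = 0 := by
    intro x
    rw [corootComb_apply, map_sum, LinearMap.sum_apply]
    simpa [minkowski_coroot] using LinearMap.congr_fun hg x
  have : g = 0 := by
    refine corootComb_injective hk (ext_coord fun n hn => ?_)
    have := h (hvec k n)
    rw [minkowski_comm] at this
    change eps k n _ = 0 at this
    rw [eps_apply] at this
    have hc : coord (corootComb k g) n = 0 := by
      rcases mul_eq_zero.1 this with h | h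
      · split_ifs at h <;> norm_num at h
      · exact h
    rw [hc]; simp [coord]
  simp [this]

/-- The quadratic form of `E_k` in Minkowski coordinates. -/
theorem form_lower_bound (hk : 3 ≤ k) (b : Fin k → ℝ) :
    (9 - k : ℝ) * ∑ n ∈ Finset.range k, coord (corootComb k b) (n + 1) ^ 2 ≤
      9 * ∑ i, b i * ((cartanMatrix k).map (Int.cast : ℤ → ℝ)).mulVec b i := by
  rw [← minkowski_corootComb hk, minkowski_apply]
  have h := sum_coord_corootComb hk b
  -- With `S` the sum of squares and `x_0` the time coordinate, orthogonality to `K_k` turns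
  -- Cauchy–Schwarz into `9 x_0² ≤ k S`, while the form is `S - x_0²`.
  have hc : (∑ n ∈ Finset.range k, coord (corootComb k b) (n + 1)) ^ 2 ≤
      k * ∑ n ∈ Finset.range k, coord (corootComb k b) (n + 1) ^ 2 := by
    simpa using sq_sum_le_card_mul_sum_sq (s := Finset.range k)
      (f := fun n => coord (corootComb k b) (n + 1))
  rw [h] at hc
  have : ∑ n ∈ Finset.range k, coord (corootComb k b) (n + 1) * coord (corootComb k b) (n + 1) =
    ∑ n ∈ Finset.range k, coord (corootComb k b) (n + 1) ^ 2 :=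
    Finset.sum_congr rfl fun n _ => (sq _).symm
  rw [this]
  nlinarith

/-- Orthogonality to `K_k` determines the time coordinate from the others. -/
theorem corootComb_eq_zero_of_coord (hk : 3 ≤ k) {b : Fin k → ℝ}
    (h : ∀ n < k, coord (corootComb k b) (n + 1) = 0) : b = 0 := by
  refine corootComb_injective hk (ext_coord fun n hn => ?_)
  rw [map_zero]
  have h0 : coord (0 : Cartan k) n = 0 := by simp [coord]
  rw [h0]
  rcases n with _ | n
  · have := sum_coord_corootComb hk b
    rw [Finset.sum_eq_zero fun n hn => h n (Finset.mem_range.1 hn)] at this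
    linarith
  · exact h n (by omega)

theorem form_pos (hk : 3 ≤ k) (hk8 : k ≤ 8) {b : Fin k → ℝ} (hb : b ≠ 0) :
    0 < ∑ i, b i * ((cartanMatrix k).map (Int.cast : ℤ → ℝ)).mulVec b i := by
  have h := form_lower_bound hk b
  have hk' : (k : ℝ) ≤ 8 := by exact_mod_cast hk8
  have hpos : 0 < ∑ n ∈ Finset.range k, coord (corootComb k b) (n + 1) ^ 2 := by
    by_contra hcon
    refine hb (corootComb_eq_zero_of_coord hk fun n hn => ?_)
    have h0 := (Finset.sum_nonneg fun n (_ : n ∈ Finset.range k) =>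
      sq_nonneg (coord (corootComb k b) (n + 1))).antisymm' (not_lt.1 hcon)
    have := (Finset.sum_eq_zero_iff_of_nonneg fun n _ => sq_nonneg _).1 h0 n
      (Finset.mem_range.2 hn)
    exact pow_eq_zero_iff (two_ne_zero) |>.1 this
  nlinarith

/-- Only the existence of a uniform bound matters: it will bound the lengths of nonzero words. The
constant is far from sharp. -/
theorem coeff_le_of_form_eq_two (hk : 3 ≤ k) (hk8 : k ≤ 8) {b : Fin k → ℝ}
    (hb : ∑ i, b i * ((cartanMatrix k).map (Int.cast : ℤ → ℝ)).mulVec b i = 2) (i : Fin k) :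
    b i ≤ 80 := by
  have h := form_lower_bound hk b
  rw [hb] at h
  have hk' : (k : ℝ) ≤ 8 := by exact_mod_cast hk8
  set S := ∑ n ∈ Finset.range k, coord (corootComb k b) (n + 1) ^ 2 with hS
  have hS0 : 0 ≤ S := Finset.sum_nonneg fun n _ => sq_nonneg _
  -- Here `9 - k ≥ 1`. As `18 < 25`, all coordinates are at most `5` in absolute value.
  have hS18 : S ≤ 18 := by nlinarith
  have hn : ∀ n < k, |coord (corootComb k b) (n + 1)| ≤ 5 := by
    intro n hn
    have : coord (corootComb k b) (n + 1) ^ 2 ≤ S :=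
      Finset.single_le_sum (f := fun n => coord (corootComb k b) (n + 1) ^ 2)
        (fun n _ => sq_nonneg _) (Finset.mem_range.2 hn)
    exact abs_le_of_sq_le_sq (by linarith) (by norm_num)
  have h0 : |b ⟨k - 1, by omega⟩| ≤ 5 := by
    rw [← coord_corootComb_zero hk b]
    have h1 := minkowski_corootComb hk b
    rw [hb, minkowski_apply] at h1
    have : ∑ n ∈ Finset.range k, coord (corootComb k b) (n + 1) * coord (corootComb k b) (n + 1) =
      S := Finset.sum_congr rfl fun n _ => (sq _).symm
    rw [this] at h1
    exact abs_le_of_sq_le_sq (by nlinarith) (by norm_num)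
  -- Each step of the recursion adds one coordinate and at most one copy of the last coefficient,
  -- both at most `5`.
  have hind : ∀ n : ℕ, ∀ h : n + 1 < k, b ⟨n, by omega⟩ ≤ 10 * (n + 1) := by
    intro n
    induction n with
    | zero =>
      intro h
      have h1 := coord_corootComb_succ hk b 0 (by omega)
      have h2 := hn 0 (by omega)
      simp [h] at h1
      rw [abs_le] at h0 h2
      simp
      linarith
    | succ n ih =>
      intro h
      have h1 := coord_corootComb_succ hk b (n + 1) (by omega)
      have h2 := hn (n + 1) (by omega)
      have h3 := ih (by omega)
      simp [h] at h1
      rw [abs_le] at h0 h2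
      push_cast
      split_ifs at h1 <;> linarith
  by_cases h : i.val + 1 < k
  · have h1 := hind i h
    have : ((i.val : ℝ) + 1) ≤ k := by exact_mod_cast h.le
    have h2 : b ⟨i, by omega⟩ = b i := rfl
    linarith
  · have : i = ⟨k - 1, by omega⟩ := Fin.ext (by simp; omega)
    rw [this]
    linarith [(abs_le.1 h0).2]

/-- A vector killed by all simple roots has equal coordinates `c` in places `1` to `k` and `-3c` in
place `0`, so it is a multiple of `K_k`. Being also orthogonal to `K_k`, it satisfies `(k - 9) c =
0`. -/
theorem eq_zero_of_mulVec_eq_zero (hk : 3 ≤ k) (hk9 : k ≠ 9) {b : Fin k → ℝ}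
    (hb : ((cartanMatrix k).map (Int.cast : ℤ → ℝ)).mulVec b = 0) : b = 0 := by
  set v := corootComb k b with hv
  have hr : ∀ i, root k i v = 0 := fun i => by rw [root_corootComb hk, hb]; rfl
  have hc : ∀ n < k, coord v (n + 1) = coord v 1 := by
    intro n
    induction n with
    | zero => simp
    | succ n ih =>
      intro h
      have h1 := hr ⟨n, by omega⟩
      rw [root_apply, if_pos (by simpa using h)] at h1
      rw [← ih (by omega)]
      simp only at h1
      have h2 : n + 1 + 1 = n + 2 := rfl
      rw [h2]
      linarith
  have hl := hr ⟨k - 1, by omega⟩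
  rw [root_apply, if_neg (by simp; omega), hc 1 (by omega), hc 2 (by omega)] at hl
  have hs := sum_coord_corootComb hk b
  rw [Finset.sum_congr rfl fun n hn => hc n (Finset.mem_range.1 hn), Finset.sum_const,
    Finset.card_range, nsmul_eq_mul] at hs
  have h9 : (k - 9 : ℝ) * coord v 1 = 0 := by rw [← hv] at hs; linarith
  have h1 : coord v 1 = 0 := by
    refine (mul_eq_zero.1 h9).resolve_left ?_
    rw [← ne_eq, sub_ne_zero]
    exact_mod_cast hk9
  exact corootComb_eq_zero_of_coord hk fun n hn => by rw [← hv, hc n hn, h1]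

/-- For `k ≠ 9` the canonical element and the coroots form a basis. -/
theorem exists_decomposition (hk : 3 ≤ k) (hk9 : k ≠ 9) :
    ∃ T : (ℝ × (Fin k → ℝ)) ≃ₗ[ℝ] Cartan k,
      ∀ a b, T (a, b) = a • canonical k + corootComb k b := by
  let T₀ : (ℝ × (Fin k → ℝ)) →ₗ[ℝ] Cartan k :=
    LinearMap.coprod (LinearMap.toSpanSingleton ℝ _ (canonical k)) (corootComb k)
  have hT : ∀ a b, T₀ (a, b) = a • canonical k + corootComb k b := fun a b => by simp [T₀]
  have hinj : Function.Injective T₀ := by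
    rw [← LinearMap.ker_eq_bot, LinearMap.ker_eq_bot']
    rintro ⟨a, b⟩ h
    rw [hT] at h
    -- Applying the simple roots removes the multiple of the canonical element and leaves a kernel
    -- vector of the matrix.
    have hb : b = 0 := by
      refine eq_zero_of_mulVec_eq_zero hk hk9 (funext fun i => ?_)
      have := congrArg (root k i) h
      rw [map_add, map_smul, root_canonical hk, root_corootComb hk] at this
      simpa using this
    subst hb
    have := congrArg (fun x => coord x 0) h
    simp only [map_zero, add_zero, coord_smul, coord_canonical_zero] at this
    have h0 : coord (0 : Cartan k) 0 = 0 := by simp [coord]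
    rw [h0] at this
    have ha : a = 0 := by linarith
    simp [ha]
  exact ⟨T₀.linearEquivOfInjective hinj (by simp [add_comm]), hT⟩

end ESeries

namespace ESeries

variable {k : ℕ}

/-! ### Types of the matrices -/

/-- The diagram is connected: the line joins its nodes to the first one, and the last node hangs on
node `3`. For `k = 3` the last node is isolated, whence `4 ≤ k`. -/
theorem isIndecomposableGCM (hk : 4 ≤ k) : IsIndecomposableGCM (cartanMatrix k) where
  diag i := by simp [cartanMatrix]
  off_diag i j hij := by
    unfold cartanMatrix
    split_ifs <;> first | contradiction | norm_num
  zero i j h := by rw [cartanMatrix_symm, h]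
  indecomposable S hS hSc := by
    by_contra! hcon
    have key : ∀ i j : Fin k, cartanMatrix k i j ≠ 0 → (i ∈ S ↔ j ∈ S) := by
      intro i j hij
      constructor
      · intro hi
        by_contra hj
        exact hij (hcon i hi j hj)
      · intro hj
        by_contra hi
        exact hij (by rw [cartanMatrix_symm]; exact hcon j hj i hi)
    have hline : ∀ n (h : n + 1 < k), (⟨n, by omega⟩ : Fin k) ∈ S ↔ (⟨0, by omega⟩ : Fin k) ∈ S := by
      intro n
      induction n with
      | zero => intro _; rfl
      | succ n ih =>
        intro h
        rw [← ih (by omega)]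
        refine key _ _ ?_
        rw [cartanMatrix, if_neg (by simp), if_pos (by simp; omega)]
        norm_num
    have hall : ∀ i : Fin k, i ∈ S ↔ (⟨0, by omega⟩ : Fin k) ∈ S := by
      intro i
      by_cases h : i.val + 1 < k
      · exact hline i h
      · rw [← hline 2 (by omega)]
        refine key _ _ ?_
        have := i.2
        rw [cartanMatrix, if_neg (fun h => by rw [h] at *; simp at *; omega),
          if_pos (by simp; omega)]
        norm_num
    obtain ⟨i, hi⟩ := hS
    obtain ⟨j, hj⟩ := hSc
    exact hj ((hall j).2 ((hall i).1 hi))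

/-- The marks of the affine diagram `E_9`. -/
def mark : Fin 9 → ℤ := ![2, 4, 6, 5, 4, 3, 2, 1, 3]

section Affine

variable (K : Type*) [Field K]

theorem cartanMatrix_nine_eq : cartanMatrix 9 =
    !![2, -1, 0, 0, 0, 0, 0, 0, 0;
       -1, 2, -1, 0, 0, 0, 0, 0, 0;
       0, -1, 2, -1, 0, 0, 0, 0, -1;
       0, 0, -1, 2, -1, 0, 0, 0, 0;
       0, 0, 0, -1, 2, -1, 0, 0, 0;
       0, 0, 0, 0, -1, 2, -1, 0, 0;
       0, 0, 0, 0, 0, -1, 2, -1, 0;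
       0, 0, 0, 0, 0, 0, -1, 2, 0;
       0, 0, -1, 0, 0, 0, 0, 0, 2] := by
  decide

theorem mulVec_mark :
    ((cartanMatrix 9).map (Int.cast : ℤ → K)).mulVec (fun i => (mark i : K)) = 0 := by
  have h : (cartanMatrix 9).mulVec mark = 0 := by decide
  funext i
  have := congrArg (Int.cast : ℤ → K) (congrFun h i)
  simpa [Matrix.mulVec, dotProduct] using this

/-- Index `7` is the end of the long arm, where the mark is `1`. The equations are solved from there
inwards. -/
theorem eq_smul_mark [CharZero K] {v : Fin 9 → K}
    (hv : ((cartanMatrix 9).map (Int.cast : ℤ → K)).mulVec v = 0) :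
    v = v 7 • fun i => (mark i : K) := by
  rw [cartanMatrix_nine_eq] at hv
  have e := fun i => congrFun hv i
  simp only [Matrix.mulVec, dotProduct, Fin.sum_univ_succ, Matrix.map_apply, Pi.zero_apply,
    Fin.forall_fin_succ, Fin.succ_zero_eq_one, Fin.succ_one_eq_two] at e
  simp at e
  obtain ⟨e0, e1, e2, e3, e4, e5, e6, e7, e8⟩ := e
  have two : (2 : K) ≠ 0 := two_ne_zero
  change 2 * v 0 + -v 1 = 0 at e0
  change -v 0 + (2 * v 1 + -v 2) = 0 at e1
  change -v 1 + (2 * v 2 + (-v 3 + -v 8)) = 0 at e2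
  change -v 2 + (2 * v 3 + -v 4) = 0 at e3
  change -v 3 + (2 * v 4 + -v 5) = 0 at e4
  change -v 4 + (2 * v 5 + -v 6) = 0 at e5
  change -v 5 + (2 * v 6 + -v 7) = 0 at e6
  change -v 6 + 2 * v 7 = 0 at e7
  change -v 2 + 2 * v 8 = 0 at e8
  have h6 : v 6 = v 7 * 2 := by linear_combination -e7
  have h5 : v 5 = v 7 * 3 := by linear_combination -e6 + 2 * h6
  have h4 : v 4 = v 7 * 4 := by linear_combination -e5 + 2 * h5 - h6
  have h3 : v 3 = v 7 * 5 := by linear_combination -e4 + 2 * h4 - h5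
  have h2 : v 2 = v 7 * 6 := by linear_combination -e3 + 2 * h3 - h4
  -- The only division: the equation at the short arm gives `2 v_8 = v_2`.
  have h8 : v 8 = v 7 * 3 := mul_left_cancel₀ two (by linear_combination e8 + h2)
  have h1 : v 1 = v 7 * 4 := by linear_combination -e2 + 2 * h2 - h3 - h8
  have h0 : v 0 = v 7 * 2 := by linear_combination -e1 + 2 * h1 - h2
  funext i
  fin_cases i <;> simp [mark, h0, h1, h2, h3, h4, h5, h6, h8]

theorem rank_cartanMatrix_nine [CharZero K] :
    ((cartanMatrix 9).map (Int.cast : ℤ → K)).rank = 8 := by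
  set M := (cartanMatrix 9).map (Int.cast : ℤ → K)
  have hker : LinearMap.ker M.mulVecLin = K ∙ (fun i => (mark i : K)) := by
    ext v
    rw [LinearMap.mem_ker, Matrix.mulVecLin_apply, Submodule.mem_span_singleton]
    constructor
    · intro h
      exact ⟨v 7, (eq_smul_mark K h).symm⟩
    · rintro ⟨c, rfl⟩
      rw [Matrix.mulVec_smul, mulVec_mark, smul_zero]
  have h := LinearMap.finrank_range_add_finrank_ker M.mulVecLin
  rw [hker, finrank_span_singleton (by
    intro h
    have := congrFun h 7
    simp [mark] at this)] at h
  simp at h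
  exact h

end Affine

/-- For the last condition, pair `C v` with the marks: by symmetry the result is zero, and a sum of
nonnegative terms with positive weights vanishes only termwise. -/
theorem isAffineType_nine : IsAffineType (cartanMatrix 9) where
  toIsIndecomposableGCM := isIndecomposableGCM (by norm_num)
  corank := by rw [rank_cartanMatrix_nine]; rfl
  exists_pos := ⟨fun i => (mark i : ℝ), fun i => by fin_cases i <;> simp [mark], mulVec_mark ℝ⟩
  eq_zero v hv := by
    set M := (cartanMatrix 9).map (Int.cast : ℤ → ℝ) with hM
    have hsymm : M.transpose = M := by
      ext i j
      simp [hM, cartanMatrix_symm i j]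
    have h : ∑ i, (mark i : ℝ) * M.mulVec v i = 0 := by
      change (fun i => (mark i : ℝ)) ⬝ᵥ M.mulVec v = 0
      rw [Matrix.dotProduct_mulVec, ← Matrix.mulVec_transpose, hsymm, mulVec_mark,
        zero_dotProduct]
    have hpos : ∀ i, (0 : ℝ) < mark i := fun i => by fin_cases i <;> simp [mark]
    funext i
    have := (Finset.sum_eq_zero_iff_of_nonneg fun i _ => mul_nonneg (hpos i).le (hv i)).1 h i
      (Finset.mem_univ i)
    exact (mul_eq_zero.1 this).resolve_left (hpos i).ne'

/-- A positive combination of coroots on which all simple roots are negative, for `k ≥ 10`. -/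
theorem exists_pos_mulVec_neg (hk : 10 ≤ k) : ∃ u : Fin k → ℝ, (∀ i, 0 < u i) ∧
    ∀ i, ((cartanMatrix k).map (Int.cast : ℤ → ℝ)).mulVec u i < 0 := by
  have hk3 : 3 ≤ k := by omega
  -- The vector is chosen by its Minkowski coordinates `x_j = j - P` for `1 ≤ j ≤ k` and `x_0 = d`.
  -- Increasing coordinates make the line roots equal to `-1`, and `d` is forced by orthogonality to
  -- `K_k`. The last root is then `3P - 6 - d`, negative for large `P` because `d` is about `k P /
  -- 3` and `k > 9`. The coefficients `u` come from the recursion `coord_corootComb_succ`.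
  set P : ℝ := (k : ℝ) ^ 2 with hP
  set d : ℝ := (k * P - k * (k + 1) / 2) / 3 with hd
  have hkr : (10 : ℝ) ≤ k := by exact_mod_cast hk
  let u : Fin k → ℝ := fun i => if i.val + 1 < k then
    (if i.val = 0 then 1 else if i.val = 1 then 2 else 3) * d - (i.val + 1) * P +
      (i.val + 1) * (i.val + 2) / 2 else d
  have hdl : 3 * P < d + 6 := by rw [hd, hP]; nlinarith
  have hP10 : 100 ≤ P := by nlinarith
  refine ⟨u, fun i => ?_, fun i => ?_⟩
  · simp only [u]
    by_cases h : i.val + 1 < k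
    · rw [if_pos h]
      obtain ⟨n, hn⟩ := i
      simp only at h ⊢
      split_ifs with h0 h1
      · subst h0; push_cast; linarith
      · subst h1; push_cast; linarith
      · have h' : (n : ℝ) + 2 ≤ k := by exact_mod_cast h
        -- The value is the sum of `P - j` over `n + 2 ≤ j ≤ k`, visibly positive in factored form.
        have : 3 * d - (n + 1) * P + (n + 1) * (n + 2) / 2 =
          (k - (n + 1)) * (P - (k + n + 2) / 2) := by rw [hd]; ring
        rw [this]
        refine mul_pos (by linarith) ?_
        rw [hP]
        nlinarith
    · rw [if_neg h]; linarith
  · rw [← root_corootComb hk3, root_apply]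
    have hl : u ⟨k - 1, by omega⟩ = d := by
      simp only [u]; rw [if_neg (by omega)]
    have hc : ∀ n < k, coord (corootComb k u) (n + 1) = n + 1 - P := by
      intro n hn
      rw [coord_corootComb_succ hk3 u n hn, hl]
      by_cases h : n + 1 < k
      · rw [if_pos h]
        have hu : ∀ m (hm : m + 1 < k), u ⟨m, by omega⟩ =
          (if m = 0 then 1 else if m = 1 then 2 else 3) * d - (m + 1) * P +
            (m + 1) * (m + 2) / 2 := fun m hm => by simp only [u]; rw [if_pos hm]
        rcases n with _ | _ | _ | n
        · rw [hu _ h]; simp; ring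
        · rw [hu _ h, dif_pos (by omega), hu _ (by omega)]; simp; ring
        · rw [hu _ h, dif_pos (by omega), hu _ (by omega)]; simp; ring
        · rw [hu _ h, dif_pos (by omega), hu _ (by omega)]
          rw [if_neg (by omega : ¬ (n + 1 + 1 + 1 < 3))]
          simp
          ring
      -- At the end of the recursion no coefficient is left to choose; this coordinate is right by
      -- the choice of `d`.
      · have hnk : n = k - 1 := by omega
        have h' : (n : ℝ) + 1 = k := by
          rw [hnk]; push_cast [Nat.cast_sub (show 1 ≤ k by omega)]; ring
        rw [if_neg h, dif_pos (by omega), if_neg (by omega)]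
        have hm : (((n - 1 : ℕ) : ℝ)) = k - 2 := by
          rw [hnk, Nat.sub_sub, Nat.cast_sub (by omega)]; push_cast; ring
        simp only [u]
        rw [if_pos (by omega), if_neg (by omega), if_neg (by omega), hm, h', hd]
        ring
    split_ifs with h
    · rw [hc _ (by omega), show (i.val + 2) = (i.val + 1) + 1 from rfl, hc _ (by omega)]
      push_cast
      linarith
    · rw [coord_corootComb_zero hk3, hl, hc 0 (by omega), hc 1 (by omega), hc 2 (by omega)]
      push_cast
      linarith

/-- Symmetry gives `(u, C v) = (C u, v)`, with left side nonnegative and right side nonpositive.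
Both vanish, and strict negativity of `C u` forces `v = 0`. -/
theorem isIndefiniteType (hk : 10 ≤ k) : IsIndefiniteType (cartanMatrix k) where
  toIsIndecomposableGCM := isIndecomposableGCM (by omega)
  exists_pos := exists_pos_mulVec_neg hk
  eq_zero v hv hv0 := by
    obtain ⟨u, hu, hCu⟩ := exists_pos_mulVec_neg hk
    set M := (cartanMatrix k).map (Int.cast : ℤ → ℝ) with hM
    have hsymm : M.transpose = M := by
      ext i j
      simp [hM, cartanMatrix_symm i j]
    have h : ∑ i, u i * M.mulVec v i = ∑ i, M.mulVec u i * v i := by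
      change u ⬝ᵥ M.mulVec v = M.mulVec u ⬝ᵥ v
      rw [Matrix.dotProduct_mulVec, ← Matrix.mulVec_transpose, hsymm]
    have h1 : 0 ≤ ∑ i, u i * M.mulVec v i :=
      Finset.sum_nonneg fun i _ => mul_nonneg (hu i).le (hv i)
    have h2 : ∑ i, -(M.mulVec u i * v i) = 0 := by
      refine le_antisymm ?_ (Finset.sum_nonneg fun i _ => ?_)
      · rw [Finset.sum_neg_distrib, ← h]; linarith
      · nlinarith [hCu i, hv0 i]
    funext i
    have := (Finset.sum_eq_zero_iff_of_nonneg fun i _ => by nlinarith [hCu i, hv0 i]).1 h2 i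
      (Finset.mem_univ i)
    exact (mul_eq_zero.1 (neg_eq_zero.1 this)).resolve_left (hCu i).ne

end ESeries

namespace ESeries

/-! ### Realizations of the affine matrix -/

section Realization

variable {K V : Type*} [Field K] [CharZero K] [AddCommGroup V] [Module K V]
  {α : Fin 9 → Module.Dual K V} {αv : Fin 9 → V}

/-- By duality: injectivity of the transpose is the linear independence of the functionals. -/
theorem _root_.LinearIndependent.pi_surjective {K V ι : Type*} [Field K] [AddCommGroup V]
    [Module K V] [Finite ι] {α : ι → Module.Dual K V} (h : LinearIndependent K α) :
    Function.Surjective (LinearMap.pi α : V →ₗ[K] ι → K) := by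
  classical
  have := Fintype.ofFinite ι
  rw [← LinearMap.dualMap_injective_iff, ← LinearMap.ker_eq_bot, LinearMap.ker_eq_bot']
  intro φ hφ
  have h0 : ∑ i, φ (Pi.single i 1) • α i = 0 := by
    ext x
    have h1 : φ (fun i => α i x) = 0 := LinearMap.congr_fun hφ x
    rw [LinearMap.pi_apply_eq_sum_univ] at h1
    rw [LinearMap.sum_apply, LinearMap.zero_apply, ← h1]
    refine Finset.sum_congr rfl fun i _ => ?_
    rw [LinearMap.smul_apply, smul_eq_mul, smul_eq_mul, mul_comm]
    congr 2
    funext j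
    simp [Pi.single_apply, eq_comm]
  ext i
  simpa using Fintype.linearIndependent_iff.1 h _ h0 i

/-- In a realization of the affine matrix, the coroots are completed to a basis by an element with
prescribed values of the simple roots. -/
theorem exists_basis_of_isRealization (H : IsRealization K (cartanMatrix 9) α αv) :
    ∃ b : Module.Basis (Option (Fin 9)) K V, (∀ i, b (some i) = αv i) ∧
      ∀ j, α j (b none) = if j = 7 then 1 else 0 := by
  obtain ⟨d, hd⟩ := H.root_indep.pi_surjective (fun j => if j = 7 then 1 else 0)
  have hd' : ∀ j, α j d = if j = 7 then 1 else 0 := fun j => congrFun hd j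
  let v : Option (Fin 9) → V := fun o => o.elim d αv
  have hm := mulVec_mark K
  have hind : LinearIndependent K v := by
    rw [linearIndependent_option]
    refine ⟨H.coroot_indep, fun hmem => ?_⟩
    -- The null root. It vanishes on every coroot but takes the value `1` on `d`, since the mark at
    -- index `7` is `1`; hence `d` is not in the span of the coroots.
    let ℓ : Module.Dual K V := ∑ j, (mark j : K) • α j
    have h0 : ∀ i, ℓ (αv i) = 0 := fun i => by
      have := congrFun hm i
      simp only [ℓ, LinearMap.sum_apply, LinearMap.smul_apply, H.pairing, smul_eq_mul]
      simpa [Matrix.mulVec, dotProduct, mul_comm] using this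
    have h1 : ℓ d = 1 := by
      simp only [ℓ, LinearMap.sum_apply, LinearMap.smul_apply, hd', smul_eq_mul]
      simp [mark]
    have h2 : Submodule.span K (Set.range (v ∘ some)) ≤ LinearMap.ker ℓ := by
      rw [Submodule.span_le]
      rintro _ ⟨i, rfl⟩
      exact h0 i
    have h3 : ℓ d = 0 := h2 hmem
    rw [h1] at h3
    exact one_ne_zero h3
  have := H.finite
  have hcard : Fintype.card (Option (Fin 9)) = Module.finrank K V := by
    have := H.dim
    rw [rank_cartanMatrix_nine] at this
    simp only [Fintype.card_option, Fintype.card_fin] at this ⊢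
    omega
  refine ⟨basisOfLinearIndependentOfCardEqFinrank hind hcard, fun i => by simp [v], fun j => ?_⟩
  rw [coe_basisOfLinearIndependentOfCardEqFinrank]
  exact hd' j

theorem isRealization_nine : IsRealization ℝ (cartanMatrix 9) (root 9) (coroot 9) where
  finite := inferInstance
  root_indep := linearIndependent_root (by norm_num)
  coroot_indep := linearIndependent_coroot (by norm_num)
  pairing i j := root_coroot (by norm_num) i j
  dim := by rw [rank_cartanMatrix_nine]; simp

/-- Realizations of the affine matrix over the same field are isomorphic. -/
theorem exists_equiv_of_isRealization {W : Type*} [AddCommGroup W] [Module K W]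
    {β : Fin 9 → Module.Dual K W} {βv : Fin 9 → W} (H : IsRealization K (cartanMatrix 9) α αv)
    (H' : IsRealization K (cartanMatrix 9) β βv) :
    ∃ φ : V ≃ₗ[K] W, (∀ i, φ (αv i) = βv i) ∧ ∀ i x, β i (φ x) = α i x := by
  obtain ⟨b, hb, hb'⟩ := exists_basis_of_isRealization H
  obtain ⟨c, hc, hc'⟩ := exists_basis_of_isRealization H'
  refine ⟨b.equiv c (Equiv.refl _), fun i => by rw [← hb, ← hc]; simp, fun i => ?_⟩
  -- On coroots both sides are entries of the matrix, and on the additional vector both are the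
  -- prescribed values.
  suffices h : β i ∘ₗ (b.equiv c (Equiv.refl _)).toLinearMap = α i from
    fun x => LinearMap.congr_fun h x
  refine b.ext fun o => ?_
  cases o with
  | none => simp [hb', hc']
  | some j =>
    have h : b.equiv c (Equiv.refl _) (b (some j)) = c (some j) := by simp
    change β i (b.equiv c (Equiv.refl _) (b (some j))) = α i (b (some j))
    rw [h, hb, hc, H.pairing, H'.pairing]

/-- Realizations of the affine matrix become isomorphic after extension of scalars. -/
theorem exists_baseChange_equiv_of_isRealization {A W : Type*} [Field A] [CharZero A] [Algebra K A]
    [AddCommGroup W] [Module A W]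
    {β : Fin 9 → Module.Dual A W} {βv : Fin 9 → W} (H : IsRealization K (cartanMatrix 9) α αv)
    (H' : IsRealization A (cartanMatrix 9) β βv) :
    ∃ ψ : (A ⊗[K] V) ≃ₗ[A] W, (∀ i, ψ (1 ⊗ₜ αv i) = βv i) ∧
      ∀ i x, β i (ψ (1 ⊗ₜ x)) = algebraMap K A (α i x) := by
  obtain ⟨b, hb, hb'⟩ := exists_basis_of_isRealization H
  obtain ⟨c, hc, hc'⟩ := exists_basis_of_isRealization H'
  let ψ := (b.baseChange A).equiv c (Equiv.refl _)
  have hψ : ∀ o, ψ (1 ⊗ₜ b o) = c o := fun o => by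
    rw [← Module.Basis.baseChange_apply]
    simp only [ψ, Module.Basis.equiv_apply, Equiv.refl_apply]
  refine ⟨ψ, fun i => by rw [← hb, ← hc]; exact hψ _, fun i => ?_⟩
  suffices h : (β i ∘ₗ ψ.toLinearMap).restrictScalars K ∘ₗ TensorProduct.mk K A V 1 =
      Algebra.linearMap K A ∘ₗ α i from fun x => LinearMap.congr_fun h x
  refine b.ext fun o => ?_
  change β i (ψ (1 ⊗ₜ b o)) = algebraMap K A (α i (b o))
  rw [hψ]
  cases o with
  | none => rw [hb', hc']; split_ifs <;> simp
  | some j => rw [hb, hc, H.pairing, H'.pairing]; simp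

end Realization

/-! ### The central extension -/

section CentralExtension

variable {k : ℕ}

attribute [local instance] LieRing.ofAssociativeRing

/-- Reconciles the two conventions for the Serre relations: `ad x ^ (1 - c)` applied to `y`, and `ad
x ^ (-c)` applied to `[x, y]`. -/
theorem toNat_neg_cartanMatrix (i j : Fin k) (hij : i ≠ j) {n : ℕ}
    (hn : (n : ℝ) = 1 - (cartanMatrix k i j : ℝ)) : n = (-cartanMatrix k i j).toNat + 1 := by
  have h : (n : ℤ) = 1 - cartanMatrix k i j := by exact_mod_cast hn
  have : cartanMatrix k i j ≤ 0 := by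
    unfold cartanMatrix
    split_ifs <;> first | contradiction | norm_num
  omega

theorem isSerreFamily_G (hk : 3 ≤ k) :
    IsSerreFamily ℝ (cartanMatrix k) (fun i => gh k (coroot k i)) (ge k) (gf k) := by
  have H := ChevalleyAlgebra.isChevalleyFamily_gen (root k) (coroot k)
  have hs : ∀ i j : Fin k, i ≠ j →
      (((-cartanMatrix k i j).toNat + 1 : ℕ) : ℝ) = 1 - root k j (coroot k i) := by
    intro i j hij
    have : cartanMatrix k i j ≤ 0 := by
      unfold cartanMatrix
      split_ifs <;> first | contradiction | norm_num
    rw [root_coroot hk]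
    have h : (((-cartanMatrix k i j).toNat + 1 : ℕ) : ℤ) = 1 - cartanMatrix k i j := by
      omega
    exact_mod_cast h
  refine ⟨fun i j => H.hh _ _, fun i j => ?_, fun i j => ?_, fun i => H.ef_same i, H.ef_ne,
    fun i j => ?_, fun i j => ?_⟩
  · have := H.he (coroot k i) j
    rw [root_coroot hk, Int.cast_smul_eq_zsmul] at this
    exact this
  · have := H.hf (coroot k i) j
    rw [root_coroot hk, Int.cast_smul_eq_zsmul] at this
    exact this
  · rcases eq_or_ne i j with rfl | hij
    · simp
    · have := H.serre_e i j hij _ (hs i j hij)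
      rwa [pow_succ, Module.End.mul_apply, LieAlgebra.ad_apply] at this
  · rcases eq_or_ne i j with rfl | hij
    · simp
    · have := H.serre_f i j hij _ (hs i j hij)
      rwa [pow_succ, Module.End.mul_apply, LieAlgebra.ad_apply] at this

theorem lie_canonical (hk : 3 ≤ k) (x : G k) : ⁅gh k (canonical k), x⁆ = 0 := by
  have H := ChevalleyAlgebra.isChevalleyFamily_gen (root k) (coroot k)
  have hx : x ∈ LieSubalgebra.lieSpan ℝ (G k)
      (Set.range (ChevalleyAlgebra.gen ℝ (root k) (coroot k))) := by
    rw [ChevalleyAlgebra.lieSpan_range_gen]; trivial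
  induction hx using LieSubalgebra.lieSpan_induction with
  | mem y hy =>
    obtain ⟨y, rfl⟩ := hy
    cases y with
    | h y => exact H.hh _ _
    | e i =>
      have := H.he (canonical k) i
      rwa [root_canonical hk, zero_smul] at this
    | f i =>
      have := H.hf (canonical k) i
      rwa [root_canonical hk, zero_smul, neg_zero] at this
  | zero => simp
  | add u v _ _ hu hv => rw [lie_add, hu, hv, add_zero]
  | smul t u _ hu => rw [lie_smul, hu, smul_zero]
  | lie u v _ _ hu hv => rw [leibniz_lie, hu, hv, zero_lie, lie_zero, add_zero]

/-- The morphism `ℝ × 𝔢_k → 𝔤_k`. -/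
noncomputable def fromProd (hk : 3 ≤ k) : (ℝ × E ℝ k) →ₗ⁅ℝ⁆ G k where
  toFun p := p.1 • gh k (canonical k) + Matrix.ToLieAlgebra.lift (isSerreFamily_G hk) p.2
  map_add' p q := by
    simp only [Prod.fst_add, Prod.snd_add, map_add, add_smul]
    abel
  map_smul' c p := by
    simp only [Prod.smul_fst, Prod.smul_snd, map_smul, smul_add, smul_smul, smul_eq_mul,
      RingHom.id_apply]
  map_lie' := by
    intro p q
    have h1 : ⁅p, q⁆.1 = 0 := by
      change ⁅p.1, q.1⁆ = 0
      rw [LieRing.of_associative_ring_bracket, mul_comm, sub_self]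
    have h2 : ⁅p, q⁆.2 = ⁅p.2, q.2⁆ := rfl
    have hc : ∀ x : G k, ⁅x, gh k (canonical k)⁆ = 0 := fun x => by
      rw [← lie_skew, lie_canonical hk, neg_zero]
    simp only [h1, h2, zero_smul, zero_add, LieHom.map_lie, add_lie, lie_add, smul_lie, lie_smul,
      lie_canonical hk, hc, smul_zero]

/-- The inverse of `T` splits a Cartan element into its `K_k`-part and its coroot coefficients. The
roots see only the latter, so the first factor can be abelian. -/
theorem isChevalleyFamily_prod (hk : 3 ≤ k) (T : (ℝ × (Fin k → ℝ)) ≃ₗ[ℝ] Cartan k)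
    (hT : ∀ a b, T (a, b) = a • canonical k + corootComb k b) :
    IsChevalleyFamily ℝ (L := ℝ × E ℝ k) (root k) (coroot k)
      (LinearMap.prodMap LinearMap.id
        (Fintype.linearCombination ℝ fun i => egen ℝ k (.H i)) ∘ₗ T.symm.toLinearMap)
      (fun i => (0, egen ℝ k (.E i))) (fun i => (0, egen ℝ k (.F i))) := by
  have S : IsSerreFamily ℝ (cartanMatrix k) (fun i => egen ℝ k (.H i))
    (fun i => egen ℝ k (.E i)) (fun i => egen ℝ k (.F i)) :=
    Matrix.ToLieAlgebra.isSerreFamily_gen ℝ (cartanMatrix k)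
  have hroot : ∀ p i, root k i (T p) = ∑ j, p.2 j * cartanMatrix k j i := by
    rintro ⟨a, b⟩ i
    rw [hT, map_add, map_smul, root_canonical hk, smul_zero, zero_add, root_corootComb hk,
      Matrix.mulVec, dotProduct]
    exact Finset.sum_congr rfl fun j _ => by
      rw [Matrix.map_apply, cartanMatrix_symm, mul_comm]
  have hb : ∀ a b : ℝ, ⁅a, b⁆ = 0 := fun a b => by
    rw [LieRing.of_associative_ring_bracket, mul_comm, sub_self]
  have ha : ∀ (n : ℕ) (x y : E ℝ k), (LieAlgebra.ad ℝ (ℝ × E ℝ k) (0, x) ^ n) (0, y) =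
      (0, (LieAlgebra.ad ℝ (E ℝ k) x ^ n) y) := fun n x y =>
    (LieHom.map_ad_pow (LieHom.inr ℝ ℝ (E ℝ k)) n x y).symm
  refine ⟨fun x y => ?_, fun x i => ?_, fun x i => ?_, fun i => ?_, fun i j hij => ?_,
    fun i j hij n hn => ?_, fun i j hij n hn => ?_⟩
  · ext
    · exact hb _ _
    · change ⁅Fintype.linearCombination ℝ (fun i => egen ℝ k (.H i)) (T.symm x).2,
        Fintype.linearCombination ℝ (fun i => egen ℝ k (.H i)) (T.symm y).2⁆ = 0
      simp only [Fintype.linearCombination_apply, sum_lie, lie_sum, smul_lie, lie_smul, S.hh,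
        smul_zero, Finset.sum_const_zero]
  · obtain ⟨p, rfl⟩ := T.surjective x
    rw [hroot]
    ext
    · change ⁅_, (0 : ℝ)⁆ = _
      simp
    · change ⁅Fintype.linearCombination ℝ (fun i => egen ℝ k (.H i)) (T.symm (T p)).2, _⁆ = _
      rw [LinearEquiv.symm_apply_apply, Prod.smul_snd]
      simp only [Fintype.linearCombination_apply, sum_lie, smul_lie, S.he,
        Finset.sum_smul, mul_smul, Int.cast_smul_eq_zsmul]
  · obtain ⟨p, rfl⟩ := T.surjective x
    rw [hroot]
    ext
    · change ⁅_, (0 : ℝ)⁆ = _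
      simp
    · change ⁅Fintype.linearCombination ℝ (fun i => egen ℝ k (.H i)) (T.symm (T p)).2, _⁆ = _
      rw [LinearEquiv.symm_apply_apply, Prod.snd_neg, Prod.smul_snd]
      simp only [Fintype.linearCombination_apply, sum_lie, smul_lie, S.hf,
        Finset.sum_smul, mul_smul, Int.cast_smul_eq_zsmul, smul_neg,
        Finset.sum_neg_distrib]
  · have h : coroot k i = T (0, Pi.single i 1) := by
      rw [hT, zero_smul, zero_add, corootComb]
      simp [Fintype.linearCombination_apply_single]
    rw [h]
    ext
    · change ⁅(0 : ℝ), (0 : ℝ)⁆ = (T.symm (T _)).1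
      simp
    · change ⁅_, _⁆ = Fintype.linearCombination ℝ (fun i => egen ℝ k (.H i)) (T.symm (T _)).2
      rw [LinearEquiv.symm_apply_apply]
      simp [Fintype.linearCombination_apply_single, S.ef_same]
  · ext
    · exact hb _ _
    · exact S.ef_ne i j hij
  · rw [root_coroot hk] at hn
    rw [toNat_neg_cartanMatrix i j hij hn, ha, pow_succ, Module.End.mul_apply,
      LieAlgebra.ad_apply, S.serre_e]
    rfl
  · rw [root_coroot hk] at hn
    rw [toNat_neg_cartanMatrix i j hij hn, ha, pow_succ, Module.End.mul_apply,
      LieAlgebra.ad_apply, S.serre_f]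
    rfl

/-- Both composites fix generators; on `ℝ × 𝔢_k` the two factors are checked separately. The
condition `k ≠ 9` enters only through the decomposition of the Cartan space. -/
theorem isTrivialCentralExtension (hk : 3 ≤ k) (hk9 : k ≠ 9) : IsTrivialCentralExtension k := by
  obtain ⟨T, hT⟩ := exists_decomposition hk hk9
  have H := isChevalleyFamily_prod hk T hT
  have hgh : ∀ p : ℝ × (Fin k → ℝ), ChevalleyAlgebra.lift H (gh k (T p)) =
      (p.1, Fintype.linearCombination ℝ (fun i => egen ℝ k (.H i)) p.2) := by
    intro p
    refine (ChevalleyAlgebra.lift_gen H _).trans ?_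
    simp [chevalleyValue]
  have hge : ∀ i, ChevalleyAlgebra.lift H (ge k i) = (0, egen ℝ k (.E i)) :=
    fun i => ChevalleyAlgebra.lift_gen H _
  have hgf : ∀ i, ChevalleyAlgebra.lift H (gf k i) = (0, egen ℝ k (.F i)) :=
    fun i => ChevalleyAlgebra.lift_gen H _
  have hcan : ChevalleyAlgebra.lift H (gh k (canonical k)) = (1, 0) := by
    have : canonical k = T (1, 0) := by rw [hT]; simp
    rw [this, hgh, map_zero]
  have hco : ∀ i, ChevalleyAlgebra.lift H (gh k (coroot k i)) = (0, egen ℝ k (.H i)) := by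
    intro i
    have h : coroot k i = T (0, Pi.single i 1) := by
      rw [hT, zero_smul, zero_add, corootComb]
      simp [Fintype.linearCombination_apply_single]
    rw [h, hgh]
    simp [Fintype.linearCombination_apply_single]
  have hF : ∀ x, Matrix.ToLieAlgebra.lift (isSerreFamily_G hk) (egen ℝ k x) =
      serreValue (fun i => gh k (coroot k i)) (ge k) (gf k) x :=
    fun x => Matrix.ToLieAlgebra.lift_gen (isSerreFamily_G hk) x
  have hfrom : ∀ p, fromProd hk p =
      p.1 • gh k (canonical k) + Matrix.ToLieAlgebra.lift (isSerreFamily_G hk) p.2 :=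
    fun p => rfl
  refine ⟨LieEquiv.ofHoms (ChevalleyAlgebra.lift H) (fromProd hk)
    (ChevalleyAlgebra.hom_ext fun x => ?_) ?_, hcan, fun i => ⟨hco i, hge i, hgf i⟩⟩
  · rw [LieHom.comp_apply, LieHom.id_apply]
    cases x with
    | h x =>
      obtain ⟨⟨a, b⟩, rfl⟩ := T.surjective x
      refine (congrArg _ (hgh (a, b))).trans ?_
      rw [hfrom, Fintype.linearCombination_apply, map_sum]
      simp only [map_smul, hF, serreValue]
      rw [hT, corootComb_apply]
      change _ = ChevalleyAlgebra.genH (root k) (coroot k) _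
      rw [map_add, map_smul, map_sum]
      simp only [map_smul]
      rfl
    | e i =>
      refine (congrArg _ (hge i)).trans ?_
      rw [hfrom, zero_smul, zero_add, hF]
      rfl
    | f i =>
      refine (congrArg _ (hgf i)).trans ?_
      rw [hfrom, zero_smul, zero_add, hF]
      rfl
  · have hinr : (ChevalleyAlgebra.lift H).comp (Matrix.ToLieAlgebra.lift (isSerreFamily_G hk)) =
        LieHom.inr ℝ ℝ (E ℝ k) := by
      refine Matrix.ToLieAlgebra.hom_ext fun x => ?_
      rw [LieHom.comp_apply]
      refine (congrArg _ (hF x)).trans ?_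
      cases x with
      | H i => exact hco i
      | E i => exact hge i
      | F i => exact hgf i
    refine LieHom.ext fun p => ?_
    rw [LieHom.comp_apply, hfrom, map_add, map_smul, hcan]
    have := LieHom.congr_fun hinr p.2
    rw [LieHom.comp_apply] at this
    rw [this]
    simp

end CentralExtension

end ESeries

/-! ### Simply laced matrices and the nonvanishing of the generators -/

/-- Simply laced generalized Cartan matrices. -/
structure IsSymmetricSimplyLaced {ι : Type*} (A : Matrix ι ι ℤ) : Prop where
  diag : ∀ i, A i i = 2
  off_diag : ∀ i j, i ≠ j → A i j = 0 ∨ A i j = -1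
  symm : ∀ i j, A i j = A j i

theorem ESeries.isSymmetricSimplyLaced (k : ℕ) : IsSymmetricSimplyLaced (ESeries.cartanMatrix k) where
  diag i := by simp [cartanMatrix]
  off_diag i j hij := by
    unfold cartanMatrix
    split_ifs <;> first | contradiction | simp
  symm := cartanMatrix_symm

/-- The element `ad x ^ n [x, y]`. -/
noncomputable def LieAlgebra.adPowLie (K : Type*) [CommRing K] {L : Type*} [LieRing L]
    [LieAlgebra K L] (n : ℕ) (x y : L) : L :=
  (LieAlgebra.ad K L x ^ n) ⁅x, y⁆

theorem LieAlgebra.exists_lie_adPowLie {K L : Type*} [CommRing K] [LieRing L] [LieAlgebra K L]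
    {t x y : L} {a b : K} (hx : ⁅t, x⁆ = a • x) (hy : ⁅t, y⁆ = b • y) (n : ℕ) :
    ∃ c : K, ⁅t, adPowLie K n x y⁆ = c • adPowLie K n x y := by
  induction n with
  | zero =>
    refine ⟨a + b, ?_⟩
    rw [adPowLie, pow_zero, Module.End.one_apply, leibniz_lie, hx, hy, smul_lie, lie_smul,
      add_smul]
  | succ n ih =>
    obtain ⟨c, hc⟩ := ih
    refine ⟨a + c, ?_⟩
    rw [adPowLie] at hc ⊢
    rw [pow_succ', Module.End.mul_apply, LieAlgebra.ad_apply, leibniz_lie, hc, hx, smul_lie,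
      lie_smul, add_smul]

section Associative

attribute [local instance] LieRing.ofAssociativeRing

variable {K R : Type*} [CommRing K] [Ring R] [Algebra K R]

theorem LieAlgebra.adPowLie_zero (x y : R) : adPowLie K 0 x y = x * y - y * x := rfl

theorem LieAlgebra.adPowLie_succ (n : ℕ) (x y : R) :
    adPowLie K (n + 1) x y = x * adPowLie K n x y - adPowLie K n x y * x := by
  rw [adPowLie, pow_succ']
  rfl

end Associative

/-- Elements that satisfy the Serre relations but possibly not the relations among the `e i` and
among the `f i`. -/
structure IsWeakSerreFamily {ι : Type*} (A : Matrix ι ι ℤ) {L : Type*} [LieRing L]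
    (h e f : ι → L) : Prop where
  hh : ∀ i j, ⁅h i, h j⁆ = 0
  he : ∀ i j, ⁅h i, e j⁆ = A i j • e j
  hf : ∀ i j, ⁅h i, f j⁆ = -(A i j • f j)
  ef_same : ∀ i, ⁅e i, f i⁆ = h i
  ef_ne : ∀ i j, i ≠ j → ⁅e i, f j⁆ = 0

namespace IsWeakSerreFamily

variable {ι : Type*} {A : Matrix ι ι ℤ} {L : Type*} [LieRing L] {h e f : ι → L}

theorem symm (S : IsWeakSerreFamily A h e f) : IsWeakSerreFamily A (-h) f e where
  hh i j := by simp [S.hh]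
  he i j := by simp [S.hf]
  hf i j := by simp [S.he]
  ef_same i := by rw [← lie_skew, S.ef_same]; rfl
  ef_ne i j hij := by rw [← lie_skew, S.ef_ne j i hij.symm, neg_zero]

variable {K : Type*} [Field K] [LieAlgebra K L]

/-- The Serre elements among the `f i` commute with the `e l`. -/
theorem lie_e_serre_f (S : IsWeakSerreFamily A h e f) (hA : IsSymmetricSimplyLaced A) (l i j : ι) :
    ⁅e l, LieAlgebra.adPowLie K (-A i j).toNat (f i) (f j)⁆ = 0 := by
  classical
  rw [LieAlgebra.adPowLie]
  rcases eq_or_ne i j with rfl | hij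
  · simp
  have hef : ∀ a b, ⁅e a, f b⁆ = if a = b then h a else 0 := by
    intro a b
    split_ifs with hab
    · rw [hab, S.ef_same]
    · exact S.ef_ne a b hab
  have hfh : ∀ a b, ⁅f a, h b⁆ = A b a • f a := fun a b => by
    rw [← lie_skew, S.hf, neg_neg]
  rcases hA.off_diag i j hij with h0 | h1
  · have h0' : A j i = 0 := by rw [hA.symm, h0]
    have hfin : ⁅e l, ⁅f i, f j⁆⁆ = 0 := by
      rw [leibniz_lie, hef, hef]
      split_ifs with h2 h3 h3
      · exact absurd (h2.symm.trans h3) hij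
      · rw [h2, S.hf, h0]; simp
      · rw [h3, hfh, h0']; simp
      · simp
    rw [h0]
    simpa using hfin
  -- For `l = i` the terms `[h_i, [f_i, f_j]]` and `[f_i, [h_i, f_j]]` cancel; for `l = j` what
  -- remains is a multiple of `[f_i, f_i]`.
  · have h1' : A j i = -1 := by rw [hA.symm, h1]
    have hfin : ⁅e l, ⁅f i, ⁅f i, f j⁆⁆⁆ = 0 := by
      rw [leibniz_lie, leibniz_lie (e l) (f i) (f j), hef, hef]
      split_ifs with h2 h3 h3
      · exact absurd (h2.symm.trans h3) hij
      · rw [h2, leibniz_lie, S.hf, S.hf, h1, hA.diag]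
        simp only [two_smul, neg_smul, one_smul, neg_neg, add_zero,
          neg_add_rev, add_lie, neg_lie, lie_zero]
        abel
      · rw [h3, hfh, h1']
        simp
      · simp
    rw [h1]
    simpa using hfin

end IsWeakSerreFamily

/-! ### A Verma module on words, and the submodules generated by Serre elements. -/

namespace VermaModule

variable {ι : Type*} [DecidableEq ι] (K : Type*) [Field K] (A : Matrix ι ι ℤ)

/-- The underlying space of the Verma module (of the algebra without Serre relations) whose highest
weight is `1` on all coroots: the free module on words. -/
abbrev Space (ι K : Type*) [Field K] : Type _ := List ι →₀ K

/-- The weight of a word. -/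
def weight (i : ι) (w : List ι) : K := 1 - ((w.map (A i)).sum : ℤ)

/-- The action of a coroot. -/
noncomputable def opH (i : ι) : Module.End K (Space ι K) :=
  Finsupp.linearCombination K fun w => Finsupp.single w (weight K A i w)

/-- The action of a lowering operator. -/
noncomputable def opF (i : ι) : Module.End K (Space ι K) :=
  Finsupp.linearCombination K fun w => Finsupp.single (i :: w) 1

/-- The action of a raising operator on words. -/
noncomputable def raise (i : ι) : List ι → Space ι K
  | [] => 0
  | j :: w => opF K j (raise i w) + if i = j then Finsupp.single w (weight K A i w) else 0

/-- The action of a raising operator. -/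
noncomputable def opE (i : ι) : Module.End K (Space ι K) :=
  Finsupp.linearCombination K (raise K A i)

variable {K A}

omit [DecidableEq ι] in
theorem opH_single (i : ι) (w : List ι) :
    opH K A i (Finsupp.single w 1) = weight K A i w • Finsupp.single w 1 := by
  simp [opH]

omit [DecidableEq ι] in
theorem opF_single (i : ι) (w : List ι) :
    opF K i (Finsupp.single w 1) = Finsupp.single (i :: w) 1 := by
  simp [opF]

theorem opE_single_nil (i : ι) : opE K A i (Finsupp.single [] 1) = 0 := by
  simp [opE, raise]

theorem opE_single_cons (i j : ι) (w : List ι) :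
    opE K A i (Finsupp.single (j :: w) 1) = opF K j (opE K A i (Finsupp.single w 1)) +
      if i = j then opH K A i (Finsupp.single w 1) else 0 := by
  simp [opE, raise, opH]

omit [DecidableEq ι] in
theorem weight_cons (i j : ι) (w : List ι) :
    weight K A i (j :: w) = weight K A i w - A i j := by
  simp [weight]; ring

attribute [local instance] LieRing.ofAssociativeRing

omit [DecidableEq ι] in
theorem linearMap_ext {S T : Space ι K →ₗ[K] Space ι K}
    (h : ∀ w, S (Finsupp.single w 1) = T (Finsupp.single w 1)) : S = T := by
  ext1 w
  ext1
  exact h w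

/-- Raising operators are defined by recursion from `[e_i, f_j] = δ_ij h_i`, so the only relation
that needs induction on words is `[h_i, e_j]`. -/
theorem isWeakSerreFamily :
    IsWeakSerreFamily A (L := Module.End K (Space ι K)) (opH K A) (opE K A) (opF K) where
  hh i j := by
    refine linearMap_ext fun w => ?_
    simp only [LieRing.of_associative_ring_bracket, LinearMap.sub_apply, Module.End.mul_apply,
      opH_single, map_smul, LinearMap.zero_apply]
    rw [smul_comm, sub_self]
  he i j := by
    refine linearMap_ext fun w => ?_
    simp only [LieRing.of_associative_ring_bracket, LinearMap.sub_apply, Module.End.mul_apply,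
      LinearMap.smul_apply, opH_single, map_smul]
    rw [sub_eq_iff_eq_add, ← Int.cast_smul_eq_zsmul K, ← add_smul]
    have hf : ∀ l (x : Space ι K), opH K A i (opF K l x) =
        opF K l (opH K A i x) - (A i l : K) • opF K l x := by
      intro l x
      have : opH K A i ∘ₗ opF K l = opF K l ∘ₗ opH K A i - (A i l : K) • opF K l := by
        refine linearMap_ext fun w => ?_
        simp only [LinearMap.comp_apply, LinearMap.sub_apply, LinearMap.smul_apply, opF_single,
          opH_single, map_smul, weight_cons, sub_smul]
      exact LinearMap.congr_fun this x
    induction w with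
    | nil => simp [opE_single_nil]
    | cons l w ih =>
      rw [opE_single_cons, map_add, hf, ih, weight_cons, map_smul, smul_add]
      split_ifs with hjl
      · subst hjl
        rw [opH_single, map_smul, opH_single]
        module
      · rw [map_zero]
        module
  hf i j := by
    refine linearMap_ext fun w => ?_
    simp only [LieRing.of_associative_ring_bracket, LinearMap.sub_apply, Module.End.mul_apply,
      LinearMap.smul_apply, LinearMap.neg_apply, opF_single, opH_single, map_smul, weight_cons]
    rw [← Int.cast_smul_eq_zsmul K]
    module
  ef_same i := by
    refine linearMap_ext fun w => ?_
    simp only [LieRing.of_associative_ring_bracket, LinearMap.sub_apply, Module.End.mul_apply,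
      opF_single, opE_single_cons, if_true]
    abel
  ef_ne i j hij := by
    refine linearMap_ext fun w => ?_
    simp only [LieRing.of_associative_ring_bracket, LinearMap.sub_apply, Module.End.mul_apply,
      opF_single, opE_single_cons, if_neg hij, LinearMap.zero_apply]
    abel

variable (K A) in
theorem opH_opF (l a : ι) (x : Space ι K) :
    opH K A l (opF K a x) = opF K a (opH K A l x) - (A l a : K) • opF K a x := by
  have h : opH K A l * opF K a - opF K a * opH K A l = -(A l a • opF K a) :=
    (isWeakSerreFamily (K := K) (A := A)).hf l a
  rw [sub_eq_add_neg, Int.cast_smul_eq_zsmul]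
  exact sub_eq_iff_eq_add'.1 (LinearMap.congr_fun h x)

variable (K A) in
theorem opE_opF (l a : ι) (x : Space ι K) :
    opE K A l (opF K a x) = opF K a (opE K A l x) + if l = a then opH K A l x else 0 := by
  split_ifs with hla
  · subst hla
    have h : opE K A l * opF K l - opF K l * opE K A l = opH K A l :=
      (isWeakSerreFamily (K := K) (A := A)).ef_same l
    exact sub_eq_iff_eq_add'.1 (LinearMap.congr_fun h x)
  · have h : opE K A l * opF K a - opF K a * opE K A l = 0 :=
      (isWeakSerreFamily (K := K) (A := A)).ef_ne l a hla
    exact sub_eq_iff_eq_add'.1 (LinearMap.congr_fun h x)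

/-- The Serre elements among the raising operators. -/
noncomputable def serreE (A : Matrix ι ι ℤ) (i j : ι) : Module.End K (Space ι K) :=
  LieAlgebra.adPowLie K (-A i j).toNat (opE K A i) (opE K A j)

/-- The Serre elements among the lowering operators. -/
noncomputable def serreF (A : Matrix ι ι ℤ) (i j : ι) : Module.End K (Space ι K) :=
  LieAlgebra.adPowLie K (-A i j).toNat (opF K i) (opF K j)

/-- This is `lie_e_serre_f` after exchanging `e` with `f`. -/
theorem serreE_opF (hA : IsSymmetricSimplyLaced A) (i j l : ι) (x : Space ι K) :
    serreE A i j (opF K l x) = opF K l (serreE A i j x) := by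
  have h : opF K l * serreE A i j - serreE A i j * opF K l = 0 :=
    (isWeakSerreFamily (K := K) (A := A)).symm.lie_e_serre_f (K := K) hA l i j
  exact (sub_eq_zero.1 (LinearMap.congr_fun h x)).symm

theorem opE_serreF (hA : IsSymmetricSimplyLaced A) (i j l : ι) (x : Space ι K) :
    opE K A l (serreF A i j x) = serreF A i j (opE K A l x) := by
  have h : opE K A l * serreF A i j - serreF A i j * opE K A l = 0 :=
    (isWeakSerreFamily (K := K) (A := A)).lie_e_serre_f (K := K) hA l i j
  exact sub_eq_zero.1 (LinearMap.congr_fun h x)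

theorem opH_serreF (i j l : ι) : ∃ c : K, ∀ x, opH K A l (serreF A i j x) =
    serreF A i j (opH K A l x) + c • serreF A i j x := by
  have S := isWeakSerreFamily (K := K) (A := A)
  have hf := S.hf
  simp only [← Int.cast_smul_eq_zsmul K, ← neg_smul] at hf
  obtain ⟨c, hc⟩ := LieAlgebra.exists_lie_adPowLie (hf l i) (hf l j) (-A i j).toNat
  refine ⟨c, fun x => ?_⟩
  change opH K A l * serreF A i j - serreF A i j * opH K A l = c • serreF A i j at hc
  exact sub_eq_iff_eq_add'.1 (LinearMap.congr_fun hc x)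

/-- The Serre elements among the raising operators act by zero. -/
theorem serreE_eq_zero (hA : IsSymmetricSimplyLaced A) (i j : ι) : serreE (K := K) A i j = 0 := by
  -- The Serre element kills the highest weight vector and commutes with the lowering operators,
  -- which produce every word from it.
  have hkill : ∀ n : ℕ, (LieAlgebra.adPowLie K n (opE K A i) (opE K A j))
      (Finsupp.single [] 1) = 0 := by
    intro n
    induction n with
    | zero =>
      rw [LieAlgebra.adPowLie_zero, LinearMap.sub_apply, Module.End.mul_apply,
        Module.End.mul_apply, opE_single_nil, opE_single_nil, map_zero, map_zero, sub_zero]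
    | succ n ih =>
      rw [LieAlgebra.adPowLie_succ, LinearMap.sub_apply, Module.End.mul_apply,
        Module.End.mul_apply, ih, opE_single_nil, map_zero, map_zero, sub_zero]
  refine linearMap_ext fun w => ?_
  rw [LinearMap.zero_apply]
  induction w with
  | nil => exact hkill _
  | cons l w ih => rw [← opF_single, serreE_opF hA, ih, map_zero]

/-- Iterated lowering operators. -/
noncomputable def opFWord (u : List ι) (x : Space ι K) : Space ι K :=
  u.foldr (fun i y => opF K i y) x

/-- The submodule generated by the image of a Serre element. -/
noncomputable def serreSubmodule (A : Matrix ι ι ℤ) (i j : ι) : Submodule K (Space ι K) :=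
  Submodule.span K {y | ∃ (u : List ι) (x : Space ι K), y = opFWord u (serreF A i j x)}

omit [DecidableEq ι] in
theorem opF_mem_serreSubmodule (i j l : ι) {y : Space ι K} (hy : y ∈ serreSubmodule A i j) :
    opF K l y ∈ serreSubmodule A i j := by
  induction hy using Submodule.span_induction with
  | mem y hy =>
    obtain ⟨u, x, rfl⟩ := hy
    exact Submodule.subset_span ⟨l :: u, x, rfl⟩
  | zero => simp
  | add x y _ _ hx hy => rw [map_add]; exact add_mem hx hy
  | smul c x _ hx => rw [map_smul]; exact Submodule.smul_mem _ c hx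

theorem opH_mem_serreSubmodule (i j l : ι) {y : Space ι K} (hy : y ∈ serreSubmodule A i j) :
    opH K A l y ∈ serreSubmodule A i j := by
  induction hy using Submodule.span_induction with
  | mem y hy =>
    obtain ⟨u, x, rfl⟩ := hy
    induction u with
    | nil =>
      obtain ⟨c, hc⟩ := opH_serreF (K := K) (A := A) i j l
      change opH K A l (serreF A i j x) ∈ _
      rw [hc]
      exact add_mem (Submodule.subset_span ⟨[], _, rfl⟩)
        (Submodule.smul_mem _ _ (Submodule.subset_span ⟨[], _, rfl⟩))
    | cons a u ih =>
      change opH K A l (opF K a (opFWord u (serreF A i j x))) ∈ _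
      rw [opH_opF]
      exact sub_mem (opF_mem_serreSubmodule i j a ih)
        (Submodule.smul_mem _ _ (opF_mem_serreSubmodule i j a (Submodule.subset_span ⟨u, x, rfl⟩)))
  | zero => simp
  | add x y _ _ hx hy => rw [map_add]; exact add_mem hx hy
  | smul c x _ hx => rw [map_smul]; exact Submodule.smul_mem _ c hx

theorem opE_mem_serreSubmodule (hA : IsSymmetricSimplyLaced A) (i j l : ι) {y : Space ι K}
    (hy : y ∈ serreSubmodule A i j) : opE K A l y ∈ serreSubmodule A i j := by
  induction hy using Submodule.span_induction with
  | mem y hy =>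
    obtain ⟨u, x, rfl⟩ := hy
    induction u with
    | nil =>
      exact Submodule.subset_span ⟨[], opE K A l x, opE_serreF hA i j l x⟩
    | cons a u ih =>
      change opE K A l (opF K a (opFWord u (serreF A i j x))) ∈ _
      rw [opE_opF]
      refine add_mem (opF_mem_serreSubmodule i j a ih) ?_
      split_ifs
      · exact opH_mem_serreSubmodule i j l (Submodule.subset_span ⟨u, x, rfl⟩)
      · exact zero_mem _
  | zero => simp
  | add x y _ _ hx hy => rw [map_add]; exact add_mem hx hy
  | smul c x _ hx => rw [map_smul]; exact Submodule.smul_mem _ c hx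

omit [DecidableEq ι] in
theorem opF_apply_nil (i : ι) (x : Space ι K) : opF K i x [] = 0 := by
  have : Finsupp.lapply [] ∘ₗ opF K i = 0 := by
    ext w
    simp [opF]
  exact LinearMap.congr_fun this x

-- Every monomial of the Serre element starts with a lowering operator, whose image has no empty
-- word.
omit [DecidableEq ι] in
theorem serreF_apply_nil (i j : ι) (x : Space ι K) : serreF A i j x [] = 0 := by
  rw [serreF]
  generalize (-A i j).toNat = n
  cases n with
  | zero =>
    rw [LieAlgebra.adPowLie_zero, LinearMap.sub_apply, Module.End.mul_apply,
      Module.End.mul_apply, Finsupp.sub_apply, opF_apply_nil, opF_apply_nil, sub_zero]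
  | succ n =>
    induction n generalizing x with
    | zero =>
      rw [LieAlgebra.adPowLie_succ, LieAlgebra.adPowLie_zero]
      simp [opF_apply_nil]
    | succ n ih =>
      rw [LieAlgebra.adPowLie_succ, LinearMap.sub_apply, Module.End.mul_apply,
        Module.End.mul_apply, Finsupp.sub_apply, opF_apply_nil, ih, sub_zero]

omit [DecidableEq ι] in
theorem apply_nil_of_mem_serreSubmodule (i j : ι) {y : Space ι K}
    (hy : y ∈ serreSubmodule A i j) : y [] = 0 := by
  induction hy using Submodule.span_induction with
  | mem y hy =>
    obtain ⟨u, x, rfl⟩ := hy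
    cases u with
    | nil => exact serreF_apply_nil i j x
    | cons a u => exact opF_apply_nil a _
  | zero => simp
  | add x y _ _ hx hy => rw [Finsupp.add_apply, hx, hy, add_zero]
  | smul c x _ hx => rw [Finsupp.smul_apply, hx, smul_zero]

variable (K A) in
/-- The action of the free Lie algebra. -/
noncomputable def rep :
    FreeLieAlgebra K (CartanMatrix.Generators ι) →ₗ⁅K⁆ Module.End K (Space ι K) :=
  FreeLieAlgebra.lift K (serreValue (opH K A) (opE K A) (opF K))

variable (K A) in
/-- The module over the free Lie algebra. -/
@[reducible] noncomputable def lieRingModule :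
    LieRingModule (FreeLieAlgebra K (CartanMatrix.Generators ι)) (Space ι K) :=
  LieRingModule.compLieHom _ (rep K A)

end VermaModule

-- The Serre elements in the `f_i` need not act by zero on the Verma module, but their images
-- generate submodules that avoid the highest weight vector. Modulo such submodules all Serre
-- relations hold, so the quotient is a module over the presented algebra. There `e_i f_i v = h_i v
-- = v ≠ 0` for the highest weight vector `v`, so `e_i` cannot be zero.
open VermaModule in
attribute [local instance] LieRing.ofAssociativeRing in
theorem Matrix.ToLieAlgebra.gen_E_ne_zero {ι : Type*} [DecidableEq ι] (K : Type*) [Field K]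
    {A : Matrix ι ι ℤ} (hA : IsSymmetricSimplyLaced A) (i : ι) : gen K A (.E i) ≠ 0 := by
  let _ := lieRingModule K A
  have : LieModule K (FreeLieAlgebra K (CartanMatrix.Generators ι)) (Space ι K) :=
    LieModule.compLieHom _ (rep K A)
  have hact : ∀ r (x : Space ι K), ⁅r, x⁆ = rep K A r x := fun _ _ => rfl
  -- The condition on the coefficient of the empty word is linear, so it survives sums and there is
  -- a largest such submodule.
  let N : LieSubmodule K (FreeLieAlgebra K (CartanMatrix.Generators ι)) (Space ι K) :=
    sSup {N | ∀ x ∈ N, x [] = 0}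
  have hN : ∀ x ∈ N, x [] = 0 := by
    have h : N.toSubmodule ≤ LinearMap.ker (Finsupp.lapply (R := K) ([] : List ι)) := by
      rw [LieSubmodule.sSup_toSubmodule]
      refine sSup_le ?_
      rintro _ ⟨N', hN', rfl⟩
      exact fun x hx => hN' x hx
    exact fun x hx => h hx
  have hJ : ∀ a b x, serreF A a b x ∈ N := by
    intro a b x
    have hst : ∀ r, ∀ y ∈ serreSubmodule (K := K) A a b, rep K A r y ∈ serreSubmodule A a b := by
      intro r
      have hr : r ∈ LieSubalgebra.lieSpan K (FreeLieAlgebra K (CartanMatrix.Generators ι))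
          (Set.range (FreeLieAlgebra.of K)) := by
        rw [FreeLieAlgebra.lieSpan_range_of]; trivial
      induction hr using LieSubalgebra.lieSpan_induction with
      | mem g hg =>
        obtain ⟨g, rfl⟩ := hg
        intro y hy
        rw [rep, FreeLieAlgebra.lift_of_apply]
        cases g with
        | H l => exact opH_mem_serreSubmodule a b l hy
        | E l => exact opE_mem_serreSubmodule hA a b l hy
        | F l => exact opF_mem_serreSubmodule a b l hy
      | zero => intro y _; simp
      | add u v _ _ hu hv =>
        intro y hy
        rw [map_add, LinearMap.add_apply]
        exact add_mem (hu y hy) (hv y hy)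
      | smul t u _ hu =>
        intro y hy
        rw [map_smul, LinearMap.smul_apply]
        exact Submodule.smul_mem _ t (hu y hy)
      | lie u v _ _ hu hv =>
        intro y hy
        rw [LieHom.map_lie, LieRing.of_associative_ring_bracket, LinearMap.sub_apply,
          Module.End.mul_apply, Module.End.mul_apply]
        exact sub_mem (hu _ (hv y hy)) (hv _ (hu y hy))
    let J : LieSubmodule K (FreeLieAlgebra K (CartanMatrix.Generators ι)) (Space ι K) :=
      { serreSubmodule A a b with lie_mem := fun {r y} hy => hst r y hy }
    have hJN : J ≤ N := le_sSup fun y hy => apply_nil_of_mem_serreSubmodule a b hy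
    exact hJN (Submodule.subset_span ⟨[], x, rfl⟩)
  let ρ := LieModule.toEnd K (FreeLieAlgebra K (CartanMatrix.Generators ι)) (Space ι K ⧸ N)
  have hρ : ∀ r, (∀ x, rep K A r x ∈ N) → ρ r = 0 := by
    intro r hr
    refine LinearMap.ext fun x => ?_
    induction x using Submodule.Quotient.induction_on with | _ x
    exact (LieSubmodule.Quotient.mk_eq_zero' (N := N)).2 (hr x)
  have hρ' : ∀ r, rep K A r = 0 → ρ r = 0 := fun r hr => hρ r fun x => by rw [hr]; simp
  have hrep : ∀ g, rep K A (FreeLieAlgebra.of K g) = serreValue (opH K A) (opE K A) (opF K) g :=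
    fun g => FreeLieAlgebra.lift_of_apply _ _
  have W := isWeakSerreFamily (K := K) (A := A)
  have S : IsSerreFamily K A (fun i => ρ (FreeLieAlgebra.of K (.H i)))
      (fun i => ρ (FreeLieAlgebra.of K (.E i))) (fun i => ρ (FreeLieAlgebra.of K (.F i))) := by
    refine ⟨fun i j => ?_, fun i j => ?_, fun i j => ?_, fun i => ?_, fun i j hij => ?_,
      fun i j => ?_, fun i j => ?_⟩
    · rw [← LieHom.map_lie]
      refine hρ' _ ?_
      rw [LieHom.map_lie, hrep, hrep]
      exact W.hh i j
    · rw [← LieHom.map_lie, ← LieHom.map_zsmul', ← sub_eq_zero, ← map_sub]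
      refine hρ' _ ?_
      rw [map_sub, LieHom.map_lie, LieHom.map_zsmul', hrep, hrep, sub_eq_zero]
      exact W.he i j
    · rw [← LieHom.map_lie, ← LieHom.map_zsmul', ← add_eq_zero_iff_eq_neg, ← map_add]
      refine hρ' _ ?_
      rw [map_add, LieHom.map_lie, LieHom.map_zsmul', hrep, hrep]
      change ⁅opH K A i, opF K j⁆ + A i j • opF K j = 0
      rw [W.hf]
      exact neg_add_cancel _
    · rw [← LieHom.map_lie, ← sub_eq_zero, ← map_sub]
      refine hρ' _ ?_
      rw [map_sub, LieHom.map_lie, hrep, hrep, hrep, sub_eq_zero]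
      exact W.ef_same i
    · rw [← LieHom.map_lie]
      refine hρ' _ ?_
      rw [LieHom.map_lie, hrep, hrep]
      exact W.ef_ne i j hij
    · rw [← LieHom.map_lie, ← LieHom.map_ad_pow]
      refine hρ' _ ?_
      rw [LieHom.map_ad_pow, LieHom.map_lie, hrep, hrep]
      exact serreE_eq_zero hA i j
    · rw [← LieHom.map_lie, ← LieHom.map_ad_pow]
      refine hρ _ fun x => ?_
      rw [LieHom.map_ad_pow, LieHom.map_lie, hrep, hrep]
      exact hJ i j x
  intro h0
  have h1 : ρ (FreeLieAlgebra.of K (.E i)) = 0 := by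
    have := lift_gen S (.E i)
    rw [h0, map_zero] at this
    exact this.symm
  have h2 := LinearMap.congr_fun h1
    (LieSubmodule.Quotient.mk (N := N) (Finsupp.single [i] 1))
  have h3 : rep K A (FreeLieAlgebra.of K (.E i)) (Finsupp.single [i] 1) ∈ N :=
    (LieSubmodule.Quotient.mk_eq_zero' (N := N)).1 h2
  rw [hrep] at h3
  change opE K A i (Finsupp.single [i] 1) ∈ N at h3
  rw [opE_single_cons, opE_single_nil, map_zero, zero_add, if_pos rfl, opH_single] at h3
  have h4 := hN _ h3
  simp [weight] at h4

/-! ### Lie algebras generated by a Serre family of positive definite type -/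

/-- Simply laced matrices with a positive definite form, for which the coefficients of the vectors
of norm `2` are bounded. -/
structure IsPositiveSimplyLaced {ι : Type*} [Fintype ι] (A : Matrix ι ι ℤ) : Prop
    extends IsSymmetricSimplyLaced A where
  pos : ∀ b : ι → ℤ, b ≠ 0 → 0 < ∑ i, b i * A.mulVec b i
  bounded : ∃ N : ℕ, ∀ b : ι → ℤ, ∑ i, b i * A.mulVec b i = 2 → ∀ i, b i ≤ N

theorem IsPositiveSimplyLaced.eq_zero_of_mulVec_eq_zero {ι : Type*} [Fintype ι]
    {A : Matrix ι ι ℤ} (P : IsPositiveSimplyLaced A) {b : ι → ℤ} (hb : A.mulVec b = 0) :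
    b = 0 := by
  by_contra h
  have := P.pos b h
  simp [hb] at this

theorem IsPositiveSimplyLaced.det_ne_zero {ι : Type*} [Fintype ι] [DecidableEq ι]
    {A : Matrix ι ι ℤ} (P : IsPositiveSimplyLaced A) : A.det ≠ 0 := by
  intro h
  obtain ⟨v, hv, hv0⟩ := Matrix.exists_mulVec_eq_zero_iff.2 h
  exact hv (P.eq_zero_of_mulVec_eq_zero hv0)

/-- A Serre family which generates the Lie algebra and whose raising elements do not vanish. -/
structure IsSerreGenerators (K : Type*) [Field K] {ι : Type*} (A : Matrix ι ι ℤ) {L : Type*}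
    [LieRing L] [LieAlgebra K L] (h e f : ι → L) : Prop extends IsSerreFamily K A h e f where
  lieSpan_eq_top : LieSubalgebra.lieSpan K L (Set.range e ∪ Set.range f) = ⊤
  e_ne_zero : ∀ i, e i ≠ 0

namespace IsSerreGenerators

variable {K ι L : Type*} [Field K] [CharZero K] [Fintype ι] [DecidableEq ι] {A : Matrix ι ι ℤ}
  [LieRing L] [LieAlgebra K L] {h e f : ι → L}

section Basic

omit [CharZero K] [Fintype ι] [DecidableEq ι] in
theorem lie_h_e (G : IsSerreGenerators K A h e f) (i j : ι) : ⁅h i, e j⁆ = (A i j : K) • e j := by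
  rw [G.he, Int.cast_smul_eq_zsmul]

omit [CharZero K] [Fintype ι] [DecidableEq ι] in
theorem lie_h_f (G : IsSerreGenerators K A h e f) (i j : ι) :
    ⁅h i, f j⁆ = -((A i j : K) • f j) := by
  rw [G.hf, Int.cast_smul_eq_zsmul]

omit [Fintype ι] [DecidableEq ι] in
theorem h_ne_zero (G : IsSerreGenerators K A h e f) (hA : IsSymmetricSimplyLaced A) (i : ι) :
    h i ≠ 0 := by
  intro h0
  have := G.lie_h_e i i
  rw [h0, zero_lie, hA.diag, eq_comm, smul_eq_zero] at this
  exact this.elim (by norm_num) (G.e_ne_zero i)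

omit [Fintype ι] [DecidableEq ι] in
theorem f_ne_zero (G : IsSerreGenerators K A h e f) (hA : IsSymmetricSimplyLaced A) (i : ι) :
    f i ≠ 0 := by
  intro h0
  apply G.h_ne_zero hA i
  rw [← G.ef_same, h0, lie_zero]

-- The Chevalley involution; it reduces statements about negative weights to positive ones.
omit [Fintype ι] [DecidableEq ι] in
theorem symm (G : IsSerreGenerators K A h e f) (hA : IsSymmetricSimplyLaced A) :
    IsSerreGenerators K A (-h) f e where
  hh i j := by simp [G.hh]
  he i j := by simp [G.hf]
  hf i j := by simp [G.he]
  ef_same i := by rw [← lie_skew, G.ef_same]; rfl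
  ef_ne i j hij := by rw [← lie_skew, G.ef_ne j i hij.symm, neg_zero]
  serre_e := G.serre_f
  serre_f := G.serre_e
  lieSpan_eq_top := by rw [Set.union_comm, G.lieSpan_eq_top]
  e_ne_zero := G.f_ne_zero hA

omit [Fintype ι] [DecidableEq ι] in
theorem isSl2Triple (G : IsSerreGenerators K A h e f) (hA : IsSymmetricSimplyLaced A) (i : ι) :
    IsSl2Triple (h i) (e i) (f i) where
  h_ne_zero := G.h_ne_zero hA i
  lie_e_f := G.ef_same i
  lie_h_e_nsmul := by rw [G.he, hA.diag]; exact ofNat_zsmul _ _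
  lie_h_f_nsmul := by rw [G.hf, hA.diag]; exact congrArg _ (ofNat_zsmul _ _)

end Basic

end IsSerreGenerators

/-! ### Weight spaces indexed by the root lattice. -/

section WeightSpaces

variable {K ι L : Type*} [Field K] [Fintype ι] {A : Matrix ι ι ℤ} [LieRing L] [LieAlgebra K L]

/-- The weight space of a root lattice element. -/
def latticeWeightSpace (K : Type*) [Field K] (A : Matrix ι ι ℤ) {L : Type*} [LieRing L]
    [LieAlgebra K L] (h : ι → L) (β : ι → ℤ) : Submodule K L :=
  ⨅ i, LinearMap.ker (LieAlgebra.ad K L (h i) - ((A.mulVec β i : ℤ) : K) • LinearMap.id)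

variable {h : ι → L}

theorem mem_latticeWeightSpace {β : ι → ℤ} {x : L} : x ∈ latticeWeightSpace K A h β ↔
    ∀ i, ⁅h i, x⁆ = ((A.mulVec β i : ℤ) : K) • x := by
  simp [latticeWeightSpace, sub_eq_zero]

theorem latticeWeightSpace_neg (β : ι → ℤ) :
    latticeWeightSpace K A (-h) (-β) = latticeWeightSpace K A h β := by
  ext x
  simp only [mem_latticeWeightSpace, Matrix.mulVec_neg, Pi.neg_apply, Int.cast_neg, neg_smul,
    neg_lie, neg_inj]

theorem lie_mem_latticeWeightSpace {β γ : ι → ℤ} {x y : L} (hx : x ∈ latticeWeightSpace K A h β)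
    (hy : y ∈ latticeWeightSpace K A h γ) : ⁅x, y⁆ ∈ latticeWeightSpace K A h (β + γ) := by
  rw [mem_latticeWeightSpace] at *
  intro i
  rw [leibniz_lie, hx, hy, smul_lie, lie_smul, Matrix.mulVec_add, ← add_smul, Pi.add_apply,
    Int.cast_add]

theorem mulVec_single_apply [DecidableEq ι] (n : ℤ) (i j : ι) :
    A.mulVec (Pi.single i n) j = A j i * n := by
  simp

/-- A subspace stable under the coroots contains the weight components of its elements, because an
injective matrix separates the weights of distinct lattice elements. -/
theorem mem_of_sum_mem [CharZero K] (hA : ∀ b : ι → ℤ, A.mulVec b = 0 → b = 0) (I : Submodule K L)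
    (hI : ∀ i, ∀ x ∈ I, ⁅h i, x⁆ ∈ I) (s : Finset (ι → ℤ)) (x : (ι → ℤ) → L)
    (hx : ∀ β ∈ s, x β ∈ latticeWeightSpace K A h β) (hs : ∑ β ∈ s, x β ∈ I) :
    ∀ β ∈ s, x β ∈ I := by
  classical
  induction s using Finset.induction_on generalizing x with
  | empty => simp
  | insert a s ha ih =>
    have hrest : ∀ b ∈ s, x b ∈ I := by
      intro b hb
      have hne : A.mulVec b ≠ A.mulVec a := by
        intro hab
        rw [← sub_eq_zero, ← Matrix.mulVec_sub] at hab
        exact ha (sub_eq_zero.1 (hA _ hab) ▸ hb)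
      obtain ⟨i, hi⟩ := Function.ne_iff.1 hne
      -- Subtracting from `h_i` its eigenvalue at `a` removes the component at `a`; at `b` a nonzero
      -- factor remains.
      have key : ∑ β ∈ s, (((A.mulVec β i : ℤ) : K) - ((A.mulVec a i : ℤ) : K)) • x β ∈ I := by
        have h1 := sub_mem (hI i _ hs) (I.smul_mem ((A.mulVec a i : ℤ) : K) hs)
        rw [lie_sum, Finset.smul_sum, ← Finset.sum_sub_distrib, Finset.sum_insert ha,
          mem_latticeWeightSpace.1 (hx a (Finset.mem_insert_self a s)), sub_self, zero_add] at h1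
        convert h1 using 1
        refine Finset.sum_congr rfl fun β hβ => ?_
        rw [mem_latticeWeightSpace.1 (hx β (Finset.mem_insert_of_mem hβ)), sub_smul]
      have h2 := ih _ (fun β hβ => Submodule.smul_mem _ _ (hx β (Finset.mem_insert_of_mem hβ)))
        key b hb
      refine (I.smul_mem_iff ?_).1 h2
      rw [sub_ne_zero]
      exact_mod_cast hi
    intro β hβ
    rcases Finset.mem_insert.1 hβ with rfl | hβ
    · rw [Finset.sum_insert ha] at hs
      exact (I.add_mem_iff_left (sum_mem hrest)).1 hs
    · exact hrest β hβ

end WeightSpaces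

/-! #### Words -/

/-- Iterated brackets. -/
def lieWord {ι L : Type*} [LieRing L] (e : ι → L) : List ι → L
  | [] => 0
  | [i] => e i
  | i :: j :: w => ⁅e i, lieWord e (j :: w)⁆

/-- The number of occurrences of each letter. -/
def wordContent {ι : Type*} [DecidableEq ι] (w : List ι) : ι → ℤ := fun i => w.count i

section Words

variable {ι : Type*} [DecidableEq ι]

theorem wordContent_cons (i : ι) (w : List ι) :
    wordContent (i :: w) = Pi.single i 1 + wordContent w := by
  ext j
  by_cases hij : i = j
  · subst hij
    simp [wordContent, add_comm]
  · simp [wordContent, hij, Ne.symm hij]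

theorem wordContent_nonneg (w : List ι) : 0 ≤ wordContent w := fun i => by simp [wordContent]

theorem wordContent_ne_zero {w : List ι} (hw : w ≠ []) : wordContent w ≠ 0 := by
  obtain ⟨i, w, rfl⟩ := List.exists_cons_of_ne_nil hw
  intro h
  have := congrFun h i
  simp [wordContent] at this
  omega

omit [DecidableEq ι] in
theorem lieWord_cons {L : Type*} [LieRing L] (e : ι → L) (i : ι) {w : List ι} (hw : w ≠ []) :
    lieWord e (i :: w) = ⁅e i, lieWord e w⁆ := by
  obtain ⟨j, w, rfl⟩ := List.exists_cons_of_ne_nil hw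
  rfl

end Words

/-! ### Triangular decomposition and the shape of the weight spaces. -/

namespace IsSerreGenerators

variable {K ι L : Type*} [Field K] [Fintype ι] [DecidableEq ι] {A : Matrix ι ι ℤ}
  [LieRing L] [LieAlgebra K L] {h e f : ι → L}

omit [DecidableEq ι] in
theorem h_mem (G : IsSerreGenerators K A h e f) (i : ι) : h i ∈ latticeWeightSpace K A h 0 :=
  mem_latticeWeightSpace.2 fun j => by simp [G.hh]

theorem e_mem (G : IsSerreGenerators K A h e f) (i : ι) :
    e i ∈ latticeWeightSpace K A h (Pi.single i 1) :=
  mem_latticeWeightSpace.2 fun j => by rw [G.lie_h_e, mulVec_single_apply, mul_one]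

theorem f_mem (G : IsSerreGenerators K A h e f) (i : ι) :
    f i ∈ latticeWeightSpace K A h (-Pi.single i 1) :=
  mem_latticeWeightSpace.2 fun j => by
    rw [G.lie_h_f, Matrix.mulVec_neg, Pi.neg_apply, mulVec_single_apply, mul_one, Int.cast_neg,
      neg_smul]

theorem lieWord_e_mem (G : IsSerreGenerators K A h e f) (w : List ι) :
    lieWord e w ∈ latticeWeightSpace K A h (wordContent w) := by
  induction w with
  | nil => exact zero_mem _
  | cons i w ih =>
    rcases eq_or_ne w [] with rfl | hw
    · rw [wordContent_cons]
      convert G.e_mem i using 2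
      · ext j
        simp [wordContent]
      · rfl
    · rw [lieWord_cons e i hw, wordContent_cons]
      exact lie_mem_latticeWeightSpace (G.e_mem i) ih

theorem lieWord_f_mem (G : IsSerreGenerators K A h e f) (w : List ι) :
    lieWord f w ∈ latticeWeightSpace K A h (-wordContent w) := by
  induction w with
  | nil => exact zero_mem _
  | cons i w ih =>
    rcases eq_or_ne w [] with rfl | hw
    · rw [wordContent_cons]
      convert G.f_mem i using 2
      · ext j
        simp [wordContent]
      · rfl
    · rw [lieWord_cons f i hw, wordContent_cons, neg_add]
      exact lie_mem_latticeWeightSpace (G.f_mem i) ih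

/-- The spanning set of words and coroots. -/
def spanningSubmodule (K : Type*) [Field K] {ι L : Type*} [LieRing L] [LieAlgebra K L]
    (h e f : ι → L) : Submodule K L :=
  Submodule.span K (Set.range (lieWord e) ∪ Set.range h ∪ Set.range (lieWord f))

omit [Fintype ι] [DecidableEq ι] in
theorem lie_e_mem_spanningSubmodule (G : IsSerreGenerators K A h e f) (i : ι) {x : L}
    (hx : x ∈ spanningSubmodule K h e f) : ⁅e i, x⁆ ∈ spanningSubmodule K h e f := by
  classical
  have he : ∀ w, lieWord e w ∈ spanningSubmodule K h e f := fun w =>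
    Submodule.subset_span (Or.inl (Or.inl ⟨w, rfl⟩))
  have hh : ∀ i, h i ∈ spanningSubmodule K h e f := fun i =>
    Submodule.subset_span (Or.inl (Or.inr ⟨i, rfl⟩))
  have hf : ∀ w, lieWord f w ∈ spanningSubmodule K h e f := fun w =>
    Submodule.subset_span (Or.inr ⟨w, rfl⟩)
  have hhf : ∀ j w, ∃ c : K, ⁅h j, lieWord f w⁆ = c • lieWord f w := by
    intro j w
    induction w with
    | nil => exact ⟨0, by simp [lieWord]⟩
    | cons a w ih =>
      rcases eq_or_ne w [] with rfl | hw
      · exact ⟨-(A j a : K), by rw [neg_smul]; exact G.lie_h_f j a⟩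
      · obtain ⟨c, hc⟩ := ih
        refine ⟨-(A j a : K) + c, ?_⟩
        rw [lieWord_cons f a hw, leibniz_lie, hc, G.lie_h_f, lie_smul, neg_lie, smul_lie,
          add_smul, neg_smul]
  have hef : ∀ a b, ⁅e a, f b⁆ = if a = b then h a else 0 := by
    intro a b
    split_ifs with hab
    · rw [hab, G.ef_same]
    · exact G.ef_ne a b hab
  -- The target leaves out words in the `e_i` so that the induction can apply `ad f_a` to it.
  have hf' : ∀ w, ⁅e i, lieWord f w⁆ ∈
      Submodule.span K (Set.range h ∪ Set.range (lieWord f)) := by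
    intro w
    induction w with
    | nil => simp [lieWord]
    | cons a w ih =>
      rcases eq_or_ne w [] with rfl | hw
      · change ⁅e i, f a⁆ ∈ _
        rw [hef]
        split_ifs
        · exact Submodule.subset_span (Or.inl ⟨i, rfl⟩)
        · exact zero_mem _
      · rw [lieWord_cons f a hw, leibniz_lie, hef]
        refine add_mem ?_ ?_
        · split_ifs
          · obtain ⟨c, hc⟩ := hhf i w
            rw [hc]
            exact Submodule.smul_mem _ _ (Submodule.subset_span (Or.inr ⟨w, rfl⟩))
          · simp
        · generalize ⁅e i, lieWord f w⁆ = y at ih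
          induction ih using Submodule.span_induction with
          | mem y hy =>
            rcases hy with ⟨b, rfl⟩ | ⟨u, rfl⟩
            · rw [← lie_skew, G.lie_h_f, neg_neg]
              exact Submodule.smul_mem _ _ (Submodule.subset_span (Or.inr ⟨[a], rfl⟩))
            · rcases eq_or_ne u [] with rfl | hu
              · simp [lieWord]
              · rw [← lieWord_cons f a hu]
                exact Submodule.subset_span (Or.inr ⟨_, rfl⟩)
          | zero => simp
          | add x y _ _ hx hy => rw [lie_add]; exact add_mem hx hy
          | smul c x _ hx => rw [lie_smul]; exact Submodule.smul_mem _ c hx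
  induction hx using Submodule.span_induction with
  | mem y hy =>
    rcases hy with (⟨u, rfl⟩ | ⟨b, rfl⟩) | ⟨u, rfl⟩
    · rcases eq_or_ne u [] with rfl | hu
      · simp [lieWord]
      · rw [← lieWord_cons e i hu]
        exact he _
    · rw [← lie_skew, G.lie_h_e]
      exact neg_mem (Submodule.smul_mem _ _ (he [i]))
    · refine Submodule.span_mono ?_ (hf' u)
      exact Set.union_subset_union_left _ Set.subset_union_right
  | zero => simp
  | add x y _ _ hx hy => rw [lie_add]; exact add_mem hx hy
  | smul c x _ hx => rw [lie_smul]; exact Submodule.smul_mem _ c hx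

omit [Fintype ι] [DecidableEq ι] in
theorem spanningSubmodule_symm : spanningSubmodule K (-h) f e = spanningSubmodule K h e f := by
  have : ∀ h' : ι → L, ∀ e f : ι → L, spanningSubmodule K (-h') f e ≤
      spanningSubmodule K h' e f := by
    intro h e f
    refine Submodule.span_le.2 ?_
    rintro _ ((⟨u, rfl⟩ | ⟨b, rfl⟩) | ⟨u, rfl⟩)
    · exact Submodule.subset_span (Or.inr ⟨u, rfl⟩)
    · exact neg_mem (Submodule.subset_span (Or.inl (Or.inr ⟨b, rfl⟩)))
    · exact Submodule.subset_span (Or.inl (Or.inl ⟨u, rfl⟩))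
  refine le_antisymm (this h e f) ?_
  have h2 := this (-h) f e
  rwa [neg_neg] at h2

-- The span is stable under `ad e_i`, by the involution also under `ad f_i`, hence under the whole
-- algebra; and it contains the generators.
omit [Fintype ι] [DecidableEq ι] in
theorem spanningSubmodule_eq_top [CharZero K] (G : IsSerreGenerators K A h e f)
    (hA : IsSymmetricSimplyLaced A) : spanningSubmodule K h e f = ⊤ := by
  have hstab : ∀ x y : L, y ∈ spanningSubmodule K h e f → ⁅x, y⁆ ∈ spanningSubmodule K h e f := by
    intro x
    have hx : x ∈ LieSubalgebra.lieSpan K L (Set.range e ∪ Set.range f) := by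
      rw [G.lieSpan_eq_top]; trivial
    induction hx using LieSubalgebra.lieSpan_induction with
    | mem x hx =>
      intro y hy
      rcases hx with ⟨i, rfl⟩ | ⟨i, rfl⟩
      · exact G.lie_e_mem_spanningSubmodule i hy
      · rw [← spanningSubmodule_symm] at hy ⊢
        exact (G.symm hA).lie_e_mem_spanningSubmodule i hy
    | zero => simp
    | add u v _ _ hu hv => intro y hy; rw [add_lie]; exact add_mem (hu y hy) (hv y hy)
    | smul t u _ hu => intro y hy; rw [smul_lie]; exact Submodule.smul_mem _ t (hu y hy)
    | lie u v _ _ hu hv =>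
      intro y hy
      rw [lie_lie]
      exact sub_mem (hu _ (hv y hy)) (hv _ (hu y hy))
  rw [eq_top_iff]
  intro x _
  have hx : x ∈ LieSubalgebra.lieSpan K L (Set.range e ∪ Set.range f) := by
    rw [G.lieSpan_eq_top]; trivial
  induction hx using LieSubalgebra.lieSpan_induction with
  | mem x hx =>
    rcases hx with ⟨i, rfl⟩ | ⟨i, rfl⟩
    · exact Submodule.subset_span (Or.inl (Or.inl ⟨[i], rfl⟩))
    · exact Submodule.subset_span (Or.inr ⟨[i], rfl⟩)
  | zero => exact zero_mem _
  | add u v _ _ hu hv => exact add_mem (hu trivial) (hv trivial)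
  | smul t u _ hu => exact Submodule.smul_mem _ t (hu trivial)
  | lie u v _ _ hu hv => exact hstab u v (hv trivial)

/-- The part of a weight space spanned by words and coroots. -/
def wordSpace (K : Type*) [Field K] {ι L : Type*} [DecidableEq ι] [LieRing L] [LieAlgebra K L]
    (h e f : ι → L) (β : ι → ℤ) : Submodule K L :=
  Submodule.span K {x | (∃ w, wordContent w = β ∧ x = lieWord e w) ∨ (β = 0 ∧ x ∈ Set.range h) ∨
    ∃ w, -wordContent w = β ∧ x = lieWord f w}

theorem wordSpace_le (G : IsSerreGenerators K A h e f) (β : ι → ℤ) :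
    wordSpace K h e f β ≤ latticeWeightSpace K A h β := by
  refine Submodule.span_le.2 ?_
  rintro _ (⟨w, rfl, rfl⟩ | ⟨rfl, i, rfl⟩ | ⟨w, rfl, rfl⟩)
  · exact G.lieWord_e_mem w
  · exact G.h_mem i
  · exact G.lieWord_f_mem w

omit [Fintype ι] in
/-- Every element is a finite sum of elements of the word spaces. -/
theorem exists_sum_eq [CharZero K] (G : IsSerreGenerators K A h e f)
    (hA : IsSymmetricSimplyLaced A) (x : L) : ∃ (s : Finset (ι → ℤ)) (y : (ι → ℤ) → L),
    (∀ β, y β ∈ wordSpace K h e f β) ∧ ∑ β ∈ s, y β = x := by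
  have hx : x ∈ ⨆ β, wordSpace K h e f β := by
    have h1 : spanningSubmodule K h e f ≤ ⨆ β, wordSpace K h e f β := by
      refine Submodule.span_le.2 ?_
      rintro _ ((⟨w, rfl⟩ | ⟨b, rfl⟩) | ⟨w, rfl⟩)
      · exact Submodule.mem_iSup_of_mem (wordContent w)
          (Submodule.subset_span (Or.inl ⟨w, rfl, rfl⟩))
      · exact Submodule.mem_iSup_of_mem 0
          (Submodule.subset_span (Or.inr (Or.inl ⟨rfl, b, rfl⟩)))
      · exact Submodule.mem_iSup_of_mem (-wordContent w)
          (Submodule.subset_span (Or.inr (Or.inr ⟨w, rfl, rfl⟩)))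
    rw [G.spanningSubmodule_eq_top hA] at h1
    exact h1 trivial
  obtain ⟨y, hy, rfl⟩ := (Submodule.mem_iSup_iff_exists_finsupp _ _).1 hx
  exact ⟨y.support, y, hy, rfl⟩

theorem wordSpace_eq [CharZero K] (G : IsSerreGenerators K A h e f)
    (P : IsPositiveSimplyLaced A) (β : ι → ℤ) :
    latticeWeightSpace K A h β = wordSpace K h e f β := by
  refine le_antisymm (fun x hx => ?_) (G.wordSpace_le β)
  obtain ⟨s, y, hy, hs⟩ := G.exists_sum_eq P.toIsSymmetricSimplyLaced x
  let t := insert β s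
  -- A sum of weight vectors equal to zero. By `mem_of_sum_mem` for the zero subspace each component
  -- vanishes, and the one at `β` identifies `x` with `y β`.
  have h1 : ∑ γ ∈ t, ((if γ ∈ s then y γ else 0) - if γ = β then x else 0) ∈
      (⊥ : Submodule K L) := by
    rw [Finset.sum_sub_distrib, Finset.sum_ite_eq' t β, if_pos (Finset.mem_insert_self _ _),
      Finset.sum_ite_mem, Finset.inter_eq_right.2 (Finset.subset_insert _ _), hs, sub_self]
    exact zero_mem _
  have h2 := mem_of_sum_mem (K := K) (A := A) (h := h) (fun b => P.eq_zero_of_mulVec_eq_zero) ⊥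
    (by simp) t _ (fun γ _ => ?_) h1 β (Finset.mem_insert_self _ _)
  · rw [if_pos rfl, Submodule.mem_bot, sub_eq_zero] at h2
    rw [← h2]
    split_ifs
    · exact hy β
    · exact zero_mem _
  · refine sub_mem ?_ ?_
    · split_ifs
      · exact G.wordSpace_le γ (hy γ)
      · exact zero_mem _
    · split_ifs with hγ
      · rw [hγ]; exact hx
      · exact zero_mem _

end IsSerreGenerators

/-! ### Reflections of weights, ideals, finite dimension and semisimplicity. -/

namespace IsSerreGenerators

variable {K ι L : Type*} [Field K] [CharZero K] [Fintype ι] [DecidableEq ι] {A : Matrix ι ι ℤ}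
  [LieRing L] [LieAlgebra K L] {h e f : ι → L}

theorem exists_lieWord_ne_zero (G : IsSerreGenerators K A h e f) (P : IsPositiveSimplyLaced A)
    {β : ι → ℤ} (hβ : β ≠ 0) {x : L} (hx : x ∈ latticeWeightSpace K A h β) (hx0 : x ≠ 0) :
    (∃ w, wordContent w = β ∧ lieWord e w ≠ 0) ∨ ∃ w, -wordContent w = β ∧ lieWord f w ≠ 0 := by
  by_contra! hcon
  rw [G.wordSpace_eq P] at hx
  suffices hle : wordSpace K h e f β ≤ ⊥ from hx0 ((Submodule.mem_bot K).1 (hle hx))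
  refine Submodule.span_le.2 ?_
  rintro _ (⟨w, hw, rfl⟩ | ⟨h0, -⟩ | ⟨w, hw, rfl⟩)
  · exact hcon.1 w hw
  · exact absurd h0 hβ
  · exact hcon.2 w hw

theorem nonneg_or_nonpos (G : IsSerreGenerators K A h e f) (P : IsPositiveSimplyLaced A)
    {β : ι → ℤ} {x : L} (hx : x ∈ latticeWeightSpace K A h β) (hx0 : x ≠ 0) : 0 ≤ β ∨ β ≤ 0 := by
  rcases eq_or_ne β 0 with rfl | hβ
  · exact Or.inl le_rfl
  · rcases G.exists_lieWord_ne_zero P hβ hx hx0 with ⟨w, rfl, -⟩ | ⟨w, rfl, -⟩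
    · exact Or.inl (wordContent_nonneg w)
    · exact Or.inr (neg_nonpos.2 (wordContent_nonneg w))

omit [Fintype ι] [DecidableEq ι] [CharZero K] [Field K] [LieAlgebra K L] in
theorem lieWord_replicate (e : ι → L) (i : ι) (n : ℕ) :
    lieWord e (List.replicate (n + 2) i) = 0 := by
  induction n with
  | zero => simp [lieWord]
  | succ n ih =>
    rw [List.replicate_succ, lieWord_cons e i (by simp), ih, lie_zero]

omit [Fintype ι] in
theorem eq_replicate_of_wordContent {w : List ι} {i : ι} {m : ℤ}
    (hw : wordContent w = Pi.single i m) : w = List.replicate w.length i := by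
  refine List.eq_replicate_of_mem fun j hj => ?_
  by_contra hji
  have h1 := congrFun hw j
  rw [Pi.single_eq_of_ne hji] at h1
  have h2 := List.count_pos_iff.2 hj
  simp only [wordContent] at h1
  omega

/-- A word of this content repeats the single letter `i`, and such a word vanishes from length two
on because `[e_i, e_i] = 0`. -/
theorem eq_one_and_mem_span (G : IsSerreGenerators K A h e f) (P : IsPositiveSimplyLaced A)
    {i : ι} {m : ℤ} (hm : 0 < m) {x : L} (hx : x ∈ latticeWeightSpace K A h (Pi.single i m))
    (hx0 : x ≠ 0) : m = 1 ∧ x ∈ Submodule.span K {e i} := by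
  have hwm : ∀ w : List ι, wordContent w = Pi.single i m → lieWord e w ≠ 0 → w = [i] := by
    intro w hw hw0
    have hrep := eq_replicate_of_wordContent hw
    generalize w.length = n at hrep
    subst hrep
    match n with
    | 0 => exact absurd rfl hw0
    | 1 => rfl
    | n + 2 => exact absurd (lieWord_replicate e i n) hw0
  have hneg : ∀ w : List ι, -wordContent w ≠ Pi.single i m := by
    intro w hw
    have h1 := congrFun hw i
    have h2 := wordContent_nonneg w i
    simp only [Pi.neg_apply, Pi.single_eq_same, Pi.zero_apply] at h1 h2
    omega
  have hne : (Pi.single i m : ι → ℤ) ≠ 0 := by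
    intro h0
    have := congrFun h0 i
    simp at this
    omega
  constructor
  · rcases G.exists_lieWord_ne_zero P hne hx hx0 with ⟨w, hw, hw0⟩ | ⟨w, hw, -⟩
    · have := hwm w hw hw0
      subst this
      have h1 := congrFun hw i
      simp [wordContent] at h1
      exact h1.symm
    · exact absurd hw (hneg w)
  · rw [G.wordSpace_eq P] at hx
    refine (?_ : wordSpace K h e f (Pi.single i m) ≤ _) hx
    refine Submodule.span_le.2 ?_
    rintro _ (⟨w, hw, rfl⟩ | ⟨h0, -⟩ | ⟨w, hw, rfl⟩)
    · by_cases hw0 : lieWord e w = 0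
      · rw [hw0]; exact zero_mem _
      · rw [hwm w hw hw0]
        exact Submodule.mem_span_singleton_self _
    · exact absurd h0 hne
    · exact absurd hw (hneg w)

-- The elements killed by a power of `ad e_i` form a subalgebra, the Engel subalgebra, so it
-- suffices to treat generators. The Serre relation does this for `e_j`.
omit [Fintype ι] [DecidableEq ι] [CharZero K] in
theorem exists_ad_e_pow_eq_zero (G : IsSerreGenerators K A h e f)
    (i : ι) (x : L) : ∃ n, (LieAlgebra.ad K L (e i) ^ n) x = 0 := by
  have htop : LieSubalgebra.engel K (e i) = ⊤ := by
    rw [eq_top_iff, ← G.lieSpan_eq_top, LieSubalgebra.lieSpan_le]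
    rintro _ (⟨j, rfl⟩ | ⟨j, rfl⟩)
    · refine (LieSubalgebra.mem_engel_iff K _ _).2 ⟨(-A i j).toNat + 1, ?_⟩
      rw [pow_succ, Module.End.mul_apply]
      exact G.serre_e i j
    · refine (LieSubalgebra.mem_engel_iff K _ _).2 ?_
      rcases eq_or_ne i j with rfl | hij
      -- The chain is `f_i ↦ h_i ↦ -2 e_i ↦ 0`.
      · refine ⟨3, ?_⟩
        simp only [pow_succ, pow_zero, one_mul, Module.End.mul_apply, LieAlgebra.ad_apply,
          G.ef_same]
        rw [← lie_skew (e i) (h i), G.lie_h_e, lie_neg, lie_smul, lie_self, smul_zero, neg_zero]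
      · exact ⟨1, by simp [G.ef_ne i j hij]⟩
  have hx : x ∈ LieSubalgebra.engel K (e i) := by rw [htop]; trivial
  exact (LieSubalgebra.mem_engel_iff K _ _).1 hx

omit [CharZero K] [DecidableEq ι] in
theorem ad_pow_mem (I : LieIdeal K L) {γ β : ι → ℤ} {x y : L}
    (hx : x ∈ latticeWeightSpace K A h γ) (hy : y ∈ latticeWeightSpace K A h β) (hyI : y ∈ I)
    (n : ℕ) : (LieAlgebra.ad K L x ^ n) y ∈ I ∧
      (LieAlgebra.ad K L x ^ n) y ∈ latticeWeightSpace K A h (β + n • γ) := by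
  induction n with
  | zero => simpa using ⟨hyI, hy⟩
  | succ n ih =>
    rw [pow_succ', Module.End.mul_apply, LieAlgebra.ad_apply]
    refine ⟨lie_mem_right K L I _ _ ih.1, ?_⟩
    have := lie_mem_latticeWeightSpace hx ih.2
    convert this using 1
    rw [succ_nsmul]
    abel_nf

/-- Weights of an ideal are stable under simple reflections. -/
theorem exists_mem_reflection (G : IsSerreGenerators K A h e f) (hA : IsSymmetricSimplyLaced A)
    (I : LieIdeal K L) {β : ι → ℤ} {i : ι} {n : ℕ} (hn : A.mulVec β i = n) {x : L}
    (hx : x ∈ latticeWeightSpace K A h β) (hxI : x ∈ I) (hx0 : x ≠ 0) :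
    ∃ y ∈ latticeWeightSpace K A h (β - Pi.single i (n : ℤ)), y ∈ I ∧ y ≠ 0 := by
  classical
  have hex := G.exists_ad_e_pow_eq_zero i x
  obtain ⟨p, hp0, hp1⟩ := Nat.exists_not_and_succ_of_not_zero_of_exists
    (p := fun n => (LieAlgebra.ad K L (e i) ^ n) x = 0) (by simpa using hx0) hex
  obtain ⟨hyI, hy⟩ := ad_pow_mem I (G.e_mem i) hx hxI p
  set y := (LieAlgebra.ad K L (e i) ^ p) x with hydef
  have hPr : (G.isSl2Triple hA i).HasPrimitiveVectorWith y ((n + 2 * p : ℕ) : K) := by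
    refine ⟨hp0, ?_, ?_⟩
    · rw [mem_latticeWeightSpace.1 hy]
      congr 1
      rw [Matrix.mulVec_add, Matrix.mulVec_smul, Pi.add_apply, Pi.smul_apply, hn,
        mulVec_single_apply, hA.diag]
      push_cast
      simp
      ring
    · rw [pow_succ', Module.End.mul_apply] at hp1
      exact hp1
  -- Applying `e_i` to `f_i ^ (m + 1) y` gives `(m + 1)(n + 2p - m) f_i ^ m y`, whose coefficient is
  -- nonzero in this range.
  have hne : ∀ m ≤ n + 2 * p, (LieModule.toEnd K L L (f i) ^ m) y ≠ 0 := by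
    intro m
    induction m with
    | zero => intro _; simpa using hp0
    | succ m ih =>
      intro hm h0
      have h1 := hPr.lie_e_pow_succ_toEnd_f m
      rw [h0, lie_zero, eq_comm, smul_eq_zero] at h1
      refine h1.elim (fun h2 => ?_) (ih (by omega))
      rw [mul_eq_zero, sub_eq_zero] at h2
      rcases h2 with h2 | h2
      · exact absurd h2 (by exact_mod_cast Nat.succ_ne_zero m)
      · have h3 : n + 2 * p = m := by exact_mod_cast h2
        omega
  -- After `p` steps up, `n + p` steps down lead to `β - n α_i`, the reflection of `β`.
  obtain ⟨hzI, hz⟩ := ad_pow_mem I (G.f_mem i) hy hyI (n + p)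
  refine ⟨_, ?_, hzI, hne (n + p) (by omega)⟩
  have hβ : β - Pi.single i (n : ℤ) =
      β + p • Pi.single i 1 + (n + p) • -(Pi.single i 1 : ι → ℤ) := by
    ext j
    rcases eq_or_ne j i with rfl | hj
    · simp
      ring
    · simp [hj]
  rw [hβ]
  exact hz

theorem form_reflection (hA : IsSymmetricSimplyLaced A) (β : ι → ℤ) (i : ι) :
    ∑ j, (β - Pi.single i (A.mulVec β i) : ι → ℤ) j * A.mulVec (β - Pi.single i (A.mulVec β i)) j =
      ∑ j, β j * A.mulVec β j := by
  set n := A.mulVec β i with hn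
  have h1 : ∀ j, A.mulVec (β - Pi.single i n) j = A.mulVec β j - A j i * n := by
    intro j
    rw [Matrix.mulVec_sub, Pi.sub_apply, mulVec_single_apply]
  have h2 : ∑ j, β j * A j i = n := by
    rw [hn, Matrix.mulVec, dotProduct]
    exact Finset.sum_congr rfl fun j _ => by rw [hA.symm j i, mul_comm]
  have h3 : ∑ j, (Pi.single i n : ι → ℤ) j * (A.mulVec β j - A j i * n) = n * (n - 2 * n) := by
    rw [Finset.sum_eq_single i (fun j _ hj => by simp [hj]) (by simp), Pi.single_eq_same,
      hA.diag, ← hn]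
  simp only [h1, Pi.sub_apply, sub_mul]
  rw [Finset.sum_sub_distrib, h3]
  simp only [mul_sub, Finset.sum_sub_distrib, ← mul_assoc]
  rw [← Finset.sum_mul, h2]
  ring

/-- A positive weight of an ideal has norm `2`, and the ideal contains a raising generator. -/
theorem form_eq_two_of_nonneg (G : IsSerreGenerators K A h e f) (P : IsPositiveSimplyLaced A)
    (I : LieIdeal K L) {β : ι → ℤ} (hβ : 0 ≤ β) (hβ0 : β ≠ 0) {x : L}
    (hx : x ∈ latticeWeightSpace K A h β) (hxI : x ∈ I) (hx0 : x ≠ 0) :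
    ∑ j, β j * A.mulVec β j = 2 ∧ ∃ i, e i ∈ I := by
  induction hN : (∑ j, β j).toNat using Nat.strong_induction_on generalizing β x with
  | _ N ih =>
    have hpos := P.pos β hβ0
    -- Positivity of the form yields a node in the support of `β` at which the reflection strictly
    -- lowers the height.
    obtain ⟨i, -, hi⟩ := Finset.exists_lt_of_sum_lt
      (f := fun _ => (0 : ℤ)) (g := fun j => β j * A.mulVec β j) (s := Finset.univ)
      (by simpa using hpos)
    have hi0 : 0 ≤ β i := hβ i
    have hi1 : 0 < β i := lt_of_le_of_ne hi0 fun h0 => by simp [← h0] at hi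
    have hn : 0 < A.mulVec β i := pos_of_mul_pos_right hi hi0
    obtain ⟨n, hn'⟩ := Int.eq_ofNat_of_zero_le hn.le
    obtain ⟨y, hy, hyI, hy0⟩ := G.exists_mem_reflection P.toIsSymmetricSimplyLaced I hn' hx hxI hx0
    have hform := form_reflection P.toIsSymmetricSimplyLaced β i
    rw [hn'] at hform
    -- Either the reflected weight is still nonnegative, and induction applies since the norm is
    -- preserved, or it has a negative entry. In the latter case it must be nonpositive, so `β` is
    -- supported at `i` and is the simple root.
    rcases le_or_gt (n : ℤ) (β i) with hle | hlt
    · have hγ : 0 ≤ β - Pi.single i (n : ℤ) := by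
        intro j
        rcases eq_or_ne j i with rfl | hj
        · simpa using hle
        · simpa [hj] using hβ j
      have hγ0 : β - Pi.single i (n : ℤ) ≠ 0 := by
        intro h0
        rw [h0] at hform
        simp at hform
        omega
      have hsum : ∑ j, (β - Pi.single i (n : ℤ) : ι → ℤ) j = ∑ j, β j - n := by
        simp [Finset.sum_sub_distrib]
      have hγs : 0 ≤ ∑ j, (β - Pi.single i (n : ℤ) : ι → ℤ) j := Finset.sum_nonneg fun j _ => hγ j
      have := ih _ (by omega) hγ hγ0 hy hyI hy0 rfl
      rw [hform] at this
      exact this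
    · have hγ : β - Pi.single i (n : ℤ) ≤ 0 := by
        refine (G.nonneg_or_nonpos P hy hy0).resolve_left fun h0 => ?_
        have := h0 i
        simp at this
        omega
      have hβi : β = Pi.single i (β i) := by
        ext j
        rcases eq_or_ne j i with rfl | hj
        · simp
        · have h1 := hγ j
          have h2 := hβ j
          simp [hj] at h1 h2 ⊢
          omega
      rw [hβi] at hx
      obtain ⟨h1, h2⟩ := G.eq_one_and_mem_span P hi1 hx hx0
      constructor
      · rw [hβi, h1, Finset.sum_eq_single i (fun j _ hj => by simp [hj]) (by simp),
          mulVec_single_apply, P.diag, Pi.single_eq_same]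
        norm_num
      · obtain ⟨c, rfl⟩ := Submodule.mem_span_singleton.1 h2
        refine ⟨i, ?_⟩
        have hc : c ≠ 0 := by rintro rfl; simp at hx0
        have := I.smul_mem c⁻¹ hxI
        rwa [inv_smul_smul₀ hc] at this

omit [Fintype ι] [DecidableEq ι] in
theorem e_mem_of_f_mem (G : IsSerreGenerators K A h e f) (hA : IsSymmetricSimplyLaced A)
    (I : LieIdeal K L) {i : ι} (hi : f i ∈ I) : e i ∈ I := by
  have h1 : h i ∈ I := by
    rw [← G.ef_same]
    exact lie_mem_right K L I _ _ hi
  have h2 : ⁅h i, e i⁆ ∈ I := lie_mem_left K L I _ _ h1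
  rw [G.lie_h_e, hA.diag] at h2
  have h3 := I.smul_mem (((2 : ℤ) : K)⁻¹) h2
  rwa [inv_smul_smul₀ (by norm_num)] at h3

omit [CharZero K] [DecidableEq ι] in
theorem lie_sum_h_e (G : IsSerreGenerators K A h e f) (c : ι → K) (j : ι) :
    ⁅∑ i, c i • h i, e j⁆ = (∑ i, c i * (A i j : K)) • e j := by
  rw [sum_lie, Finset.sum_smul]
  exact Finset.sum_congr rfl fun i _ => by rw [smul_lie, G.lie_h_e, smul_smul]

theorem eq_zero_of_sum_mul_eq_zero (P : IsPositiveSimplyLaced A) {c : ι → K}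
    (hc : ∀ j, ∑ i, c i * (A i j : K) = 0) : c = 0 := by
  have hdet : (A.map (Int.cast : ℤ → K)).det ≠ 0 := by
    have h1 := (Int.castRingHom K).map_det A
    have h2 : (Int.castRingHom K) A.det ≠ 0 := by
      simpa using P.det_ne_zero
    rw [h1] at h2
    exact h2
  refine Matrix.eq_zero_of_vecMul_eq_zero hdet (funext fun j => ?_)
  simpa [Matrix.vecMul, dotProduct] using hc j

theorem linearIndependent_h (G : IsSerreGenerators K A h e f) (P : IsPositiveSimplyLaced A) :
    LinearIndependent K h := by
  rw [Fintype.linearIndependent_iff]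
  intro c hc i
  refine congrFun (eq_zero_of_sum_mul_eq_zero P fun j => ?_) i
  have := G.lie_sum_h_e c j
  rw [hc, zero_lie, eq_comm, smul_eq_zero] at this
  exact this.resolve_right (G.e_ne_zero j)

/-- A nonzero ideal contains a raising generator. -/
theorem exists_e_mem (G : IsSerreGenerators K A h e f) (P : IsPositiveSimplyLaced A)
    (I : LieIdeal K L) (hI : I ≠ ⊥) : ∃ i, e i ∈ I := by
  obtain ⟨x, hxI, hx0⟩ : ∃ x ∈ I, x ≠ 0 := by
    by_contra! hcon
    exact hI ((LieSubmodule.eq_bot_iff I).2 hcon)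
  obtain ⟨s, y, hy, hs⟩ := G.exists_sum_eq P.toIsSymmetricSimplyLaced x
  have hyI := mem_of_sum_mem (K := K) (A := A) (h := h) (fun b => P.eq_zero_of_mulVec_eq_zero)
    I.toSubmodule (fun i x hx => lie_mem_right K L I _ _ hx) s y (fun β _ => G.wordSpace_le β (hy β))
    (by rw [hs]; exact hxI)
  obtain ⟨β, hβs, hβ0⟩ : ∃ β ∈ s, y β ≠ 0 := by
    by_contra! hcon
    rw [Finset.sum_eq_zero hcon] at hs
    exact hx0 hs.symm
  have hβW := G.wordSpace_le β (hy β)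
  have hβI : y β ∈ I := hyI β hβs
  rcases eq_or_ne β 0 with rfl | hne
  -- Nonempty words have nonzero content, so weight zero is spanned by coroots. As the matrix is
  -- invertible, some root is nonzero on this component and recovers its `e_j`.
  · have hspan : y 0 ∈ Submodule.span K (Set.range h) := by
      refine (?_ : wordSpace K h e f 0 ≤ _) (hy 0)
      refine Submodule.span_le.2 ?_
      rintro _ (⟨w, hw, rfl⟩ | ⟨-, h0⟩ | ⟨w, hw, rfl⟩)
      · rcases eq_or_ne w [] with rfl | hw0
        · exact zero_mem _
        · exact absurd hw (wordContent_ne_zero hw0)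
      · exact Submodule.subset_span h0
      · rcases eq_or_ne w [] with rfl | hw0
        · exact zero_mem _
        · exact absurd (neg_eq_zero.1 hw) (wordContent_ne_zero hw0)
    obtain ⟨c, hc⟩ := (Submodule.mem_span_range_iff_exists_fun K).1 hspan
    have hc0 : c ≠ 0 := by
      rintro rfl
      exact hβ0 (by rw [← hc]; simp)
    obtain ⟨j, hj⟩ : ∃ j, ∑ i, c i * (A i j : K) ≠ 0 := by
      by_contra! hcon
      exact hc0 (eq_zero_of_sum_mul_eq_zero P hcon)
    refine ⟨j, ?_⟩
    have h1 : ⁅y 0, e j⁆ ∈ I := lie_mem_left K L I _ _ hβI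
    rw [← hc, G.lie_sum_h_e] at h1
    have := I.smul_mem (∑ i, c i * (A i j : K))⁻¹ h1
    rwa [inv_smul_smul₀ hj] at this
  · rcases G.nonneg_or_nonpos P hβW hβ0 with h1 | h1
    · exact (G.form_eq_two_of_nonneg P I h1 hne hβW hβI hβ0).2
    · obtain ⟨-, i, hi⟩ := (G.symm P.toIsSymmetricSimplyLaced).form_eq_two_of_nonneg P I
        (β := -β) (neg_nonneg.2 h1) (neg_ne_zero.2 hne) (by rwa [latticeWeightSpace_neg]) hβI hβ0
      exact ⟨i, G.e_mem_of_f_mem P.toIsSymmetricSimplyLaced I hi⟩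

/-- The ideal `⊤` shows that a nonzero word has content of norm `2`. The bound on coefficients then
bounds its length, and the alphabet is finite. -/
theorem finite_range_lieWord (G : IsSerreGenerators K A h e f) (P : IsPositiveSimplyLaced A) :
    (Set.range (lieWord e)).Finite := by
  obtain ⟨N, hN⟩ := P.bounded
  refine Set.Finite.subset (((List.finite_length_le ι (Fintype.card ι * N)).image
    (lieWord e)).insert 0) ?_
  rintro _ ⟨w, rfl⟩
  by_cases hw0 : lieWord e w = 0
  · exact Or.inl hw0
  · refine Or.inr ⟨w, ?_, rfl⟩
    have hw : w ≠ [] := by rintro rfl; exact hw0 rfl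
    have h1 := (G.form_eq_two_of_nonneg P ⊤ (wordContent_nonneg w) (wordContent_ne_zero hw)
      (G.lieWord_e_mem w) (LieSubmodule.mem_top _) hw0).1
    have h2 : ∀ i ∈ Finset.univ, w.count i ≤ N := fun i _ => by
      have := hN _ h1 i
      simpa [wordContent] using this
    have h3 := Finset.sum_le_card_nsmul _ _ _ h2
    rw [smul_eq_mul, Finset.card_univ] at h3
    have h4 : ∑ i, w.count i = w.length := by
      have := Multiset.sum_count_eq_card (s := Finset.univ) (m := (w : Multiset ι)) (by simp)
      simpa using this
    simpa [h4] using h3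

theorem finiteDimensional (G : IsSerreGenerators K A h e f) (P : IsPositiveSimplyLaced A) :
    FiniteDimensional K L := by
  refine ⟨?_⟩
  rw [← G.spanningSubmodule_eq_top P.toIsSymmetricSimplyLaced]
  exact Submodule.fg_span (((G.finite_range_lieWord P).union (Set.finite_range h)).union
    ((G.symm P.toIsSymmetricSimplyLaced).finite_range_lieWord P))

/-- A nonzero ideal contains some `e_i`, hence `h_i = [e_i, f_i]`, and `[h_i, e_i] = 2 e_i ≠ 0`
prevents it from being abelian. -/
theorem hasTrivialRadical (G : IsSerreGenerators K A h e f) (P : IsPositiveSimplyLaced A) :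
    LieAlgebra.HasTrivialRadical K L := by
  rw [LieAlgebra.hasTrivialRadical_iff_no_abelian_ideals]
  intro I hI
  by_contra hne
  obtain ⟨i, hi⟩ := G.exists_e_mem P I hne
  have h1 : h i ∈ I := by
    rw [← G.ef_same]
    exact lie_mem_left K L I _ _ hi
  have h2 : ⁅(⟨h i, h1⟩ : I), (⟨e i, hi⟩ : I)⁆ = 0 := trivial_lie_zero _ _ _ _
  have h3 : ⁅h i, e i⁆ = 0 := congrArg Subtype.val h2
  rw [G.lie_h_e, P.diag, smul_eq_zero] at h3
  exact h3.elim (by norm_num) (G.e_ne_zero i)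

/-- The basis, in the sense of split semisimple Lie algebras, given by a Serre family. -/
def lieBasis (G : IsSerreGenerators K A h e f) (P : IsPositiveSimplyLaced A) :
    LieAlgebra.Basis ι (LieSubalgebra.lieSpan K L (Set.range h)) where
  A := A
  h := h
  e := e
  f := f
  cartan_eq_lieSpan := rfl
  span_ef := G.lieSpan_eq_top
  linInd := G.linearIndependent_h P
  nondegen := Matrix.nondegenerate_of_det_ne_zero P.det_ne_zero
  sl2 := G.isSl2Triple P.toIsSymmetricSimplyLaced
  lie_h_h := G.hh
  lie_h_e i j := by rw [G.he, P.symm]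
  lie_h_f i j := by rw [G.hf, P.symm, neg_smul]
  lie_e_f_ne := G.ef_ne

/-- The subalgebra generated by the coroots is just their span, and it acts by a scalar on every
word space. -/
theorem isTriangularizable (G : IsSerreGenerators K A h e f) (P : IsPositiveSimplyLaced A) :
    LieModule.IsTriangularizable K (LieSubalgebra.lieSpan K L (Set.range h)) L := by
  refine ⟨fun x => ?_⟩
  have hx : (x : L) ∈ Submodule.span K (Set.range h) := by
    have hH := (G.lieBasis P).coe_cartan_eq_span
    have hx' : (x : L) ∈ (LieSubalgebra.lieSpan K L (Set.range h)).toSubmodule := x.2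
    rwa [hH] at hx'
  obtain ⟨c, hc⟩ := (Submodule.mem_span_range_iff_exists_fun K).1 hx
  rw [eq_top_iff]
  intro y _
  obtain ⟨s, z, hz, rfl⟩ := G.exists_sum_eq P.toIsSymmetricSimplyLaced y
  refine sum_mem fun β _ => ?_
  refine Submodule.mem_iSup_of_mem (∑ i, c i * ((A.mulVec β i : ℤ) : K)) ?_
  refine Module.End.mem_maxGenEigenspace _ _ _ |>.2 ⟨1, ?_⟩
  have hW := mem_latticeWeightSpace.1 (G.wordSpace_le β (hz β))
  have : ⁅x, z β⁆ = (∑ i, c i * ((A.mulVec β i : ℤ) : K)) • z β := by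
    change ⁅(x : L), z β⁆ = _
    rw [← hc, sum_lie, Finset.sum_smul]
    exact Finset.sum_congr rfl fun i _ => by rw [smul_lie, hW, smul_smul]
  simp [this]

theorem isSplitSemisimpleOfType (G : IsSerreGenerators K A h e f) (P : IsPositiveSimplyLaced A) :
    IsSplitSemisimpleOfType K L A := by
  have _ := G.finiteDimensional P
  have _ := G.hasTrivialRadical P
  have _ := G.isTriangularizable P
  refine ⟨G.finiteDimensional P, inferInstance, _, (G.lieBasis P).isCartanSubalgebra,
    G.isTriangularizable P, (G.lieBasis P).base, (G.lieBasis P).baseSupportEquiv, fun i j => ?_⟩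
  rw [(G.lieBasis P).cartanMatrix_base_eq, Matrix.reindex_apply, Matrix.submatrix_apply,
    Equiv.symm_apply_apply, Equiv.symm_apply_apply]
  rfl

end IsSerreGenerators

/-! ### Application to `E_k` and assembly of the three cases. -/

theorem ESeries.form_intCast (k : ℕ) (b : Fin k → ℤ) :
    ((∑ i, b i * (cartanMatrix k).mulVec b i : ℤ) : ℝ) = ∑ i, (fun j => (b j : ℝ)) i *
      ((cartanMatrix k).map (Int.cast : ℤ → ℝ)).mulVec (fun j => (b j : ℝ)) i := by
  push_cast [Matrix.mulVec, dotProduct]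
  rfl

theorem ESeries.isPositiveSimplyLaced {k : ℕ} (hk : 3 ≤ k) (hk8 : k ≤ 8) :
    IsPositiveSimplyLaced (ESeries.cartanMatrix k) where
  toIsSymmetricSimplyLaced := isSymmetricSimplyLaced k
  pos b hb := by
    have hb' : (fun j => (b j : ℝ)) ≠ 0 := by
      intro h
      refine hb (funext fun j => ?_)
      simpa using congrFun h j
    have h := form_pos hk hk8 hb'
    rw [← form_intCast] at h
    exact_mod_cast h
  bounded := by
    refine ⟨80, fun b hb i => ?_⟩
    have h : ((∑ i, b i * (cartanMatrix k).mulVec b i : ℤ) : ℝ) = 2 := by rw [hb]; norm_num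
    rw [form_intCast] at h
    have := coeff_le_of_form_eq_two hk hk8 h i
    exact_mod_cast this

theorem Matrix.ToLieAlgebra.isSerreGenerators {ι : Type*} [DecidableEq ι] (K : Type*) [Field K]
    {A : Matrix ι ι ℤ} (hA : IsSymmetricSimplyLaced A) :
    IsSerreGenerators K A (fun i => gen K A (.H i)) (fun i => gen K A (.E i))
      (fun i => gen K A (.F i)) where
  toIsSerreFamily := isSerreFamily_gen K A
  lieSpan_eq_top := by
    rw [eq_top_iff, ← lieSpan_range_gen K A, LieSubalgebra.lieSpan_le]
    rintro _ ⟨x | x | x, rfl⟩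
    · rw [← (isSerreFamily_gen K A).ef_same]
      exact LieSubalgebra.lie_mem _ (LieSubalgebra.subset_lieSpan (Or.inl ⟨x, rfl⟩))
        (LieSubalgebra.subset_lieSpan (Or.inr ⟨x, rfl⟩))
    · exact LieSubalgebra.subset_lieSpan (Or.inl ⟨x, rfl⟩)
    · exact LieSubalgebra.subset_lieSpan (Or.inr ⟨x, rfl⟩)
  e_ne_zero := gen_E_ne_zero K hA

theorem ESeries.isSplitSemisimpleOfType (K : Type*) [Field K] [CharZero K] {k : ℕ} (hk : 3 ≤ k)
    (hk8 : k ≤ 8) : IsSplitSemisimpleOfType K (ESeries.E K k) (ESeries.cartanMatrix k) :=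
  (Matrix.ToLieAlgebra.isSerreGenerators K (isSymmetricSimplyLaced k)).isSplitSemisimpleOfType
    (isPositiveSimplyLaced hk hk8)

theorem proposition4p2 :
    -- (i) finite-dimensional case
    (∀ k : ℕ, 3 ≤ k → k ≤ 8 →
      IsSplitSemisimpleOfType ℂ (ESeries.E ℂ k) (ESeries.cartanMatrix k) ∧
      IsSplitSemisimpleOfType ℝ (ESeries.E ℝ k) (ESeries.cartanMatrix k) ∧
      ESeries.IsStandardSplitForm k ∧
      ESeries.IsTrivialCentralExtension k) ∧
    -- (ii) affine case
    (IsAffineType (ESeries.cartanMatrix 9) ∧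
      IsRealization ℝ (ESeries.cartanMatrix 9) (ESeries.root 9) (ESeries.coroot 9) ∧
      (∀ (V : Type*) [AddCommGroup V] [Module ℝ V]
        (α : Fin 9 → Module.Dual ℝ V) (αv : Fin 9 → V),
        IsRealization ℝ (ESeries.cartanMatrix 9) α αv →
        ∃ (Φ : ESeries.G 9 ≃ₗ⁅ℝ⁆ ChevalleyAlgebra ℝ α αv) (φ : ESeries.Cartan 9 ≃ₗ[ℝ] V),
          (∀ x, Φ (ESeries.gh 9 x) = ChevalleyAlgebra.gen ℝ α αv (.h (φ x))) ∧
          (∀ i, φ (ESeries.coroot 9 i) = αv i) ∧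
          (∀ i x, α i (φ x) = ESeries.root 9 i x) ∧
          ∀ i, Φ (ESeries.ge 9 i) = ChevalleyAlgebra.gen ℝ α αv (.e i) ∧
            Φ (ESeries.gf 9 i) = ChevalleyAlgebra.gen ℝ α αv (.f i)) ∧
      (∀ (W : Type*) [AddCommGroup W] [Module ℂ W]
        (α : Fin 9 → Module.Dual ℂ W) (αv : Fin 9 → W),
        IsRealization ℂ (ESeries.cartanMatrix 9) α αv →
        ∃ (Ψ : (ℂ ⊗[ℝ] ESeries.G 9) ≃ₗ⁅ℂ⁆ ChevalleyAlgebra ℂ α αv)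
          (ψ : (ℂ ⊗[ℝ] ESeries.Cartan 9) ≃ₗ[ℂ] W),
          (∀ x, Ψ (1 ⊗ₜ[ℝ] ESeries.gh 9 x) =
            ChevalleyAlgebra.gen ℂ α αv (.h (ψ (1 ⊗ₜ[ℝ] x)))) ∧
          (∀ i, ψ (1 ⊗ₜ[ℝ] ESeries.coroot 9 i) = αv i) ∧
          (∀ i x, α i (ψ (1 ⊗ₜ[ℝ] x)) = (ESeries.root 9 i x : ℂ)) ∧
          ∀ i, Ψ (1 ⊗ₜ[ℝ] ESeries.ge 9 i) = ChevalleyAlgebra.gen ℂ α αv (.e i) ∧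
            Ψ (1 ⊗ₜ[ℝ] ESeries.gf 9 i) = ChevalleyAlgebra.gen ℂ α αv (.f i))) ∧
    -- (iii) indefinite case
    (∀ k : ℕ, 10 ≤ k →
      IsIndefiniteType (ESeries.cartanMatrix k) ∧
      ESeries.IsStandardSplitForm k ∧
      ESeries.IsTrivialCentralExtension k) := by
  refine ⟨fun k hk hk8 => ⟨ESeries.isSplitSemisimpleOfType ℂ hk hk8,
    ESeries.isSplitSemisimpleOfType ℝ hk hk8, ESeries.isStandardSplitForm k,
    ESeries.isTrivialCentralExtension hk (by omega)⟩,
    ⟨ESeries.isAffineType_nine, ESeries.isRealization_nine, ?_, ?_⟩,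
    fun k hk => ⟨ESeries.isIndefiniteType hk, ESeries.isStandardSplitForm k,
      ESeries.isTrivialCentralExtension (by omega) (by omega)⟩⟩
  · intro V _ _ α αv H
    obtain ⟨φ, h1, h2⟩ := ESeries.exists_equiv_of_isRealization ESeries.isRealization_nine H
    obtain ⟨Φ, h3, h4⟩ := ChevalleyAlgebra.exists_equiv φ h2 h1
    exact ⟨Φ, φ, h3, h1, h2, h4⟩
  · intro W _ _ α αv H
    obtain ⟨ψ, h1, h2⟩ :=
      ESeries.exists_baseChange_equiv_of_isRealization ESeries.isRealization_nine H
    obtain ⟨Ψ, h3, h4⟩ := ChevalleyAlgebra.exists_baseChange_equiv ψ h2 h1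
    exact ⟨Ψ, ψ, h3, h1, h2, h4⟩
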